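/- **Theorem.** *Notation.* For a complex matrix $A$ let $\|A\|$ be the maximum of its largest absolute row sum and its largest absolute column sum, and for a triplet let $\|(U,V,\Sigma)\|=\max(\|U\|,\|V\|,\|\Sigma\|)$. For $W\in\mathbb C^{a\times b}$ let $E_b(W)=W^*W-I_b$ and $\mathrm{St}_{a,b}=\{W: E_b(W)=0\}$. Let $M\in\mathbb C^{m\times n}$, $q\le\ell$, and let $q=q_1+\cdots+q_e$ with integers $q_i\ge 1$; this splits $\{1,\dots,q\}$ into consecutive blocks of lengths $q_1,\dots,q_e$. For a matrix $A$ whose numbers of rows and columns are at least $q$, $\mathrm{Diag}(A)=\mathrm{Diag}_{q_1\ldots q_e}(A)$ is obtained from $A$ by replacing with $0$ every entry $(i,j)$ for which $i,j$ do not belong to one and the same block; $\mathbb D^{\ell\times q}_{q_1\ldots q_e}$ is the set of the matrices $\mathrm{Diag}(A)$, $A\in\mathbb C^{\ell\times q}$. Let $p\ge 1$, let $s_p$ be the Taylor polynomial of degree $p$ at $0$ of $(1+u)^{-1/2}-1$, and $c_p$ that of $(1+u^2)^{1/2}+u-1$. *Iteration.* $H_p(U,V,\Sigma)=\big(U(I_\ell+\Omega)(I_\ell+c_p(X_1+\cdots+X_p)),\;V(I_q+\Lambda)(I_q+c_p(Y_1+\cdots+Y_p)),\;\Sigma+S_1+\cdots+S_p\big)$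 for $U\in\mathbb C^{m\times\ell}$, $V\in\mathbb C^{n\times q}$, $\Sigma\in\mathbb D^{\ell\times q}_{q_1\ldots q_e}$, where $\Omega=s_p(E_\ell(U))$, $\Lambda=s_p(E_q(V))$, $\Delta_1=(I_\ell+\Omega)U^*MV(I_q+\Lambda)-\Sigma$, $$\Delta_k=\big(I_\ell+c_p(X_1+\cdots+X_{k-1})^*\big)(\Delta_1+\Sigma)\big(I_q+c_p(Y_1+\cdots+Y_{k-1})\big)-\Sigma-\sum_{j<k}S_j\qquad(2\le k\le p),$$ $S_k=\mathrm{Diag}(\Delta_k)$, and $X_k\in\mathbb C^{\ell\times\ell}$, $Y_k\in\mathbb C^{q\times q}$ are skew-Hermitian with $\mathrm{Diag}(X_k)=0$, $\mathrm{Diag}(Y_k)=0$, $(X_k)_{ij}=0$ for $i,j>q$, and $$\Delta_k-S_k-X_k\Sigma+\Sigma Y_k=0\qquad(1\le k\le p).$$ *Hypotheses.* Let $\delta\ge0$ and let $\Sigma_0=\begin{pmatrix}\mathrm{diag}(\sigma_1,\dots,\sigma_q)\\0\end{pmatrix}\in\mathbb R^{\ell\times q}$ be clustered with size $\delta$: $|\sigma_j-\sigma_k|\le\delta$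 whenever $j,k$ are in the same block and $|\sigma_j-\sigma_k|>\delta$ whenever they are in different blocks. Let all $\sigma_i$ be nonzero and $\sigma_i+\sigma_k\ne0$ whenever $|\sigma_k-\sigma_i|>\delta$ (this holds if all $\sigma_i>0$), and put $$\kappa=\max\Big(1,\max_{i}\frac1{|\sigma_i|},\max_{i<k,\;|\sigma_k-\sigma_i|>\delta}\Big(\frac1{|\sigma_k-\sigma_i|}+\frac1{|\sigma_k+\sigma_i|}\Big)\Big),\qquad K=\max\big(1,\max_i|\sigma_i|\big).$$ Let $(a,u_0)=(2,\,0.0289)$ if $p=1$, $(4/3,\,0.046)$ if $p=2$, $(4/3,\,0.0297)$ if $p\ge3$. Let $U_0\in\mathbb C^{m\times\ell}$, $V_0\in\mathbb C^{n\times q}$ satisfy $$\max\big((\kappa K)^a\|E_\ell(U_0)\|,\;(\kappa K)^a\|E_q(V_0)\|,\;\kappa^aK^{a-1}\|U_0^*MV_0-\Sigma_0\|\big)\le u_0.$$ *Conclusion.* There is exactly one sequence $(U_i,V_i,\Sigma_i)_{i\ge0}$ that starts at $(U_0,V_0,\Sigma_0)$ and satisfies $(U_{i+1},V_{i+1},\Sigma_{i+1})=H_p(U_i,V_i,\Sigma_i)$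 for all $i\ge0$. It converges with order $p+1$ to some $(U_\infty,V_\infty,\Sigma_\infty)\in\mathrm{St}_{m,\ell}\times\mathrm{St}_{n,q}\times\mathbb D^{\ell\times q}_{q_1\ldots q_e}$, that is, there is a constant $C>0$ with $$\|(U_i,V_i,\Sigma_i)-(U_\infty,V_\infty,\Sigma_\infty)\|\le C\,2^{-(p+1)^i+1}\qquad(i\ge0),$$ and $U_\infty^*MV_\infty=\Sigma_\infty$. -/

import Mathlib

open Matrix Finset
open scoped Matrix

noncomputable section

namespace ClusterSVD

/-- The matrix norm `max (‖A‖₁, ‖A*‖₁)`: the maximum of the largest absolute row sum and the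
largest absolute column sum. -/
def mnorm {a b : ℕ} (A : Matrix (Fin a) (Fin b) ℂ) : ℝ :=
  max (⨆ i, ∑ j, ‖A i j‖) (⨆ j, ∑ i, ‖A i j‖)

/-- `E_ℓ(W) = W* W - I_ℓ`. -/
def defect {a b : ℕ} (W : Matrix (Fin a) (Fin b) ℂ) : Matrix (Fin b) (Fin b) ℂ :=
  Wᴴ * W - 1

/-- The Stiefel variety `St_{a,b}`. -/
def Stiefel (a b : ℕ) : Set (Matrix (Fin a) (Fin b) ℂ) :=
  {W | defect W = 0}

/-- The real rectangular diagonal matrix with diagonal `σ` (the rows below the diagonal block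
vanish). -/
def rectDiagonal (l : ℕ) {q : ℕ} (σ : Fin q → ℝ) : Matrix (Fin l) (Fin q) ℂ :=
  Matrix.of fun i j => if (i : ℕ) = (j : ℕ) then ((σ j : ℝ) : ℂ) else 0

/-- The (zero-based) positions `i` and `j` lie in the same block of the partition
`q = q₁ + ⋯ + q_e`; positions `≥ q` lie in no block. -/
def SameBlock {q : ℕ} (c : Composition q) (i j : ℕ) : Prop :=
  ∃ (hi : i < q) (hj : j < q), c.index ⟨i, hi⟩ = c.index ⟨j, hj⟩

open Classical in
/-- `Diag_{q₁,…,q_e}(A)`: keep the diagonal blocks of `A`, put `0` elsewhere. -/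
def blockDiag {q : ℕ} (c : Composition q) {a b : ℕ} (A : Matrix (Fin a) (Fin b) ℂ) :
    Matrix (Fin a) (Fin b) ℂ :=
  Matrix.of fun i j => if SameBlock c (i : ℕ) (j : ℕ) then A i j else 0

/-- `𝔻_{q₁,…,q_e}`: the block-diagonal matrices of size `l × q`. -/
def BlockDiagonal {q : ℕ} (c : Composition q) (l : ℕ) : Set (Matrix (Fin l) (Fin q) ℂ) :=
  Set.range fun A => blockDiag c A

/-- The numbers `σ₁, …, σ_q` form clusters of size `δ` relatively to `q₁, …, q_e`. -/
def IsClustered {q : ℕ} (c : Composition q) (δ : ℝ) (σ : Fin q → ℝ) : Prop :=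
  (∀ j k, c.index j = c.index k → |σ k - σ j| ≤ δ) ∧
  (∀ j k, c.index j ≠ c.index k → δ < |σ k - σ j|)

/-- None of the quotients that occur in the condition number has a zero denominator. (The
differences `σ_k - σ_i` that occur are nonzero because they exceed `δ ≥ 0`.) -/
def Nondegenerate {q : ℕ} (δ : ℝ) (σ : Fin q → ℝ) : Prop :=
  (∀ i, σ i ≠ 0) ∧ ∀ i k, δ < |σ k - σ i| → σ k + σ i ≠ 0

/-- The condition number `κ` in the clusters case. -/
def kappa {q : ℕ} (δ : ℝ) (σ : Fin q → ℝ) : ℝ :=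
  max 1 (max (⨆ i, 1 / |σ i|)
    (⨆ r : {r : Fin q × Fin q // r.1 < r.2 ∧ δ < |σ r.2 - σ r.1|},
      (1 / |σ r.1.2 - σ r.1.1| + 1 / |σ r.1.2 + σ r.1.1|)))

/-- `K = max (1, max |σ_i|)`. -/
def bigK {q : ℕ} (σ : Fin q → ℝ) : ℝ :=
  max 1 (⨆ i, |σ i|)

/-- `s_p`: the truncation at degree `p` of the series of `-1 + (1 + u)^{-1/2}`. -/
def sPoly (p : ℕ) : Polynomial ℝ :=
  ∑ k ∈ Finset.Icc 1 p, Polynomial.C (Ring.choose (-1 / 2 : ℝ) k) * Polynomial.X ^ k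

/-- `c_p`: the truncation at degree `p ≥ 1` of the series of `(1 + u²)^{1/2} + u - 1`. -/
def cPoly (p : ℕ) : Polynomial ℝ :=
  Polynomial.X +
    ∑ k ∈ Finset.Icc 1 (p / 2), Polynomial.C (Ring.choose (1 / 2 : ℝ) k) * Polynomial.X ^ (2 * k)

/-- `s_p(A)`. -/
def sMat (p : ℕ) {a : ℕ} (A : Matrix (Fin a) (Fin a) ℂ) : Matrix (Fin a) (Fin a) ℂ :=
  Polynomial.aeval A (sPoly p)

/-- `c_p(A)`. -/
def cMat (p : ℕ) {a : ℕ} (A : Matrix (Fin a) (Fin a) ℂ) : Matrix (Fin a) (Fin a) ℂ :=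
  Polynomial.aeval A (cPoly p)

/-- Triplets `(U, V, Σ)`. -/
abbrev Triplet (m n l q : ℕ) : Type :=
  Matrix (Fin m) (Fin l) ℂ × Matrix (Fin n) (Fin q) ℂ × Matrix (Fin l) (Fin q) ℂ

/-- The norm on triplets. -/
def tnorm {m n l q : ℕ} (T : Triplet m n l q) : ℝ :=
  max (mnorm T.1) (max (mnorm T.2.1) (mnorm T.2.2))

/-- `(S, X, Y)` solves `D - S - X Σ + Σ Y = 0` with `S = Diag(D)` block-diagonal and `X`, `Y`
skew-Hermitian, normalized by `Diag(X) = 0`, `Diag(Y) = 0` and `x_{ij} = 0` for `i, j > q`. -/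
structure SolvesLinear {q : ℕ} (c : Composition q) {l : ℕ} (Sig D S : Matrix (Fin l) (Fin q) ℂ)
    (X : Matrix (Fin l) (Fin l) ℂ) (Y : Matrix (Fin q) (Fin q) ℂ) : Prop where
  S_eq : S = blockDiag c D
  X_skew : Xᴴ = -X
  Y_skew : Yᴴ = -Y
  X_diag : blockDiag c X = 0
  X_corner : ∀ i j : Fin l, q ≤ (i : ℕ) → q ≤ (j : ℕ) → X i j = 0
  Y_diag : blockDiag c Y = 0
  eq : D - S - X * Sig + Sig * Y = 0

/-- `T' = H_p(T)`, where `T = (U, V, Σ)`, and the families `D` (written `Δ_k` on paper), `S`, `X`,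
`Y`, of which only the indices `1, …, p` matter, are the auxiliary matrices of the definition. -/
def IsStep {m n l q : ℕ} (p : ℕ) (c : Composition q) (M : Matrix (Fin m) (Fin n) ℂ)
    (T T' : Triplet m n l q) : Prop :=
  let U := T.1
  let V := T.2.1
  let Sig := T.2.2
  let Δ := Uᴴ * M * V - Sig
  let Ω := sMat p (defect U)
  let Λ := sMat p (defect V)
  let Δ₁ := (1 + Ω) * (Δ + Sig) * (1 + Λ) - Sig
  ∃ (D S : ℕ → Matrix (Fin l) (Fin q) ℂ) (X : ℕ → Matrix (Fin l) (Fin l) ℂ)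
    (Y : ℕ → Matrix (Fin q) (Fin q) ℂ),
    D 1 = Δ₁ ∧
    (∀ k ∈ Finset.Icc 2 p,
      D k = (1 + (cMat p (∑ j ∈ Finset.Icc 1 (k - 1), X j))ᴴ) * (Δ₁ + Sig) *
          (1 + cMat p (∑ j ∈ Finset.Icc 1 (k - 1), Y j)) - Sig - ∑ j ∈ Finset.Icc 1 (k - 1), S j) ∧
    (∀ k ∈ Finset.Icc 1 p, SolvesLinear c Sig (D k) (S k) (X k) (Y k)) ∧
    T' = (U * (1 + Ω) * (1 + cMat p (∑ j ∈ Finset.Icc 1 p, X j)),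
          V * (1 + Λ) * (1 + cMat p (∑ j ∈ Finset.Icc 1 p, Y j)),
          Sig + ∑ j ∈ Finset.Icc 1 p, S j)

/-- The sequence `T` starts at `T₀` and satisfies `T_{i+1} = H_p(T_i)`. -/
def IsIteration {m n l q : ℕ} (p : ℕ) (c : Composition q) (M : Matrix (Fin m) (Fin n) ℂ)
    (T₀ : Triplet m n l q) (T : ℕ → Triplet m n l q) : Prop :=
  T 0 = T₀ ∧ ∀ i, IsStep p c M (T i) (T (i + 1))

/-- The exponent `a` of the convergence test. -/
def expA (p : ℕ) : ℝ := if p = 1 then 2 else 4 / 3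

/-- The threshold `u₀` of the convergence test. -/
def thresholdU (p : ℕ) : ℝ := if p = 1 then 0.0289 else if p = 2 then 0.046 else 0.0297

/-- The quantity `ε` of the convergence test at `(U₀, V₀, Σ₀)`, where `Σ₀` has diagonal `σ`. -/
def testEps {m n l q : ℕ} (p : ℕ) (δ : ℝ) (σ : Fin q → ℝ) (M : Matrix (Fin m) (Fin n) ℂ)
    (U₀ : Matrix (Fin m) (Fin l) ℂ) (V₀ : Matrix (Fin n) (Fin q) ℂ) : ℝ :=
  max ((kappa δ σ * bigK σ) ^ expA p * mnorm (defect U₀))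
    (max ((kappa δ σ * bigK σ) ^ expA p * mnorm (defect V₀))
      (kappa δ σ ^ expA p * bigK σ ^ (expA p - 1) *
        mnorm (U₀ᴴ * M * V₀ - rectDiagonal l σ)))

/-- `T i` converges to `Tinf` with order `r`:
`‖T i - Tinf‖ ≤ C * 2 ^ (-r ^ i + 1)` for some positive constant `C`. -/
def ConvergesWithOrder {m n l q : ℕ} (r : ℕ) (T : ℕ → Triplet m n l q)
    (Tinf : Triplet m n l q) : Prop :=
  ∃ C : ℝ, 0 < C ∧ ∀ i : ℕ, tnorm (T i - Tinf) ≤ C * (2 : ℝ) ^ (-(r : ℤ) ^ i + 1)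

end ClusterSVD

end

/-!
The three quantities that the iteration drives to zero are the defects `E(U)`, `E(V)` and the
residual `U* M V - Σ`. One step first makes `U` and `V` almost unitary by the Taylor polynomial of
`(1 + u)^{-1/2}`; this changes a defect of size `E` into one of size `E^{p+1}`
(`mnorm_sMat_residual_le`). The factors `1 + c_p(W)` are unitary up to terms of order `p + 1` for
skew-Hermitian `W`, because `(1 + u²)^{1/2} + u` has modulus one at imaginary arguments
(`mnorm_cMat_residual_le`).

The corrections `X_k`, `Y_k`, `S_k` remove from the remainder `Δ_k` its linear part. At the initial
diagonal matrix the linear equation `X Σ - Σ Y = A` decouples into systems of two equations for the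
entries `(i, j)` and `(j, i)`, whose solutions are bounded by means of the condition number `κ`; in
the norm, `‖X‖ ≤ 3/2 κ ‖A‖` and `‖Y‖ ≤ κ ‖A‖` (`Conditioned.solvableWith`). If there is only one
block then `Y = 0` and `‖X‖ ≤ κ ‖A‖`; if there are two blocks then `κ K ≥ 2`, which compensates for
the larger constants. The equation stays uniquely solvable and keeps its bounds, up to a factor,
for matrices `Σ` close to the initial one (`SolvableWith.bound_perturbed`, `SolvableWith.exists`).

By the linear equation, the next remainder is the increment of a non-linear expression in the sums
of the `X_j`, `Y_j`. Its terms of orders two and three in these sums that involve `Σ` combine, again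
by the linear equation, into products with `X Σ - Σ Y`, which has the size of the first remainder.
So each correction multiplies the remainder by a factor proportional to the error
(`mnorm_nonlin_sub_le`, `IsChain.mnorm_remainder_succ_le`), and `p` corrections reduce it to
order `p + 1` (`decay_of_contraction`). For `p ≥ 2`, only terms of order at least four are
bounded by means of `‖Σ‖` itself; this is why the errors are measured with weights that are powers
of `h = (κ K)^{1/3}`, namely `h⁴` for the defects and `κ h` for the residual. For `p = 1` such a term
occurs already in order two, and the weights `h²` and `κ h` are formed with `h = κ K`.

With these weights, a step leads from the error `ε` to at most `(G ε)^p ε`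
(`HighOrderConstants.contracts`, `FirstOrderConstants.contracts`). The first step starts exactly at
the diagonal matrix, so its constant is better than the constant of the later steps, which
take the displacement of `Σ` into account; with the constants of `Conditioned.contracts_of_two_le`
and `Conditioned.contracts_one` the errors decrease like `2 ^ (-(p + 1) ^ i)`, and the total
displacement of `Σ` stays small enough (`exists_unique_iteration`). The increments of the iteration
are bounded by the errors, so it converges at the same rate, and the errors of the limit vanish
(`converges_of_bounds`).
-/

namespace ClusterSVD

/-! ### The matrix norm -/

section Norm

variable {a b d : ℕ}

lemma sum_row_le_mnorm (A : Matrix (Fin a) (Fin b) ℂ) (i : Fin a) :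
    ∑ j, ‖A i j‖ ≤ mnorm A :=
  le_trans (le_ciSup (f := fun i => ∑ j, ‖A i j‖) (Set.finite_range _).bddAbove i)
    (le_max_left _ _)

lemma sum_col_le_mnorm (A : Matrix (Fin a) (Fin b) ℂ) (j : Fin b) :
    ∑ i, ‖A i j‖ ≤ mnorm A :=
  le_trans (le_ciSup (f := fun j => ∑ i, ‖A i j‖) (Set.finite_range _).bddAbove j)
    (le_max_right _ _)

lemma mnorm_nonneg (A : Matrix (Fin a) (Fin b) ℂ) : 0 ≤ mnorm A :=
  le_trans (Real.iSup_nonneg fun _ => Finset.sum_nonneg fun _ _ => norm_nonneg _)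
    (le_max_left _ _)

lemma mnorm_le {A : Matrix (Fin a) (Fin b) ℂ} {C : ℝ} (hC : 0 ≤ C)
    (hr : ∀ i, ∑ j, ‖A i j‖ ≤ C) (hc : ∀ j, ∑ i, ‖A i j‖ ≤ C) : mnorm A ≤ C :=
  max_le (Real.iSup_le hr hC) (Real.iSup_le hc hC)

lemma norm_entry_le_mnorm (A : Matrix (Fin a) (Fin b) ℂ) (i : Fin a) (j : Fin b) :
    ‖A i j‖ ≤ mnorm A :=
  le_trans (Finset.single_le_sum (f := fun j => ‖A i j‖) (fun _ _ => norm_nonneg _)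
    (Finset.mem_univ j)) (sum_row_le_mnorm A i)

lemma mnorm_le_of_norm_entry_le {A : Matrix (Fin a) (Fin b) ℂ} {C : ℝ} (hC : 0 ≤ C)
    (h : ∀ i j, ‖A i j‖ ≤ C) : mnorm A ≤ (a + b) * C := by
  have ha : (0 : ℝ) ≤ a := Nat.cast_nonneg a
  have hb : (0 : ℝ) ≤ b := Nat.cast_nonneg b
  refine mnorm_le (by positivity) (fun i => ?_) (fun j => ?_)
  · calc ∑ j, ‖A i j‖ ≤ ∑ _j : Fin b, C := Finset.sum_le_sum fun j _ => h i j
      _ = b * C := by simp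
      _ ≤ _ := by nlinarith
  · calc ∑ i, ‖A i j‖ ≤ ∑ _i : Fin a, C := Finset.sum_le_sum fun i _ => h i j
      _ = a * C := by simp
      _ ≤ _ := by nlinarith

lemma mnorm_mono {A B : Matrix (Fin a) (Fin b) ℂ} (h : ∀ i j, ‖A i j‖ ≤ ‖B i j‖) :
    mnorm A ≤ mnorm B :=
  mnorm_le (mnorm_nonneg B)
    (fun i => (Finset.sum_le_sum fun j _ => h i j).trans (sum_row_le_mnorm B i))
    (fun j => (Finset.sum_le_sum fun i _ => h i j).trans (sum_col_le_mnorm B j))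

@[simp] lemma mnorm_zero : mnorm (0 : Matrix (Fin a) (Fin b) ℂ) = 0 :=
  le_antisymm (mnorm_le le_rfl (by simp) (by simp)) (mnorm_nonneg _)

lemma eq_zero_of_mnorm_le_zero {A : Matrix (Fin a) (Fin b) ℂ} (h : mnorm A ≤ 0) : A = 0 := by
  ext i j
  simpa using (norm_entry_le_mnorm A i j).trans h

lemma mnorm_add_le (A B : Matrix (Fin a) (Fin b) ℂ) : mnorm (A + B) ≤ mnorm A + mnorm B := by
  refine mnorm_le (add_nonneg (mnorm_nonneg A) (mnorm_nonneg B)) (fun i => ?_) (fun j => ?_)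
  · calc ∑ j, ‖(A + B) i j‖ ≤ ∑ j, (‖A i j‖ + ‖B i j‖) :=
          Finset.sum_le_sum fun j _ => norm_add_le _ _
      _ ≤ _ := by
          rw [Finset.sum_add_distrib]
          exact add_le_add (sum_row_le_mnorm A i) (sum_row_le_mnorm B i)
  · calc ∑ i, ‖(A + B) i j‖ ≤ ∑ i, (‖A i j‖ + ‖B i j‖) :=
          Finset.sum_le_sum fun j _ => norm_add_le _ _
      _ ≤ _ := by
          rw [Finset.sum_add_distrib]
          exact add_le_add (sum_col_le_mnorm A j) (sum_col_le_mnorm B j)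

@[simp] lemma mnorm_neg (A : Matrix (Fin a) (Fin b) ℂ) : mnorm (-A) = mnorm A :=
  le_antisymm (mnorm_mono (by simp)) (mnorm_mono (by simp))

lemma mnorm_sub_le (A B : Matrix (Fin a) (Fin b) ℂ) : mnorm (A - B) ≤ mnorm A + mnorm B := by
  rw [sub_eq_add_neg, ← mnorm_neg B]
  exact mnorm_add_le _ _

lemma mnorm_smul_le (r : ℝ) (A : Matrix (Fin a) (Fin b) ℂ) :
    mnorm (r • A) ≤ |r| * mnorm A := by
  have h : ∀ i j, ‖(r • A) i j‖ = |r| * ‖A i j‖ := fun i j => by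
    rw [Matrix.smul_apply, norm_smul, Real.norm_eq_abs]
  refine mnorm_le (mul_nonneg (abs_nonneg r) (mnorm_nonneg A)) (fun i => ?_) (fun j => ?_)
  · simp only [h, ← Finset.mul_sum]
    exact mul_le_mul_of_nonneg_left (sum_row_le_mnorm A i) (abs_nonneg r)
  · simp only [h, ← Finset.mul_sum]
    exact mul_le_mul_of_nonneg_left (sum_col_le_mnorm A j) (abs_nonneg r)

lemma mnorm_conjTranspose (A : Matrix (Fin a) (Fin b) ℂ) : mnorm Aᴴ = mnorm A := by
  simp only [mnorm, Matrix.conjTranspose_apply, norm_star]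
  exact max_comm _ _

lemma mnorm_mul_le (A : Matrix (Fin a) (Fin b) ℂ) (B : Matrix (Fin b) (Fin d) ℂ) :
    mnorm (A * B) ≤ mnorm A * mnorm B := by
  have hE : ∀ i k, ‖(A * B) i k‖ ≤ ∑ j, ‖A i j‖ * ‖B j k‖ := fun i k => by
    rw [Matrix.mul_apply]
    exact (norm_sum_le _ _).trans (Finset.sum_le_sum fun j _ => norm_mul_le _ _)
  refine mnorm_le (mul_nonneg (mnorm_nonneg A) (mnorm_nonneg B)) (fun i => ?_) (fun k => ?_)
  · calc ∑ k, ‖(A * B) i k‖ ≤ ∑ k, ∑ j, ‖A i j‖ * ‖B j k‖ :=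
          Finset.sum_le_sum fun k _ => hE i k
      _ = ∑ j, ‖A i j‖ * ∑ k, ‖B j k‖ := by
          rw [Finset.sum_comm]; simp only [Finset.mul_sum]
      _ ≤ ∑ j, ‖A i j‖ * mnorm B :=
          Finset.sum_le_sum fun j _ =>
            mul_le_mul_of_nonneg_left (sum_row_le_mnorm B j) (norm_nonneg _)
      _ ≤ _ := by
          rw [← Finset.sum_mul]
          exact mul_le_mul_of_nonneg_right (sum_row_le_mnorm A i) (mnorm_nonneg B)
  · calc ∑ i, ‖(A * B) i k‖ ≤ ∑ i, ∑ j, ‖A i j‖ * ‖B j k‖ :=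
          Finset.sum_le_sum fun i _ => hE i k
      _ = ∑ j, (∑ i, ‖A i j‖) * ‖B j k‖ := by
          rw [Finset.sum_comm]; simp only [Finset.sum_mul]
      _ ≤ ∑ j, mnorm A * ‖B j k‖ :=
          Finset.sum_le_sum fun j _ =>
            mul_le_mul_of_nonneg_right (sum_col_le_mnorm A j) (norm_nonneg _)
      _ ≤ _ := by
          rw [← Finset.mul_sum]
          exact mul_le_mul_of_nonneg_left (sum_col_le_mnorm B k) (mnorm_nonneg A)

/-- The norm of the identity is `1`, or `0` in dimension zero. -/
lemma mnorm_one_le : mnorm (1 : Matrix (Fin a) (Fin a) ℂ) ≤ 1 := by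
  refine mnorm_le zero_le_one (fun i => ?_) (fun j => ?_)
  · rw [Finset.sum_eq_single i] <;> simp +contextual [eq_comm]
  · rw [Finset.sum_eq_single j] <;> simp +contextual

lemma mnorm_pow_le (A : Matrix (Fin a) (Fin a) ℂ) (k : ℕ) : mnorm (A ^ k) ≤ mnorm A ^ k := by
  induction k with
  | zero => simpa using mnorm_one_le
  | succ k ih =>
    rw [pow_succ, pow_succ]
    exact (mnorm_mul_le _ _).trans (mul_le_mul_of_nonneg_right ih (mnorm_nonneg A))

lemma mnorm_sum_le {ι : Type*} (s : Finset ι) (f : ι → Matrix (Fin a) (Fin b) ℂ) :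
    mnorm (∑ i ∈ s, f i) ≤ ∑ i ∈ s, mnorm (f i) := by
  classical
  induction s using Finset.induction_on with
  | empty => simp
  | insert i s hi ih =>
    rw [Finset.sum_insert hi, Finset.sum_insert hi]
    exact (mnorm_add_le _ _).trans (add_le_add le_rfl ih)

lemma mnorm_add_le_of_le {A B : Matrix (Fin a) (Fin b) ℂ} {x y : ℝ} (hA : mnorm A ≤ x)
    (hB : mnorm B ≤ y) : mnorm (A + B) ≤ x + y :=
  (mnorm_add_le A B).trans (add_le_add hA hB)

lemma mnorm_sub_le_of_le {A B : Matrix (Fin a) (Fin b) ℂ} {x y : ℝ} (hA : mnorm A ≤ x)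
    (hB : mnorm B ≤ y) : mnorm (A - B) ≤ x + y :=
  (mnorm_sub_le A B).trans (add_le_add hA hB)

lemma mnorm_mul_le_of_le {A : Matrix (Fin a) (Fin b) ℂ} {B : Matrix (Fin b) (Fin d) ℂ} {x y : ℝ}
    (hA : mnorm A ≤ x) (hB : mnorm B ≤ y) : mnorm (A * B) ≤ x * y :=
  (mnorm_mul_le A B).trans (mul_le_mul hA hB (mnorm_nonneg B) ((mnorm_nonneg A).trans hA))

lemma mnorm_smul_le_of_le {r : ℝ} (hr : 0 ≤ r) {A : Matrix (Fin a) (Fin b) ℂ} {x : ℝ}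
    (hA : mnorm A ≤ x) : mnorm (r • A) ≤ r * x :=
  (mnorm_smul_le r A).trans (by
    rw [abs_of_nonneg hr]; exact mul_le_mul_of_nonneg_left hA hr)

lemma mnorm_one_add_le {A : Matrix (Fin a) (Fin a) ℂ} {x : ℝ} (hA : mnorm A ≤ x) :
    mnorm (1 + A) ≤ 1 + x :=
  mnorm_add_le_of_le mnorm_one_le hA

/-- Difference of two products, by changing one factor at a time. -/
lemma mnorm_mul_sub_mul_le {A A' : Matrix (Fin a) (Fin b) ℂ} {B B' : Matrix (Fin b) (Fin d) ℂ}
    {x x' y y' : ℝ} (hA : mnorm A ≤ x) (hA' : mnorm (A' - A) ≤ x') (hB : mnorm B' ≤ y)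
    (hB' : mnorm (B' - B) ≤ y') : mnorm (A' * B' - A * B) ≤ x' * y + x * y' := by
  have : A' * B' - A * B = (A' - A) * B' + A * (B' - B) := by
    rw [Matrix.sub_mul, Matrix.mul_sub]; abel
  rw [this]
  exact mnorm_add_le_of_le (mnorm_mul_le_of_le hA' hB) (mnorm_mul_le_of_le hA hB')

lemma mnorm_pow_sub_pow_le {A A' : Matrix (Fin a) (Fin a) ℂ} {w t : ℝ} (hA : mnorm A ≤ w)
    (hA' : mnorm A' ≤ w) (h : mnorm (A' - A) ≤ t) (k : ℕ) :
    mnorm (A' ^ (k + 1) - A ^ (k + 1)) ≤ (k + 1) * w ^ k * t := by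
  have hw : 0 ≤ w := (mnorm_nonneg A).trans hA
  induction k with
  | zero => simpa using h
  | succ k ih =>
    rw [pow_succ A', pow_succ A]
    have h1 := mnorm_mul_sub_mul_le (a := a) (b := a) (d := a)
      ((mnorm_pow_le A (k + 1)).trans (pow_le_pow_left₀ (mnorm_nonneg A) hA _)) ih hA' h
    refine h1.trans (le_of_eq ?_)
    push_cast
    ring

/-- If the coefficients of `P` vanish below degree `N` and are bounded by `C`, then `P(A)` is
bounded by the tail of a geometric series. -/
lemma mnorm_aeval_le (P : Polynomial ℝ) (A : Matrix (Fin a) (Fin a) ℂ) {N : ℕ} {C w : ℝ}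
    (hA : mnorm A ≤ w) (hw : w < 1) (h0 : ∀ k < N, P.coeff k = 0)
    (hC : ∀ k, |P.coeff k| ≤ C) :
    mnorm (Polynomial.aeval A P) ≤ C * w ^ N / (1 - w) := by
  have hw0 : 0 ≤ w := (mnorm_nonneg A).trans hA
  have hC0 : 0 ≤ C := (abs_nonneg _).trans (hC 0)
  have hP : Polynomial.aeval A P = ∑ k ∈ Finset.Ico N (N + P.natDegree + 1), P.coeff k • A ^ k := by
    rw [Polynomial.aeval_eq_sum_range' (n := N + P.natDegree + 1) (by omega),
      ← Finset.sum_range_add_sum_Ico _ (show N ≤ N + P.natDegree + 1 by omega),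
      Finset.sum_eq_zero, zero_add]
    intro k hk
    rw [h0 k (Finset.mem_range.1 hk), zero_smul]
  rw [hP]
  calc mnorm (∑ k ∈ Finset.Ico N (N + P.natDegree + 1), P.coeff k • A ^ k)
      ≤ ∑ k ∈ Finset.Ico N (N + P.natDegree + 1), C * w ^ k := by
        refine (mnorm_sum_le _ _).trans (Finset.sum_le_sum fun k _ => ?_)
        exact (mnorm_smul_le _ _).trans (mul_le_mul (hC k)
          ((mnorm_pow_le A k).trans (pow_le_pow_left₀ (mnorm_nonneg A) hA k))
          (mnorm_nonneg _) hC0)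
    _ ≤ C * (w ^ N / (1 - w)) := by
        rw [← Finset.mul_sum]
        exact mul_le_mul_of_nonneg_left (geom_sum_Ico_le_of_lt_one hw0 hw) hC0
    _ = _ := by ring

lemma conjTranspose_aeval (P : Polynomial ℝ) (A : Matrix (Fin a) (Fin a) ℂ) :
    (Polynomial.aeval A P)ᴴ = Polynomial.aeval Aᴴ P := by
  simp only [Polynomial.aeval_eq_sum_range, Matrix.conjTranspose_sum,
    Matrix.conjTranspose_smul, Matrix.conjTranspose_pow, star_trivial]

end Norm

/-! ### Binomial coefficients of order `±1/2` -/

section Binomial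

lemma succ_mul_choose_succ (r : ℝ) (k : ℕ) :
    ((k : ℝ) + 1) * Ring.choose r (k + 1) = Ring.choose r k * (r - k) := by
  have h := Ring.choose_smul_choose r (Nat.le_succ k)
  simpa [Nat.choose_succ_self_right] using h

lemma succ_mul_choose_succ' (r : ℝ) (k : ℕ) :
    ((k : ℝ) + 1) * Ring.choose r (k + 1) = r * Ring.choose (r - 1) k := by
  have h := Ring.choose_smul_choose r (Nat.le_add_left 1 k)
  simpa using h

/-- The coefficients of `(1 + u)^{-1/2}` alternate in sign. -/
lemma abs_choose_neg_half (k : ℕ) :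
    |Ring.choose (-1 / 2 : ℝ) k| = (-1) ^ k * Ring.choose (-1 / 2 : ℝ) k := by
  have h : 0 ≤ (-1) ^ k * Ring.choose (-1 / 2 : ℝ) k := by
    induction k with
    | zero => simp
    | succ k ih =>
      have hs := succ_mul_choose_succ (-1 / 2 : ℝ) k
      have hk : (0 : ℝ) < k + 1 := by positivity
      have : (-1) ^ (k + 1) * Ring.choose (-1 / 2 : ℝ) (k + 1)
          = ((-1) ^ k * Ring.choose (-1 / 2 : ℝ) k) * ((k + 1 / 2) / (k + 1)) := by
        generalize Ring.choose (-1 / 2 : ℝ) (k + 1) = u at hs ⊢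
        generalize Ring.choose (-1 / 2 : ℝ) k = v at hs ⊢
        field_simp
        linear_combination 2 * (-1) ^ (k + 1) * hs
      rw [this]
      positivity
  rw [← abs_of_nonneg h, abs_mul, abs_pow, abs_neg, abs_one, one_pow, one_mul]

lemma abs_choose_neg_half_succ (k : ℕ) :
    |Ring.choose (-1 / 2 : ℝ) (k + 1)|
      = |Ring.choose (-1 / 2 : ℝ) k| * ((k + 1 / 2) / (k + 1)) := by
  have hs := succ_mul_choose_succ (-1 / 2 : ℝ) k
  have hk : (0 : ℝ) < k + 1 := by positivity
  rw [abs_choose_neg_half, abs_choose_neg_half]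
  generalize Ring.choose (-1 / 2 : ℝ) (k + 1) = u at hs ⊢
  generalize Ring.choose (-1 / 2 : ℝ) k = v at hs ⊢
  field_simp
  linear_combination 2 * (-1) ^ (k + 1) * hs

lemma abs_choose_neg_half_le (k : ℕ) : |Ring.choose (-1 / 2 : ℝ) (k + 1)| ≤ 1 / 2 := by
  induction k with
  | zero => norm_num [abs_of_nonneg]
  | succ k ih =>
    rw [abs_choose_neg_half_succ]
    refine (mul_le_of_le_one_right (abs_nonneg _) ?_).trans ih
    rw [div_le_one (by positivity)]
    linarith

lemma abs_choose_neg_half_le' (k : ℕ) : |Ring.choose (-1 / 2 : ℝ) (k + 2)| ≤ 3 / 8 := by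
  induction k with
  | zero =>
    rw [abs_choose_neg_half_succ, abs_choose_neg_half_succ]
    norm_num
  | succ k ih =>
    rw [abs_choose_neg_half_succ]
    refine (mul_le_of_le_one_right (abs_nonneg _) ?_).trans ih
    rw [div_le_one (by positivity)]
    linarith

lemma choose_neg_one (k : ℕ) : Ring.choose (-1 : ℝ) k = (-1) ^ k := by
  induction k with
  | zero => simp
  | succ k ih =>
    have hs := succ_mul_choose_succ (-1 : ℝ) k
    have hk : (k : ℝ) + 1 ≠ 0 := by positivity
    rw [ih] at hs
    refine mul_left_cancel₀ hk ?_
    rw [hs]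
    ring

lemma choose_one_eq_zero (k : ℕ) : Ring.choose (1 : ℝ) (k + 2) = 0 := by
  have h := Ring.choose_natCast (R := ℝ) 1 (k + 2)
  rw [Nat.cast_one] at h
  rw [h, Nat.choose_eq_zero_of_lt (by omega), Nat.cast_zero]

/-- Squaring the series of `(1 + u)^{-1/2}` gives that of `(1 + u)^{-1}`. -/
lemma sum_choose_neg_half_mul (k : ℕ) :
    ∑ x ∈ HasAntidiagonal.antidiagonal k, Ring.choose (-1 / 2 : ℝ) x.1 * Ring.choose (-1 / 2 : ℝ) x.2
      = (-1) ^ k := by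
  rw [← Ring.add_choose_eq k (Commute.all _ _), ← choose_neg_one]
  norm_num

lemma sum_abs_choose_neg_half_mul (k : ℕ) :
    ∑ x ∈ HasAntidiagonal.antidiagonal k,
      |Ring.choose (-1 / 2 : ℝ) x.1| * |Ring.choose (-1 / 2 : ℝ) x.2| = 1 := by
  have h : ∀ x ∈ HasAntidiagonal.antidiagonal k,
      |Ring.choose (-1 / 2 : ℝ) x.1| * |Ring.choose (-1 / 2 : ℝ) x.2|
        = (-1) ^ k * (Ring.choose (-1 / 2 : ℝ) x.1 * Ring.choose (-1 / 2 : ℝ) x.2) := by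
    intro x hx
    rw [abs_choose_neg_half, abs_choose_neg_half, ← HasAntidiagonal.mem_antidiagonal.1 hx, pow_add]
    ring
  rw [Finset.sum_congr rfl h, ← Finset.mul_sum, sum_choose_neg_half_mul, ← mul_pow]
  norm_num

/-- The coefficients of `(1 + u)^{1/2}` of positive order alternate in sign, and are obtained from
those of its derivative. -/
lemma choose_half_succ (k : ℕ) :
    (-1) ^ k * Ring.choose (1 / 2 : ℝ) (k + 1)
      = |Ring.choose (-1 / 2 : ℝ) k| / (2 * (k + 1)) := by
  have hs := succ_mul_choose_succ' (1 / 2 : ℝ) k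
  have hk : (0 : ℝ) < k + 1 := by positivity
  have h2 : (1 / 2 : ℝ) - 1 = -1 / 2 := by norm_num
  rw [h2] at hs
  rw [abs_choose_neg_half]
  generalize Ring.choose (1 / 2 : ℝ) (k + 1) = u at hs ⊢
  generalize Ring.choose (-1 / 2 : ℝ) k = v at hs ⊢
  field_simp
  linear_combination 2 * hs

lemma abs_choose_half_succ (k : ℕ) :
    |Ring.choose (1 / 2 : ℝ) (k + 1)| = (-1) ^ k * Ring.choose (1 / 2 : ℝ) (k + 1) := by
  have h : 0 ≤ (-1) ^ k * Ring.choose (1 / 2 : ℝ) (k + 1) := by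
    rw [choose_half_succ]; positivity
  rw [← abs_of_nonneg h, abs_mul, abs_pow, abs_neg, abs_one, one_pow, one_mul]

lemma choose_half_one : Ring.choose (1 / 2 : ℝ) 1 = 1 / 2 := by simp

/-- The bound for the coefficients of the derivative of `(1 + u²)^{1/2}`. -/
lemma two_mul_abs_choose_half_le (k : ℕ) :
    2 * ((k : ℝ) + 2) * |Ring.choose (1 / 2 : ℝ) (k + 2)| ≤ 1 / 2 := by
  have h := abs_choose_neg_half_le k
  rw [abs_choose_half_succ, choose_half_succ]
  have hk : (0 : ℝ) < k + 2 := by positivity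
  push_cast
  rw [show (k : ℝ) + 1 + 1 = k + 2 by ring, mul_div_cancel₀ _ (by positivity)]
  exact h

lemma abs_choose_half_le (k : ℕ) : |Ring.choose (1 / 2 : ℝ) (k + 2)| ≤ 1 / 8 := by
  have h := two_mul_abs_choose_half_le k
  have hk : (0 : ℝ) ≤ k := Nat.cast_nonneg k
  nlinarith [abs_nonneg (Ring.choose (1 / 2 : ℝ) (k + 2))]

/-- Squaring the series of `(1 + u)^{1/2}` gives `1 + u`. -/
lemma sum_choose_half_mul (k : ℕ) :
    ∑ x ∈ HasAntidiagonal.antidiagonal (k + 2), Ring.choose (1 / 2 : ℝ) x.1 * Ring.choose (1 / 2 : ℝ) x.2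
      = 0 := by
  rw [← Ring.add_choose_eq (k + 2) (Commute.all _ _), ← choose_one_eq_zero k]
  norm_num

/-- The part of the convolution square of `(1 + u)^{1/2}` that avoids the constant term has
coefficients at most `1/4`. -/
lemma sum_abs_choose_half_mul_le (k : ℕ) :
    ∑ x ∈ HasAntidiagonal.antidiagonal (k + 2), (if x.1 = 0 ∨ x.2 = 0 then 0 else
      |Ring.choose (1 / 2 : ℝ) x.1| * |Ring.choose (1 / 2 : ℝ) x.2|) ≤ 1 / 4 := by
  have h0 := sum_choose_half_mul k
  rw [Finset.Nat.sum_antidiagonal_succ, Finset.Nat.sum_antidiagonal_succ'] at h0 ⊢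
  simp only [Ring.choose_zero_right, one_mul, mul_one, true_or, if_true, zero_add, or_true] at h0 ⊢
  have h : ∀ x ∈ HasAntidiagonal.antidiagonal k,
      (if x.1 + 1 = 0 ∨ x.2 + 1 = 0 then (0 : ℝ) else
        |Ring.choose (1 / 2 : ℝ) (x.1 + 1)| * |Ring.choose (1 / 2 : ℝ) (x.2 + 1)|)
        = (-1) ^ k *
          (Ring.choose (1 / 2 : ℝ) (x.1 + 1) * Ring.choose (1 / 2 : ℝ) (x.2 + 1)) := by
    intro x hx
    rw [if_neg (by omega), abs_choose_half_succ, abs_choose_half_succ,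
      ← HasAntidiagonal.mem_antidiagonal.1 hx, pow_add]
    ring
  rw [Finset.sum_congr rfl h, ← Finset.mul_sum]
  have h1 := abs_choose_half_le k
  rw [abs_choose_half_succ, pow_succ] at h1
  have h2 : ((-1 : ℝ) ^ k) * ((-1) ^ k) = 1 := by rw [← mul_pow]; norm_num
  have h3 : ∑ x ∈ HasAntidiagonal.antidiagonal k,
      Ring.choose (1 / 2 : ℝ) (x.1 + 1) * Ring.choose (1 / 2 : ℝ) (x.2 + 1)
        = -2 * Ring.choose (1 / 2 : ℝ) (k + 2) := by linarith [h0]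
  rw [h3]
  have h4 : Ring.choose (1 / 2 : ℝ) (k + 1 + 1) = Ring.choose (1 / 2 : ℝ) (k + 2) := rfl
  rw [h4] at h1
  linarith

end Binomial

/-! ### The truncated series at a matrix -/

section Series

variable {a : ℕ}

lemma coeff_one_add_sPoly (p i : ℕ) :
    (1 + sPoly p).coeff i = if i ≤ p then Ring.choose (-1 / 2 : ℝ) i else 0 := by
  rw [sPoly, Polynomial.coeff_add, Polynomial.finsetSum_coeff, Polynomial.coeff_one]
  simp only [Polynomial.coeff_C_mul_X_pow]
  rw [Finset.sum_ite_eq]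
  rcases Nat.eq_zero_or_pos i with rfl | hi
  · simp
  · rw [if_neg (by omega), zero_add]
    simp only [Finset.mem_Icc]
    split_ifs <;> first | rfl | omega

lemma abs_coeff_sq_one_add_sPoly_le (p k : ℕ) :
    |((1 + sPoly p) * (1 + sPoly p)).coeff k| ≤ 1 := by
  rw [Polynomial.coeff_mul, ← sum_abs_choose_neg_half_mul k]
  refine (Finset.abs_sum_le_sum_abs _ _).trans (Finset.sum_le_sum fun x _ => ?_)
  rw [abs_mul, coeff_one_add_sPoly, coeff_one_add_sPoly]
  refine mul_le_mul ?_ ?_ (abs_nonneg _) (abs_nonneg _)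
  all_goals
    split_ifs
    · exact le_rfl
    · simp

lemma coeff_sq_one_add_sPoly {p k : ℕ} (h : k ≤ p) :
    ((1 + sPoly p) * (1 + sPoly p)).coeff k = (-1) ^ k := by
  rw [Polynomial.coeff_mul, ← sum_choose_neg_half_mul k]
  refine Finset.sum_congr rfl fun x hx => ?_
  have := HasAntidiagonal.mem_antidiagonal.1 hx
  rw [coeff_one_add_sPoly, coeff_one_add_sPoly, if_pos (by omega), if_pos (by omega)]

/-- `(1 + s_p(u))² (1 + u) - 1` has order `p + 1`: one step of the polar iteration turns a defect
`E` into a defect of size `‖E‖^{p+1}`. -/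
lemma mnorm_sMat_residual_le (p : ℕ) {E : Matrix (Fin a) (Fin a) ℂ} {w : ℝ} (hE : mnorm E ≤ w)
    (hw : w < 1) :
    mnorm ((1 + sMat p E) * (1 + E) * (1 + sMat p E) - 1) ≤ 2 * w ^ (p + 1) / (1 - w) := by
  set P : Polynomial ℝ := (1 + sPoly p) * (1 + sPoly p) * (1 + Polynomial.X) - 1 with hP
  have h1 : (1 + sMat p E) * (1 + E) * (1 + sMat p E) - 1 = Polynomial.aeval E P := by
    have hc : P = (1 + sPoly p) * (1 + Polynomial.X) * (1 + sPoly p) - 1 := by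
      rw [hP]; ring
    rw [hc]
    simp only [sMat, map_sub, map_mul, map_add, map_one, Polynomial.aeval_X]
  have hk : ∀ k, P.coeff (k + 1) = ((1 + sPoly p) * (1 + sPoly p)).coeff (k + 1)
      + ((1 + sPoly p) * (1 + sPoly p)).coeff k := fun k => by
    rw [hP, mul_add, mul_one, Polynomial.coeff_sub, Polynomial.coeff_add,
      Polynomial.coeff_mul_X, Polynomial.coeff_one, if_neg (by omega), sub_zero]
  have h00 : P.coeff 0 = 0 := by
    rw [hP, mul_add, mul_one, Polynomial.coeff_sub, Polynomial.coeff_add,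
      Polynomial.mul_coeff_zero _ Polynomial.X, Polynomial.coeff_X_zero, mul_zero,
      coeff_sq_one_add_sPoly (Nat.zero_le p)]
    simp
  rw [h1]
  refine mnorm_aeval_le P E hE hw (fun k hkp => ?_) (fun k => ?_)
  · cases k with
    | zero => exact h00
    | succ k =>
      rw [hk, coeff_sq_one_add_sPoly (by omega), coeff_sq_one_add_sPoly (by omega), pow_succ]
      ring
  · cases k with
    | zero => rw [h00]; norm_num
    | succ k =>
      rw [hk]
      have h2 := abs_coeff_sq_one_add_sPoly_le p (k + 1)
      have h3 := abs_coeff_sq_one_add_sPoly_le p k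
      exact (abs_add_le _ _).trans (by linarith)

lemma mnorm_sMat_le (p : ℕ) {E : Matrix (Fin a) (Fin a) ℂ} {w : ℝ} (hE : mnorm E ≤ w)
    (hw : w ≤ 1 / 4) : mnorm (sMat p E) ≤ w / 2 + w ^ 2 / 2 := by
  have hw0 : 0 ≤ w := (mnorm_nonneg E).trans hE
  have hco : ∀ i, (sPoly p).coeff i = if 1 ≤ i ∧ i ≤ p then Ring.choose (-1 / 2 : ℝ) i else 0 := by
    intro i
    rw [sPoly, Polynomial.finsetSum_coeff]
    simp only [Polynomial.coeff_C_mul_X_pow]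
    rw [Finset.sum_ite_eq]
    simp only [Finset.mem_Icc]
  -- The linear term is split off, to keep its coefficient `1/2`.
  set P : Polynomial ℝ := sPoly p - Polynomial.C ((sPoly p).coeff 1) * Polynomial.X with hP
  have h1 : sMat p E = Polynomial.aeval E P + (sPoly p).coeff 1 • E := by
    simp [sMat, hP, Algebra.smul_def]
  have hP0 : ∀ k < 2, P.coeff k = 0 := by
    intro k hk
    interval_cases k
    · simp [hP, hco]
    · simp [hP]
  have hPC : ∀ k, |P.coeff k| ≤ 3 / 8 := by
    intro k
    rcases lt_or_ge k 2 with hk | hk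
    · rw [hP0 k hk]; norm_num
    · obtain ⟨j, rfl⟩ := Nat.exists_eq_add_of_le' hk
      rw [hP, Polynomial.coeff_sub, Polynomial.coeff_C_mul, Polynomial.coeff_X,
        if_neg (by omega), mul_zero, sub_zero, hco]
      split_ifs
      · exact abs_choose_neg_half_le' j
      · norm_num
  have h2 := mnorm_aeval_le P E hE (by linarith) hP0 hPC
  have h3 : |(sPoly p).coeff 1| ≤ 1 / 2 := by
    rw [hco]
    split_ifs
    · exact abs_choose_neg_half_le 0
    · norm_num
  rw [h1]
  have h4 : 3 / 8 * w ^ 2 / (1 - w) ≤ w ^ 2 / 2 := by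
    rw [div_le_iff₀ (by linarith)]
    nlinarith [sq_nonneg w]
  refine (mnorm_add_le_of_le (h2.trans h4) ((mnorm_smul_le _ _).trans
    (mul_le_mul h3 hE (mnorm_nonneg _) (by norm_num)))).trans (le_of_eq (by ring))

/-- The Taylor polynomial of degree `m` of `(1 + v)^{1/2}`. -/
noncomputable def sqrtPoly (m : ℕ) : Polynomial ℝ :=
  1 + ∑ k ∈ Finset.Icc 1 m, Polynomial.C (Ring.choose (1 / 2 : ℝ) k) * Polynomial.X ^ k

lemma coeff_sqrtPoly (m i : ℕ) :
    (sqrtPoly m).coeff i = if i ≤ m then Ring.choose (1 / 2 : ℝ) i else 0 := by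
  rw [sqrtPoly, Polynomial.coeff_add, Polynomial.finsetSum_coeff, Polynomial.coeff_one]
  simp only [Polynomial.coeff_C_mul_X_pow]
  rw [Finset.sum_ite_eq]
  rcases Nat.eq_zero_or_pos i with rfl | hi
  · simp
  · rw [if_neg (by omega), zero_add]
    simp only [Finset.mem_Icc]
    split_ifs <;> first | rfl | omega

lemma one_add_cMat (p : ℕ) (W : Matrix (Fin a) (Fin a) ℂ) :
    1 + cMat p W = W + Polynomial.aeval (W ^ 2) (sqrtPoly (p / 2)) := by
  simp only [cMat, cPoly, sqrtPoly, map_add, map_sum, map_mul, map_pow, map_one,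
    Polynomial.aeval_X, Polynomial.aeval_C, ← pow_mul]
  abel

lemma cMat_zero (p : ℕ) : cMat p (0 : Matrix (Fin a) (Fin a) ℂ) = 0 := by
  simp only [cMat, cPoly, map_add, map_sum, map_mul, map_pow, Polynomial.aeval_X,
    Polynomial.aeval_C, zero_add]
  refine Finset.sum_eq_zero fun k hk => ?_
  have := (Finset.mem_Icc.1 hk).1
  rw [zero_pow (by omega), mul_zero]

lemma conjTranspose_cMat (p : ℕ) {W : Matrix (Fin a) (Fin a) ℂ} (hW : Wᴴ = -W) :
    (cMat p W)ᴴ = cMat p (-W) := by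
  rw [cMat, conjTranspose_aeval, hW, cMat]

lemma coeff_sq_sqrtPoly_sub {m k : ℕ} (h : k ≤ m) :
    (sqrtPoly m * sqrtPoly m - (1 + Polynomial.X)).coeff k = 0 := by
  have h1 : (sqrtPoly m * sqrtPoly m).coeff k = ∑ x ∈ HasAntidiagonal.antidiagonal k,
      Ring.choose (1 / 2 : ℝ) x.1 * Ring.choose (1 / 2 : ℝ) x.2 := by
    rw [Polynomial.coeff_mul]
    refine Finset.sum_congr rfl fun x hx => ?_
    have := HasAntidiagonal.mem_antidiagonal.1 hx
    rw [coeff_sqrtPoly, coeff_sqrtPoly, if_pos (by omega), if_pos (by omega)]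
  rw [Polynomial.coeff_sub, h1, Polynomial.coeff_add, Polynomial.coeff_one, Polynomial.coeff_X]
  match k with
  | 0 => simp
  | 1 => simp [Finset.Nat.antidiagonal_succ]; norm_num
  | k + 2 => rw [sum_choose_half_mul]; simp

lemma abs_coeff_sq_sqrtPoly_sub_le {m : ℕ} (hm : 1 ≤ m) (k : ℕ) :
    |(sqrtPoly m * sqrtPoly m - (1 + Polynomial.X)).coeff k| ≤ 1 / 4 := by
  rcases le_or_gt k m with h | h
  · rw [coeff_sq_sqrtPoly_sub h]; norm_num
  · obtain ⟨j, rfl⟩ := Nat.exists_eq_add_of_le' (show 2 ≤ k by omega)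
    rw [Polynomial.coeff_sub, Polynomial.coeff_add, Polynomial.coeff_one, Polynomial.coeff_X,
      if_neg (by omega), if_neg (by omega), add_zero, sub_zero, Polynomial.coeff_mul]
    refine (Finset.abs_sum_le_sum_abs _ _).trans
      ((Finset.sum_le_sum fun x hx => ?_).trans (sum_abs_choose_half_mul_le j))
    have hx := HasAntidiagonal.mem_antidiagonal.1 hx
    rw [abs_mul, coeff_sqrtPoly, coeff_sqrtPoly]
    split_ifs <;> first | omega | simp
    all_goals positivity

/-- `(1 + c_p(-u)) (1 + c_p(u)) - 1` has order `2 ⌊p/2⌋ + 2 ≥ p + 1`. -/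
lemma mnorm_cMat_residual_le {p : ℕ} (hp : 2 ≤ p) {W : Matrix (Fin a) (Fin a) ℂ} {w : ℝ}
    (hW : mnorm W ≤ w) (hw : w < 1) :
    mnorm ((1 + cMat p (-W)) * (1 + cMat p W) - 1)
      ≤ 1 / 4 * (w ^ 2) ^ (p / 2 + 1) / (1 - w ^ 2) := by
  have hw0 : 0 ≤ w := (mnorm_nonneg W).trans hW
  set g := Polynomial.aeval (W ^ 2) (sqrtPoly (p / 2)) with hg
  have hcomm : W * g = g * W := by
    have h := (Polynomial.X * (sqrtPoly (p / 2)).comp (Polynomial.X ^ 2) : Polynomial ℝ)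
    have e1 : Polynomial.aeval W (Polynomial.X * (sqrtPoly (p / 2)).comp (Polynomial.X ^ 2))
        = W * g := by simp [hg, Polynomial.aeval_comp]
    have e2 : Polynomial.aeval W ((sqrtPoly (p / 2)).comp (Polynomial.X ^ 2) * Polynomial.X)
        = g * W := by simp [hg, Polynomial.aeval_comp]
    rw [← e1, ← e2, mul_comm]
  have h1 : (1 + cMat p (-W)) * (1 + cMat p W) - 1 = Polynomial.aeval (W ^ 2)
      (sqrtPoly (p / 2) * sqrtPoly (p / 2) - (1 + Polynomial.X)) := by
    rw [one_add_cMat, one_add_cMat, neg_sq]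
    simp only [map_sub, map_mul, map_add, map_one, Polynomial.aeval_X, ← hg]
    rw [add_mul, mul_add, mul_add, neg_mul, neg_mul, hcomm, sq]
    abel
  rw [h1]
  have hw2 : w ^ 2 < 1 := by nlinarith
  refine mnorm_aeval_le _ _ ((mnorm_pow_le W 2).trans (pow_le_pow_left₀ (mnorm_nonneg W) hW 2)) hw2
    (fun k hk => coeff_sq_sqrtPoly_sub (by omega))
    (abs_coeff_sq_sqrtPoly_sub_le (by omega))

/-- The part of `c_p` of degree at least four. -/
noncomputable def cTail (p : ℕ) (W : Matrix (Fin a) (Fin a) ℂ) : Matrix (Fin a) (Fin a) ℂ :=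
  ∑ k ∈ Finset.Icc 2 (p / 2), Ring.choose (1 / 2 : ℝ) k • W ^ (2 * k)

lemma cMat_eq {p : ℕ} (hp : 2 ≤ p) (W : Matrix (Fin a) (Fin a) ℂ) :
    cMat p W = W + (1 / 2 : ℝ) • W ^ 2 + cTail p W := by
  have h : Finset.Icc 1 (p / 2) = insert 1 (Finset.Icc 2 (p / 2)) := by
    ext k; simp only [Finset.mem_Icc, Finset.mem_insert]; omega
  simp only [cMat, cPoly, cTail, map_add, map_sum, map_mul, map_pow, Polynomial.aeval_X,
    Polynomial.aeval_C, h]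
  rw [Finset.sum_insert (by simp)]
  simp only [choose_half_one, Algebra.smul_def, mul_one, add_assoc]

lemma cTail_neg (p : ℕ) (W : Matrix (Fin a) (Fin a) ℂ) : cTail p (-W) = cTail p W := by
  simp only [cTail, pow_mul, neg_sq]

lemma cMat_one (W : Matrix (Fin a) (Fin a) ℂ) : cMat 1 W = W := by
  simp [cMat, cPoly]

lemma sum_Icc_two_pow_le {w : ℝ} (hw : 0 ≤ w) (hw5 : w ≤ 1 / 5) (m : ℕ) :
    ∑ k ∈ Finset.Icc 2 m, (w ^ 2) ^ k ≤ 25 / 24 * w ^ 4 := by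
  have h1 : w ^ 2 ≤ 1 / 25 := by nlinarith
  have h2 : Finset.Icc 2 m = Finset.Ico 2 (m + 1) := by
    ext k; simp only [Finset.mem_Icc, Finset.mem_Ico]; omega
  rw [h2]
  refine (geom_sum_Ico_le_of_lt_one (sq_nonneg w) (by linarith)).trans ?_
  rw [div_le_iff₀ (by linarith)]
  have : 0 ≤ w ^ 4 := by positivity
  nlinarith

lemma mnorm_cTail_le (p : ℕ) {W : Matrix (Fin a) (Fin a) ℂ} {w : ℝ} (hW : mnorm W ≤ w)
    (hw : w ≤ 1 / 5) : mnorm (cTail p W) ≤ 3 / 20 * w ^ 4 := by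
  have hw0 : 0 ≤ w := (mnorm_nonneg W).trans hW
  refine (mnorm_sum_le _ _).trans ?_
  calc _ ≤ ∑ k ∈ Finset.Icc 2 (p / 2), 1 / 8 * (w ^ 2) ^ k := by
        refine Finset.sum_le_sum fun k hk => ?_
        obtain ⟨j, rfl⟩ := Nat.exists_eq_add_of_le' (Finset.mem_Icc.1 hk).1
        rw [← pow_mul]
        exact (mnorm_smul_le _ _).trans (mul_le_mul (abs_choose_half_le j)
          ((mnorm_pow_le W _).trans (pow_le_pow_left₀ (mnorm_nonneg W) hW _))
          (mnorm_nonneg _) (by norm_num))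
    _ ≤ 1 / 8 * (25 / 24 * w ^ 4) := by
        rw [← Finset.mul_sum]
        exact mul_le_mul_of_nonneg_left (sum_Icc_two_pow_le hw0 hw _) (by norm_num)
    _ ≤ _ := by
        have : 0 ≤ w ^ 4 := by positivity
        nlinarith

lemma mnorm_cTail_sub_le (p : ℕ) {W W' : Matrix (Fin a) (Fin a) ℂ} {w t : ℝ} (hW : mnorm W ≤ w)
    (hW' : mnorm W' ≤ w) (ht : mnorm (W' - W) ≤ t) (hw : w ≤ 1 / 5) :
    mnorm (cTail p W' - cTail p W) ≤ 3 / 5 * w ^ 3 * t := by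
  have hw0 : 0 ≤ w := (mnorm_nonneg W).trans hW
  have ht0 : 0 ≤ t := (mnorm_nonneg _).trans ht
  rw [cTail, cTail, ← Finset.sum_sub_distrib]
  refine (mnorm_sum_le _ _).trans ?_
  rcases hw0.eq_or_lt with h0 | hpos
  · refine (Finset.sum_nonpos fun k hk => ?_).trans (by positivity)
    have hk := (Finset.mem_Icc.1 hk).1
    have e : W = 0 := eq_zero_of_mnorm_le_zero (h0 ▸ hW)
    have e' : W' = 0 := eq_zero_of_mnorm_le_zero (h0 ▸ hW')
    rw [e, e', sub_self, mnorm_zero]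
  calc _ ≤ ∑ k ∈ Finset.Icc 2 (p / 2), 1 / 2 * t / w * (w ^ 2) ^ k := by
        refine Finset.sum_le_sum fun k hk => ?_
        obtain ⟨j, rfl⟩ := Nat.exists_eq_add_of_le' (Finset.mem_Icc.1 hk).1
        rw [← smul_sub]
        have h1 := mnorm_pow_sub_pow_le hW hW' ht (2 * j + 3)
        have h2 := two_mul_abs_choose_half_le j
        have e1 : 2 * (j + 2) = 2 * j + 3 + 1 := by ring
        rw [e1]
        refine (mnorm_smul_le _ _).trans
          ((mul_le_mul_of_nonneg_left h1 (abs_nonneg _)).trans ?_)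
        have e2 : 1 / 2 * t / w * (w ^ 2) ^ (j + 2) = 1 / 2 * (w ^ (2 * j + 3) * t) := by
          field_simp
          ring
        rw [e2]
        have h3 : 0 ≤ w ^ (2 * j + 3) * t := by positivity
        push_cast
        nlinarith
    _ ≤ 1 / 2 * t / w * (25 / 24 * w ^ 4) := by
        rw [← Finset.mul_sum]
        exact mul_le_mul_of_nonneg_left (sum_Icc_two_pow_le hw0 hw _) (by positivity)
    _ = 25 / 48 * w ^ 3 * t := by field_simp; ring
    _ ≤ _ := by
        have : 0 ≤ w ^ 3 * t := by positivity
        nlinarith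

end Series

/-! ### Block-diagonal parts -/

section Blocks

variable {q : ℕ} {c : Composition q} {a b d : ℕ}

lemma sameBlock_iff {i j : Fin q} : SameBlock c (i : ℕ) (j : ℕ) ↔ c.index i = c.index j :=
  ⟨fun ⟨_, _, h⟩ => h, fun h => ⟨i.2, j.2, h⟩⟩

lemma SameBlock.symm {i j : ℕ} (h : SameBlock c i j) : SameBlock c j i := by
  obtain ⟨hi, hj, h⟩ := h
  exact ⟨hj, hi, h.symm⟩

lemma SameBlock.trans {i j k : ℕ} (h : SameBlock c i j) (h' : SameBlock c j k) :
    SameBlock c i k := by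
  obtain ⟨hi, _, h⟩ := h
  obtain ⟨_, hk, h'⟩ := h'
  exact ⟨hi, hk, h.trans h'⟩

lemma blockDiag_apply (A : Matrix (Fin a) (Fin b) ℂ) (i : Fin a) (j : Fin b)
    (h : SameBlock c (i : ℕ) (j : ℕ)) : blockDiag c A i j = A i j := by
  classical
  rw [blockDiag, Matrix.of_apply, if_pos h]

lemma blockDiag_apply_of_not (A : Matrix (Fin a) (Fin b) ℂ) (i : Fin a) (j : Fin b)
    (h : ¬ SameBlock c (i : ℕ) (j : ℕ)) : blockDiag c A i j = 0 := by
  classical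
  rw [blockDiag, Matrix.of_apply, if_neg h]

lemma blockDiag_eq_zero_iff {A : Matrix (Fin a) (Fin b) ℂ} :
    blockDiag c A = 0 ↔ ∀ (i : Fin a) (j : Fin b), SameBlock c (i : ℕ) (j : ℕ) → A i j = 0 := by
  constructor
  · intro h i j hij
    rw [← blockDiag_apply A i j hij, h, Matrix.zero_apply]
  · intro h
    ext i j
    by_cases hij : SameBlock c (i : ℕ) (j : ℕ)
    · rw [blockDiag_apply A i j hij, h i j hij, Matrix.zero_apply]
    · rw [blockDiag_apply_of_not A i j hij, Matrix.zero_apply]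

lemma blockDiag_eq_self_iff {A : Matrix (Fin a) (Fin b) ℂ} :
    blockDiag c A = A ↔ ∀ (i : Fin a) (j : Fin b), ¬ SameBlock c (i : ℕ) (j : ℕ) → A i j = 0 := by
  constructor
  · intro h i j hij
    rw [← h, blockDiag_apply_of_not A i j hij]
  · intro h
    ext i j
    by_cases hij : SameBlock c (i : ℕ) (j : ℕ)
    · rw [blockDiag_apply A i j hij]
    · rw [blockDiag_apply_of_not A i j hij, h i j hij]

lemma blockDiag_add (A B : Matrix (Fin a) (Fin b) ℂ) :
    blockDiag c (A + B) = blockDiag c A + blockDiag c B := by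
  ext i j
  by_cases h : SameBlock c (i : ℕ) (j : ℕ)
  · simp only [Matrix.add_apply, blockDiag_apply _ _ _ h]
  · simp only [Matrix.add_apply, blockDiag_apply_of_not _ _ _ h, add_zero]

lemma blockDiag_smul (r : ℝ) (A : Matrix (Fin a) (Fin b) ℂ) :
    blockDiag c (r • A) = r • blockDiag c A := by
  ext i j
  by_cases h : SameBlock c (i : ℕ) (j : ℕ)
  · simp only [Matrix.smul_apply, blockDiag_apply _ _ _ h]
  · simp only [Matrix.smul_apply, blockDiag_apply_of_not _ _ _ h, smul_zero]

lemma blockDiag_neg (A : Matrix (Fin a) (Fin b) ℂ) : blockDiag c (-A) = -blockDiag c A := by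
  simpa using blockDiag_smul (c := c) (-1) A

lemma blockDiag_sub (A B : Matrix (Fin a) (Fin b) ℂ) :
    blockDiag c (A - B) = blockDiag c A - blockDiag c B := by
  rw [sub_eq_add_neg, blockDiag_add, blockDiag_neg, sub_eq_add_neg]

lemma blockDiag_zero : blockDiag c (0 : Matrix (Fin a) (Fin b) ℂ) = 0 :=
  blockDiag_eq_zero_iff.2 fun _ _ _ => rfl

lemma blockDiag_blockDiag (A : Matrix (Fin a) (Fin b) ℂ) :
    blockDiag c (blockDiag c A) = blockDiag c A :=
  blockDiag_eq_self_iff.2 fun i j h => blockDiag_apply_of_not A i j h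

lemma blockDiag_sub_self (A : Matrix (Fin a) (Fin b) ℂ) : blockDiag c (A - blockDiag c A) = 0 := by
  rw [blockDiag_sub, blockDiag_blockDiag, sub_self]

lemma mnorm_blockDiag_le (A : Matrix (Fin a) (Fin b) ℂ) : mnorm (blockDiag c A) ≤ mnorm A := by
  refine mnorm_mono fun i j => ?_
  by_cases h : SameBlock c (i : ℕ) (j : ℕ)
  · rw [blockDiag_apply A i j h]
  · rw [blockDiag_apply_of_not A i j h, norm_zero]
    exact norm_nonneg _

lemma mnorm_sub_blockDiag_le (A : Matrix (Fin a) (Fin b) ℂ) :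
    mnorm (A - blockDiag c A) ≤ mnorm A := by
  refine mnorm_mono fun i j => ?_
  by_cases h : SameBlock c (i : ℕ) (j : ℕ)
  · rw [Matrix.sub_apply, blockDiag_apply A i j h, sub_self, norm_zero]
    exact norm_nonneg _
  · rw [Matrix.sub_apply, blockDiag_apply_of_not A i j h, sub_zero]

lemma blockDiag_mul_right {X : Matrix (Fin a) (Fin b) ℂ} {P : Matrix (Fin b) (Fin d) ℂ}
    (hX : blockDiag c X = 0) (hP : blockDiag c P = P) : blockDiag c (X * P) = 0 := by
  refine blockDiag_eq_zero_iff.2 fun i j hij => ?_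
  rw [Matrix.mul_apply]
  refine Finset.sum_eq_zero fun k _ => ?_
  by_cases h : SameBlock c (k : ℕ) (j : ℕ)
  · rw [blockDiag_eq_zero_iff.1 hX i k (hij.trans h.symm), zero_mul]
  · rw [blockDiag_eq_self_iff.1 hP k j h, mul_zero]

lemma blockDiag_mul_left {P : Matrix (Fin a) (Fin b) ℂ} {Y : Matrix (Fin b) (Fin d) ℂ}
    (hP : blockDiag c P = P) (hY : blockDiag c Y = 0) : blockDiag c (P * Y) = 0 := by
  refine blockDiag_eq_zero_iff.2 fun i j hij => ?_
  rw [Matrix.mul_apply]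
  refine Finset.sum_eq_zero fun k _ => ?_
  by_cases h : SameBlock c (i : ℕ) (k : ℕ)
  · rw [blockDiag_eq_zero_iff.1 hY k j (h.symm.trans hij), mul_zero]
  · rw [blockDiag_eq_self_iff.1 hP i k h, zero_mul]

end Blocks

/-! ### The linear equation at a diagonal matrix -/

/-- The facts about the singular values `σ`, the condition number `κ` and the bound `K` on which the
analysis rests; the last one is `1/|σ_j - σ_i| + 1/|σ_j + σ_i| ≤ κ` for `i`, `j` in different
blocks, in the weaker form that is used. -/
structure Conditioned {q : ℕ} (c : Composition q) (σ : Fin q → ℝ) (κ K : ℝ) : Prop where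
  one_le_kappa : 1 ≤ κ
  one_le_K : 1 ≤ K
  le_K : ∀ i, |σ i| ≤ K
  inv_le : ∀ i, 1 ≤ κ * |σ i|
  sep : ∀ i j, c.index i ≠ c.index j → 2 * |σ i| ≤ κ * |σ j ^ 2 - σ i ^ 2|

/-- The normalization of the pairs `(X, Y)` among which the linear equation is solved. -/
structure Normalized {q : ℕ} (c : Composition q) {l : ℕ} (X : Matrix (Fin l) (Fin l) ℂ)
    (Y : Matrix (Fin q) (Fin q) ℂ) : Prop where
  X_skew : Xᴴ = -X
  Y_skew : Yᴴ = -Y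
  X_diag : blockDiag c X = 0
  X_corner : ∀ i j : Fin l, q ≤ (i : ℕ) → q ≤ (j : ℕ) → X i j = 0
  Y_diag : blockDiag c Y = 0

section Linear

variable {l q : ℕ} {c : Composition q} {σ : Fin q → ℝ} {κ K : ℝ}

lemma Conditioned.ne_zero (hC : Conditioned c σ κ K) (i : Fin q) : σ i ≠ 0 := by
  intro h
  have := hC.inv_le i
  rw [h] at this
  norm_num at this

lemma Conditioned.sq_sub_ne_zero (hC : Conditioned c σ κ K) {i j : Fin q}
    (h : c.index i ≠ c.index j) : σ j ^ 2 - σ i ^ 2 ≠ 0 := by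
  intro h0
  have := hC.sep i j h
  rw [h0, abs_zero, mul_zero] at this
  have := abs_pos.2 (hC.ne_zero i)
  linarith

/-- With at least two blocks the condition number cannot be small. -/
lemma Conditioned.two_le_mul (hC : Conditioned c σ κ K) {i j : Fin q}
    (h : c.index i ≠ c.index j) : 2 ≤ κ * K := by
  have key : ∀ i j : Fin q, c.index i ≠ c.index j → |σ j| ≤ |σ i| → 2 ≤ κ * K := by
    intro i j h hij
    have h1 := hC.sep i j h
    have h2 : |σ j ^ 2 - σ i ^ 2| ≤ |σ i| ^ 2 := by
      rw [abs_le, sq_abs]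
      have := sq_le_sq' (by linarith [abs_nonneg (σ j), abs_nonneg (σ i)]) hij
      rw [sq_abs, sq_abs] at this
      constructor <;> nlinarith [sq_nonneg (σ j)]
    have h3 := abs_pos.2 (hC.ne_zero i)
    have h4 := hC.one_le_kappa
    have h5 : 2 * |σ i| ≤ (κ * |σ i|) * |σ i| :=
      h1.trans ((mul_le_mul_of_nonneg_left h2 (by linarith)).trans (le_of_eq (by ring)))
    have h6 : 2 ≤ κ * |σ i| := le_of_mul_le_mul_right h5 h3
    exact h6.trans (mul_le_mul_of_nonneg_left (hC.le_K i) (by linarith))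
  rcases le_total |σ j| |σ i| with h' | h'
  · exact key i j h h'
  · exact key j i h.symm h'

lemma mul_rectDiagonal_apply (hql : q ≤ l) {a : ℕ} (X : Matrix (Fin a) (Fin l) ℂ) (i : Fin a)
    (j : Fin q) : (X * rectDiagonal l σ) i j = X i (Fin.castLE hql j) * σ j := by
  rw [Matrix.mul_apply, Finset.sum_eq_single (Fin.castLE hql j)]
  · simp [rectDiagonal]
  · intro k _ hk
    have : ¬ ((k : ℕ) = (j : ℕ)) := fun h => hk (Fin.ext h)
    simp [rectDiagonal, this]
  · simp

lemma rectDiagonal_mul_apply {a : ℕ} (Y : Matrix (Fin q) (Fin a) ℂ) (i : Fin l)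
    (hi : (i : ℕ) < q) (j : Fin a) : (rectDiagonal l σ * Y) i j = σ ⟨i, hi⟩ * Y ⟨i, hi⟩ j := by
  rw [Matrix.mul_apply, Finset.sum_eq_single (⟨i, hi⟩ : Fin q)]
  · simp [rectDiagonal]
  · intro k _ hk
    have : ¬ ((i : ℕ) = (k : ℕ)) := fun h => hk (Fin.ext h.symm)
    simp [rectDiagonal, this]
  · simp

lemma rectDiagonal_mul_apply_of_le {a : ℕ} (Y : Matrix (Fin q) (Fin a) ℂ) (i : Fin l)
    (hi : q ≤ (i : ℕ)) (j : Fin a) : (rectDiagonal l σ * Y) i j = 0 := by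
  rw [Matrix.mul_apply]
  refine Finset.sum_eq_zero fun k _ => ?_
  have : ¬ ((i : ℕ) = (k : ℕ)) := by have := k.2; omega
  simp [rectDiagonal, this]

lemma skew_apply {a : ℕ} {X : Matrix (Fin a) (Fin a) ℂ} (h : Xᴴ = -X) (i j : Fin a) :
    star (X j i) = -X i j := by
  rw [← Matrix.conjTranspose_apply, h, Matrix.neg_apply]

/-- The entries of a solution in the square part, freed from denominators. -/
lemma entries_of_solution (hql : q ≤ l) {X : Matrix (Fin l) (Fin l) ℂ}
    {Y : Matrix (Fin q) (Fin q) ℂ} {A : Matrix (Fin l) (Fin q) ℂ} (hN : Normalized c X Y)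
    (hA : X * rectDiagonal l σ - rectDiagonal l σ * Y = A) (i j : Fin q) :
    ((σ j ^ 2 - σ i ^ 2 : ℝ) : ℂ) * X (Fin.castLE hql i) (Fin.castLE hql j)
        = σ j * A (Fin.castLE hql i) j + σ i * star (A (Fin.castLE hql j) i) ∧
      ((σ j ^ 2 - σ i ^ 2 : ℝ) : ℂ) * Y i j
        = σ i * A (Fin.castLE hql i) j + σ j * star (A (Fin.castLE hql j) i) := by
  have e : ∀ i j : Fin q, A (Fin.castLE hql i) j
      = X (Fin.castLE hql i) (Fin.castLE hql j) * σ j - σ i * Y i j := fun i j => by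
    rw [← hA, Matrix.sub_apply, mul_rectDiagonal_apply hql,
      rectDiagonal_mul_apply Y (Fin.castLE hql i) i.2]
    rfl
  have e2 : star (A (Fin.castLE hql j) i)
      = -X (Fin.castLE hql i) (Fin.castLE hql j) * σ i + σ j * Y i j := by
    rw [e j i, star_sub, star_mul', star_mul', skew_apply hN.X_skew, skew_apply hN.Y_skew]
    simp only [Complex.star_def, Complex.conj_ofReal]
    ring
  rw [e i j, e2]
  push_cast
  constructor <;> ring

/-- The modulus of the entry `(i, j)` of `A`, extended by zero to the columns beyond the last. -/
noncomputable def padNorm (A : Matrix (Fin l) (Fin q) ℂ) (i j : Fin l) : ℝ :=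
  if h : (j : ℕ) < q then ‖A i ⟨j, h⟩‖ else 0

lemma padNorm_nonneg (A : Matrix (Fin l) (Fin q) ℂ) (i j : Fin l) : 0 ≤ padNorm A i j := by
  unfold padNorm; split_ifs <;> simp

lemma sum_padNorm_right_le (hql : q ≤ l) (A : Matrix (Fin l) (Fin q) ℂ) (i : Fin l) :
    ∑ j, padNorm A i j ≤ mnorm A := by
  refine le_trans (le_of_eq ?_) (sum_row_le_mnorm A i)
  symm
  refine Fintype.sum_of_injective (Fin.castLE hql) (Fin.castLE_injective hql) _ _ ?_ ?_
  · intro j hj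
    refine dif_neg fun h => hj ⟨⟨j, h⟩, rfl⟩
  · intro j
    have h : ((Fin.castLE hql j : Fin l) : ℕ) < q := j.2
    rw [padNorm, dif_pos h]
    rfl

lemma sum_padNorm_left_le (A : Matrix (Fin l) (Fin q) ℂ) (j : Fin l) :
    ∑ i, padNorm A i j ≤ mnorm A := by
  unfold padNorm
  by_cases h : (j : ℕ) < q
  · simpa only [dif_pos h] using sum_col_le_mnorm A ⟨j, h⟩
  · simpa only [dif_neg h, Finset.sum_const_zero] using mnorm_nonneg A

lemma norm_le_of_mul_eq {κ s t D u v : ℝ} {z x y : ℂ} (hs : 2 * |s| ≤ κ * |D|)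
    (ht : 2 * |t| ≤ κ * |D|) (hD : D ≠ 0) (hz : (D : ℂ) * z = s * x + t * y) (hx : ‖x‖ ≤ u)
    (hy : ‖y‖ ≤ v) : ‖z‖ ≤ κ / 2 * (u + v) := by
  have h1 : |D| * ‖z‖ ≤ |s| * u + |t| * v := by
    have : |D| * ‖z‖ = ‖(s : ℂ) * x + t * y‖ := by
      rw [← hz, norm_mul, Complex.norm_real, Real.norm_eq_abs]
    rw [this]
    refine (norm_add_le _ _).trans ?_
    rw [norm_mul, norm_mul, Complex.norm_real, Complex.norm_real, Real.norm_eq_abs,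
      Real.norm_eq_abs]
    exact add_le_add (mul_le_mul_of_nonneg_left hx (abs_nonneg s))
      (mul_le_mul_of_nonneg_left hy (abs_nonneg t))
  have hu : 0 ≤ u := (norm_nonneg _).trans hx
  have hv : 0 ≤ v := (norm_nonneg _).trans hy
  have hD' : 0 < |D| := abs_pos.2 hD
  refine le_of_mul_le_mul_left (h1.trans ?_) hD'
  nlinarith

/-- The entries of `X` are bounded by the corresponding entries of the right-hand side. In the last
`l - q` rows and columns only one of the two entries of `A` exists, and the factor `1/2` is lost. -/
lemma norm_X_entry_le (hql : q ≤ l) (hC : Conditioned c σ κ K) {X : Matrix (Fin l) (Fin l) ℂ}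
    {Y : Matrix (Fin q) (Fin q) ℂ} {A : Matrix (Fin l) (Fin q) ℂ} (hN : Normalized c X Y)
    (hA : X * rectDiagonal l σ - rectDiagonal l σ * Y = A) (i j : Fin l) :
    ((i : ℕ) < q → (j : ℕ) < q → ‖X i j‖ ≤ κ / 2 * (padNorm A i j + padNorm A j i)) ∧
      ((i : ℕ) < q → q ≤ (j : ℕ) → ‖X i j‖ ≤ κ * padNorm A j i) ∧
      (q ≤ (i : ℕ) → ‖X i j‖ ≤ κ * padNorm A i j) := by
  have hκ : 0 ≤ κ := zero_le_one.trans hC.one_le_kappa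
  have hlow : ∀ i j : Fin l, q ≤ (i : ℕ) → ‖X i j‖ ≤ κ * padNorm A i j := by
    intro i j hi
    by_cases hj : (j : ℕ) < q
    · have e : X i j * σ ⟨j, hj⟩ = A i ⟨j, hj⟩ := by
        rw [← hA, Matrix.sub_apply, mul_rectDiagonal_apply hql,
          rectDiagonal_mul_apply_of_le Y i hi, sub_zero]
        rfl
      have h1 := hC.inv_le ⟨j, hj⟩
      rw [padNorm, dif_pos hj, ← e, norm_mul, Complex.norm_real, Real.norm_eq_abs]
      nlinarith [norm_nonneg (X i j)]
    · rw [hN.X_corner i j hi (not_lt.1 hj), norm_zero]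
      exact mul_nonneg hκ (padNorm_nonneg A i j)
  refine ⟨fun hi hj => ?_, fun hi hj => ?_, hlow i j⟩
  · by_cases hij : SameBlock c (i : ℕ) (j : ℕ)
    · rw [blockDiag_eq_zero_iff.1 hN.X_diag i j hij, norm_zero]
      have := padNorm_nonneg A i j
      have := padNorm_nonneg A j i
      positivity
    · have hne : c.index ⟨i, hi⟩ ≠ c.index ⟨j, hj⟩ := fun h => hij ⟨hi, hj, h⟩
      have h := (entries_of_solution hql hN hA ⟨i, hi⟩ ⟨j, hj⟩).1
      have hs := hC.sep ⟨j, hj⟩ ⟨i, hi⟩ hne.symm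
      rw [abs_sub_comm] at hs
      refine norm_le_of_mul_eq hs (hC.sep ⟨i, hi⟩ ⟨j, hj⟩ hne) (hC.sq_sub_ne_zero hne) h ?_ ?_
      · rw [padNorm, dif_pos hj]; exact le_rfl
      · rw [padNorm, dif_pos hi, norm_star]; exact le_rfl
  · have h := hlow j i hj
    rwa [← norm_star, skew_apply hN.X_skew, norm_neg] at h

lemma mnorm_le_of_skew {a : ℕ} {X : Matrix (Fin a) (Fin a) ℂ} (hX : Xᴴ = -X) {C : ℝ} (hC : 0 ≤ C)
    (h : ∀ i, ∑ j, ‖X i j‖ ≤ C) : mnorm X ≤ C := by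
  refine mnorm_le hC h fun j => ?_
  have : ∀ i, ‖X i j‖ = ‖X j i‖ := fun i => by
    rw [← norm_star, skew_apply hX, norm_neg]
  simpa only [this] using h j

lemma mnorm_X_le (hql : q ≤ l) (hC : Conditioned c σ κ K) {X : Matrix (Fin l) (Fin l) ℂ}
    {Y : Matrix (Fin q) (Fin q) ℂ} {A : Matrix (Fin l) (Fin q) ℂ} (hN : Normalized c X Y)
    (hA : X * rectDiagonal l σ - rectDiagonal l σ * Y = A) :
    mnorm X ≤ 3 / 2 * κ * mnorm A := by
  have hκ : 0 ≤ κ := zero_le_one.trans hC.one_le_kappa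
  have hA0 := mnorm_nonneg A
  refine mnorm_le_of_skew hN.X_skew (by positivity) fun i => ?_
  have h1 := sum_padNorm_right_le hql A i
  have h2 := sum_padNorm_left_le A i
  rcases lt_or_ge (i : ℕ) q with hi | hi
  · have e' : ∀ j, ‖X i j‖ ≤ κ / 2 * padNorm A i j + κ * padNorm A j i := by
      intro j
      obtain ⟨hx, hy, -⟩ := norm_X_entry_le hql hC hN hA i j
      have h3 := mul_nonneg hκ (padNorm_nonneg A i j)
      have h4 := mul_nonneg hκ (padNorm_nonneg A j i)
      rcases lt_or_ge (j : ℕ) q with hj | hj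
      · linarith [hx hi hj]
      · linarith [hy hi hj]
    calc ∑ j, ‖X i j‖ ≤ ∑ j, (κ / 2 * padNorm A i j + κ * padNorm A j i) :=
          Finset.sum_le_sum fun j _ => e' j
      _ = κ / 2 * ∑ j, padNorm A i j + κ * ∑ j, padNorm A j i := by
          rw [Finset.sum_add_distrib, Finset.mul_sum, Finset.mul_sum]
      _ ≤ κ / 2 * mnorm A + κ * mnorm A :=
          add_le_add (mul_le_mul_of_nonneg_left h1 (by positivity))
            (mul_le_mul_of_nonneg_left h2 hκ)
      _ = _ := by ring
  · calc ∑ j, ‖X i j‖ ≤ ∑ j, κ * padNorm A i j :=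
          Finset.sum_le_sum fun j _ => (norm_X_entry_le hql hC hN hA i j).2.2 hi
      _ ≤ κ * mnorm A := by
          rw [← Finset.mul_sum]; exact mul_le_mul_of_nonneg_left h1 hκ
      _ ≤ _ := by nlinarith [mul_nonneg hκ hA0]

lemma mnorm_X_le_of_one_block (hql : q ≤ l) (hC : Conditioned c σ κ K)
    (h1 : ∀ i j, c.index i = c.index j) {X : Matrix (Fin l) (Fin l) ℂ}
    {Y : Matrix (Fin q) (Fin q) ℂ} {A : Matrix (Fin l) (Fin q) ℂ} (hN : Normalized c X Y)
    (hA : X * rectDiagonal l σ - rectDiagonal l σ * Y = A) : mnorm X ≤ κ * mnorm A := by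
  have hκ : 0 ≤ κ := zero_le_one.trans hC.one_le_kappa
  have hA0 := mnorm_nonneg A
  refine mnorm_le_of_skew hN.X_skew (by positivity) fun i => ?_
  rcases lt_or_ge (i : ℕ) q with hi | hi
  · have e' : ∀ j, ‖X i j‖ ≤ κ * padNorm A j i := by
      intro j
      rcases lt_or_ge (j : ℕ) q with hj | hj
      · rw [blockDiag_eq_zero_iff.1 hN.X_diag i j ⟨hi, hj, h1 _ _⟩, norm_zero]
        exact mul_nonneg hκ (padNorm_nonneg A j i)
      · exact (norm_X_entry_le hql hC hN hA i j).2.1 hi hj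
    calc ∑ j, ‖X i j‖ ≤ ∑ j, κ * padNorm A j i := Finset.sum_le_sum fun j _ => e' j
      _ ≤ _ := by
          rw [← Finset.mul_sum]
          exact mul_le_mul_of_nonneg_left (sum_padNorm_left_le A i) hκ
  · calc ∑ j, ‖X i j‖ ≤ ∑ j, κ * padNorm A i j :=
          Finset.sum_le_sum fun j _ => (norm_X_entry_le hql hC hN hA i j).2.2 hi
      _ ≤ κ * mnorm A := by
          rw [← Finset.mul_sum]
          exact mul_le_mul_of_nonneg_left (sum_padNorm_right_le hql A i) hκ

lemma mnorm_Y_le (hql : q ≤ l) (hC : Conditioned c σ κ K) {X : Matrix (Fin l) (Fin l) ℂ}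
    {Y : Matrix (Fin q) (Fin q) ℂ} {A : Matrix (Fin l) (Fin q) ℂ} (hN : Normalized c X Y)
    (hA : X * rectDiagonal l σ - rectDiagonal l σ * Y = A) : mnorm Y ≤ κ * mnorm A := by
  have hκ : 0 ≤ κ := zero_le_one.trans hC.one_le_kappa
  have hA0 := mnorm_nonneg A
  have e : ∀ i j, ‖Y i j‖
      ≤ κ / 2 * (‖A (Fin.castLE hql i) j‖ + ‖A (Fin.castLE hql j) i‖) := by
    intro i j
    by_cases hij : c.index i = c.index j
    · rw [blockDiag_eq_zero_iff.1 hN.Y_diag i j (sameBlock_iff.2 hij), norm_zero]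
      positivity
    · have h := (entries_of_solution hql hN hA i j).2
      have hs := hC.sep j i (Ne.symm hij)
      rw [abs_sub_comm] at hs
      exact norm_le_of_mul_eq (hC.sep i j hij) hs (hC.sq_sub_ne_zero hij) h le_rfl
        (norm_star _).le
  refine mnorm_le_of_skew hN.Y_skew (by positivity) fun i => ?_
  have h2 : ∑ j, ‖A (Fin.castLE hql j) i‖ ≤ mnorm A := by
    refine le_trans ?_ (sum_col_le_mnorm A i)
    have hinj := Fin.castLE_injective hql
    have : ∑ j, ‖A (Fin.castLE hql j) i‖
        = ∑ k ∈ Finset.univ.map ⟨Fin.castLE hql, hinj⟩, ‖A k i‖ := by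
      rw [Finset.sum_map]; rfl
    rw [this]
    exact Finset.sum_le_sum_of_subset_of_nonneg (Finset.subset_univ _)
      fun _ _ _ => norm_nonneg _
  calc ∑ j, ‖Y i j‖
      ≤ ∑ j, κ / 2 * (‖A (Fin.castLE hql i) j‖ + ‖A (Fin.castLE hql j) i‖) :=
        Finset.sum_le_sum fun j _ => e i j
    _ = κ / 2 * (∑ j, ‖A (Fin.castLE hql i) j‖ + ∑ j, ‖A (Fin.castLE hql j) i‖) := by
        rw [← Finset.mul_sum, Finset.sum_add_distrib]
    _ ≤ κ / 2 * (mnorm A + mnorm A) :=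
        mul_le_mul_of_nonneg_left (add_le_add (sum_row_le_mnorm A _) h2) (by positivity)
    _ = _ := by ring

lemma Y_eq_zero_of_one_block (h1 : ∀ i j, c.index i = c.index j) {X : Matrix (Fin l) (Fin l) ℂ}
    {Y : Matrix (Fin q) (Fin q) ℂ} (hN : Normalized c X Y) : Y = 0 := by
  ext i j
  exact blockDiag_eq_zero_iff.1 hN.Y_diag i j (sameBlock_iff.2 (h1 i j))

end Linear

section ExplicitSolution

variable {l q : ℕ} {c : Composition q} {σ : Fin q → ℝ} {κ K : ℝ}

open Classical in
/-- The component `X` of the solution of `X Σ₀ - Σ₀ Y = A`, where `Σ₀` is diagonal. -/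
noncomputable def diagSolX (c : Composition q) (σ : Fin q → ℝ) (A : Matrix (Fin l) (Fin q) ℂ) :
    Matrix (Fin l) (Fin l) ℂ :=
  Matrix.of fun i j =>
    if SameBlock c (i : ℕ) (j : ℕ) then 0
    else if hj : (j : ℕ) < q then
      if hi : (i : ℕ) < q then
        (σ ⟨j, hj⟩ * A i ⟨j, hj⟩ + σ ⟨i, hi⟩ * star (A j ⟨i, hi⟩)) /
          ((σ ⟨j, hj⟩ : ℂ) ^ 2 - (σ ⟨i, hi⟩ : ℂ) ^ 2)
      else A i ⟨j, hj⟩ / σ ⟨j, hj⟩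
    else if hi : (i : ℕ) < q then -star (A j ⟨i, hi⟩) / σ ⟨i, hi⟩ else 0

open Classical in
/-- The component `Y` of the solution of `X Σ₀ - Σ₀ Y = A`, where `Σ₀` is diagonal. -/
noncomputable def diagSolY (hql : q ≤ l) (c : Composition q) (σ : Fin q → ℝ)
    (A : Matrix (Fin l) (Fin q) ℂ) : Matrix (Fin q) (Fin q) ℂ :=
  Matrix.of fun i j =>
    if SameBlock c (i : ℕ) (j : ℕ) then 0
    else (σ i * A (Fin.castLE hql i) j + σ j * star (A (Fin.castLE hql j) i)) /
      ((σ j : ℂ) ^ 2 - (σ i : ℂ) ^ 2)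

lemma diagSolX_add (A B : Matrix (Fin l) (Fin q) ℂ) :
    diagSolX c σ (A + B) = diagSolX c σ A + diagSolX c σ B := by
  ext i j
  simp only [diagSolX, Matrix.of_apply, Matrix.add_apply, star_add]
  split_ifs <;> ring

lemma diagSolX_smul (r : ℝ) (A : Matrix (Fin l) (Fin q) ℂ) :
    diagSolX c σ (r • A) = r • diagSolX c σ A := by
  ext i j
  simp only [diagSolX, Matrix.of_apply, Matrix.smul_apply, star_mul', Complex.star_def,
    Complex.real_smul, Complex.conj_ofReal]
  split_ifs <;> ring

lemma diagSolY_add (hql : q ≤ l) (A B : Matrix (Fin l) (Fin q) ℂ) :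
    diagSolY hql c σ (A + B) = diagSolY hql c σ A + diagSolY hql c σ B := by
  ext i j
  simp only [diagSolY, Matrix.of_apply, Matrix.add_apply, star_add]
  split_ifs <;> ring

lemma diagSolY_smul (hql : q ≤ l) (r : ℝ) (A : Matrix (Fin l) (Fin q) ℂ) :
    diagSolY hql c σ (r • A) = r • diagSolY hql c σ A := by
  ext i j
  simp only [diagSolY, Matrix.of_apply, Matrix.smul_apply, star_mul', Complex.star_def,
    Complex.real_smul, Complex.conj_ofReal]
  split_ifs <;> ring

lemma diagSol_normalized (hql : q ≤ l) (A : Matrix (Fin l) (Fin q) ℂ) :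
    Normalized c (diagSolX c σ A) (diagSolY hql c σ A) where
  X_skew := by
    ext i j
    rw [Matrix.conjTranspose_apply, Matrix.neg_apply]
    by_cases h : SameBlock c (i : ℕ) (j : ℕ)
    · simp only [diagSolX, Matrix.of_apply, if_pos h, if_pos h.symm, star_zero, neg_zero]
    · have h' : ¬ SameBlock c (j : ℕ) (i : ℕ) := fun h' => h h'.symm
      by_cases hi : (i : ℕ) < q <;> by_cases hj : (j : ℕ) < q <;>
        simp only [diagSolX, Matrix.of_apply, if_neg h, if_neg h', dif_pos, dif_neg, hi, hj,
          not_false_eq_true, star_div₀, star_add, star_mul', star_sub, star_pow,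
          star_neg, star_zero, neg_zero, Complex.star_def, Complex.conj_ofReal,
          starRingEnd_self_apply]
      · rw [← neg_sub, div_neg, add_comm]
      · ring
      · ring
  Y_skew := by
    ext i j
    rw [Matrix.conjTranspose_apply, Matrix.neg_apply]
    by_cases h : SameBlock c (i : ℕ) (j : ℕ)
    · simp only [diagSolY, Matrix.of_apply, if_pos h, if_pos h.symm, star_zero, neg_zero]
    · have h' : ¬ SameBlock c (j : ℕ) (i : ℕ) := fun h' => h h'.symm
      simp only [diagSolY, Matrix.of_apply, if_neg h, if_neg h', star_div₀, star_add, star_mul',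
        star_sub, star_pow, Complex.star_def, Complex.conj_ofReal, starRingEnd_self_apply]
      rw [← neg_sub, div_neg, add_comm]
  X_diag := blockDiag_eq_zero_iff.2 fun i j h => by
    simp only [diagSolX, Matrix.of_apply, if_pos h]
  X_corner := fun i j hi hj => by
    simp only [diagSolX, Matrix.of_apply, dif_neg (not_lt.2 hi), dif_neg (not_lt.2 hj), ite_self]
  Y_diag := blockDiag_eq_zero_iff.2 fun i j h => by
    simp only [diagSolY, Matrix.of_apply, if_pos h]

lemma diagSol_eq (hql : q ≤ l) (hC : Conditioned c σ κ K) {A : Matrix (Fin l) (Fin q) ℂ}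
    (hA : blockDiag c A = 0) :
    diagSolX c σ A * rectDiagonal l σ - rectDiagonal l σ * diagSolY hql c σ A = A := by
  ext i j
  have hne : ∀ i, (σ i : ℂ) ≠ 0 := fun i => Complex.ofReal_ne_zero.2 (hC.ne_zero i)
  have hlt : ((Fin.castLE hql j : Fin l) : ℕ) < q := j.2
  rw [Matrix.sub_apply, mul_rectDiagonal_apply hql]
  rcases lt_or_ge (i : ℕ) q with hi | hi
  · rw [rectDiagonal_mul_apply _ i hi]
    by_cases hij : SameBlock c (i : ℕ) (j : ℕ)
    · rw [blockDiag_eq_zero_iff.1 hA i j hij]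
      have hij' : SameBlock c (i : ℕ) ((Fin.castLE hql j : Fin l) : ℕ) := hij
      simp only [diagSolX, diagSolY, Matrix.of_apply, if_pos hij, if_pos hij']
      simp
    · have hij' : ¬ SameBlock c (i : ℕ) ((Fin.castLE hql j : Fin l) : ℕ) := hij
      have hd := hC.sq_sub_ne_zero (i := ⟨i, hi⟩) (j := j) fun h => hij ⟨hi, j.2, h⟩
      have hd' : (σ j : ℂ) ^ 2 - (σ ⟨i, hi⟩ : ℂ) ^ 2 ≠ 0 := by exact_mod_cast hd
      have e1 : diagSolX c σ A i (Fin.castLE hql j)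
          = (σ j * A i j + σ ⟨i, hi⟩ * star (A (Fin.castLE hql j) ⟨i, hi⟩)) /
            ((σ j : ℂ) ^ 2 - (σ ⟨i, hi⟩ : ℂ) ^ 2) := by
        simp only [diagSolX, Matrix.of_apply, if_neg hij', dif_pos hlt, dif_pos hi]
        rfl
      have e2 : diagSolY hql c σ A ⟨i, hi⟩ j
          = (σ ⟨i, hi⟩ * A i j + σ j * star (A (Fin.castLE hql j) ⟨i, hi⟩)) /
            ((σ j : ℂ) ^ 2 - (σ ⟨i, hi⟩ : ℂ) ^ 2) := by
        simp only [diagSolY, Matrix.of_apply, if_neg hij]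
        rfl
      rw [e1, e2]
      field_simp
      ring
  · have hij' : ¬ SameBlock c (i : ℕ) ((Fin.castLE hql j : Fin l) : ℕ) :=
      fun ⟨h, _, _⟩ => absurd h (not_lt.2 hi)
    have e1 : diagSolX c σ A i (Fin.castLE hql j) = A i j / σ j := by
      simp only [diagSolX, Matrix.of_apply, if_neg hij', dif_pos hlt, dif_neg (not_lt.2 hi)]
      rfl
    rw [rectDiagonal_mul_apply_of_le _ i hi, e1, sub_zero]
    exact div_mul_cancel₀ _ (hne j)

end ExplicitSolution

/-! ### The linear equation near a diagonal matrix -/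

section Perturbed

variable {l q : ℕ} {c : Composition q} {Sig₀ P : Matrix (Fin l) (Fin q) ℂ} {x y : ℝ}

/-- The linear equation at `Sig₀` is solvable for every right-hand side without block-diagonal part,
the solution depends linearly on it, and is bounded by `x` resp. `y` times its norm. -/
structure SolvableWith {q : ℕ} (c : Composition q) {l : ℕ} (Sig₀ : Matrix (Fin l) (Fin q) ℂ)
    (x y : ℝ) : Prop where
  x_nonneg : 0 ≤ x
  y_nonneg : 0 ≤ y
  bound : ∀ X Y, Normalized c X Y →
    mnorm X ≤ x * mnorm (X * Sig₀ - Sig₀ * Y) ∧ mnorm Y ≤ y * mnorm (X * Sig₀ - Sig₀ * Y)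
  solve : ∃ f : Matrix (Fin l) (Fin q) ℂ →ₗ[ℝ]
      Matrix (Fin l) (Fin l) ℂ × Matrix (Fin q) (Fin q) ℂ,
    ∀ A, Normalized c (f A).1 (f A).2 ∧
      (blockDiag c A = 0 → (f A).1 * Sig₀ - Sig₀ * (f A).2 = A)

lemma SolvesLinear.normalized {Sig D S : Matrix (Fin l) (Fin q) ℂ}
    {X : Matrix (Fin l) (Fin l) ℂ} {Y : Matrix (Fin q) (Fin q) ℂ}
    (h : SolvesLinear c Sig D S X Y) : Normalized c X Y :=
  ⟨h.X_skew, h.Y_skew, h.X_diag, h.X_corner, h.Y_diag⟩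

lemma Normalized.sub {X X' : Matrix (Fin l) (Fin l) ℂ} {Y Y' : Matrix (Fin q) (Fin q) ℂ}
    (h : Normalized c X Y) (h' : Normalized c X' Y') : Normalized c (X - X') (Y - Y') where
  X_skew := by rw [Matrix.conjTranspose_sub, h.X_skew, h'.X_skew]; abel
  Y_skew := by rw [Matrix.conjTranspose_sub, h.Y_skew, h'.Y_skew]; abel
  X_diag := by rw [blockDiag_sub, h.X_diag, h'.X_diag, sub_zero]
  X_corner := fun i j hi hj => by
    rw [Matrix.sub_apply, h.X_corner i j hi hj, h'.X_corner i j hi hj, sub_zero]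
  Y_diag := by rw [blockDiag_sub, h.Y_diag, h'.Y_diag, sub_zero]

/-- The a priori bound at `Sig₀ + P`: a perturbation `P` costs a factor `1 / (1 - (x + y) ‖P‖)`. -/
lemma SolvableWith.bound_perturbed (hS : SolvableWith c Sig₀ x y) {ρ t : ℝ} (hP : mnorm P ≤ ρ)
    (hρ : (x + y) * ρ < 1) {X : Matrix (Fin l) (Fin l) ℂ} {Y : Matrix (Fin q) (Fin q) ℂ}
    (hN : Normalized c X Y) (ht : mnorm (X * (Sig₀ + P) - (Sig₀ + P) * Y) ≤ t) :
    mnorm X ≤ x * (1 / (1 - (x + y) * ρ)) * t ∧ mnorm Y ≤ y * (1 / (1 - (x + y) * ρ)) * t := by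
  obtain ⟨h1, h2⟩ := hS.bound X Y hN
  have hx := hS.x_nonneg
  have hy := hS.y_nonneg
  have hX := mnorm_nonneg X
  have hY := mnorm_nonneg Y
  have hρ0 : 0 ≤ ρ := (mnorm_nonneg P).trans hP
  have e : X * Sig₀ - Sig₀ * Y
      = (X * (Sig₀ + P) - (Sig₀ + P) * Y) - (X * P - P * Y) := by
    rw [Matrix.mul_add, Matrix.add_mul]; abel
  set N := mnorm (X * Sig₀ - Sig₀ * Y) with hNdef
  have h3 : N ≤ t + (mnorm X * ρ + ρ * mnorm Y) := by
    rw [hNdef, e]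
    exact mnorm_sub_le_of_le ht (mnorm_sub_le_of_le (mnorm_mul_le_of_le le_rfl hP)
      (mnorm_mul_le_of_le hP le_rfl))
  have h1' : mnorm X ≤ x * N := h1
  have h4 : N ≤ t + (x + y) * ρ * N := by nlinarith
  have hpos : 0 < 1 - (x + y) * ρ := by linarith
  have h5 : N ≤ 1 / (1 - (x + y) * ρ) * t := by
    rw [one_div, inv_mul_eq_div, le_div_iff₀ hpos]; linarith
  constructor
  · exact h1.trans ((mul_le_mul_of_nonneg_left h5 hx).trans (le_of_eq (by ring)))
  · exact h2.trans ((mul_le_mul_of_nonneg_left h5 hy).trans (le_of_eq (by ring)))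

lemma SolvableWith.eq_zero (hS : SolvableWith c Sig₀ x y) (hρ : (x + y) * mnorm P < 1)
    {X : Matrix (Fin l) (Fin l) ℂ} {Y : Matrix (Fin q) (Fin q) ℂ} (hN : Normalized c X Y)
    (h0 : X * (Sig₀ + P) - (Sig₀ + P) * Y = 0) : X = 0 ∧ Y = 0 := by
  have h := hS.bound_perturbed le_rfl hρ hN (t := 0) (by rw [h0, mnorm_zero])
  rw [mul_zero, mul_zero] at h
  exact ⟨eq_zero_of_mnorm_le_zero h.1, eq_zero_of_mnorm_le_zero h.2⟩

lemma SolvesLinear.eq' {Sig D S : Matrix (Fin l) (Fin q) ℂ}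
    {X : Matrix (Fin l) (Fin l) ℂ} {Y : Matrix (Fin q) (Fin q) ℂ}
    (h : SolvesLinear c Sig D S X Y) : X * Sig - Sig * Y = D - S := by
  have := h.eq
  rw [← sub_eq_zero, ← neg_eq_zero, ← this]
  abel

lemma SolvableWith.unique (hS : SolvableWith c Sig₀ x y) (hρ : (x + y) * mnorm P < 1)
    {D S S' : Matrix (Fin l) (Fin q) ℂ} {X X' : Matrix (Fin l) (Fin l) ℂ}
    {Y Y' : Matrix (Fin q) (Fin q) ℂ} (h : SolvesLinear c (Sig₀ + P) D S X Y)
    (h' : SolvesLinear c (Sig₀ + P) D S' X' Y') : S = S' ∧ X = X' ∧ Y = Y' := by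
  have hSS : S = S' := h.S_eq.trans h'.S_eq.symm
  obtain ⟨h1, h2⟩ := hS.eq_zero hρ (h.normalized.sub h'.normalized) (by
    have e : (X - X') * (Sig₀ + P) - (Sig₀ + P) * (Y - Y')
        = (X * (Sig₀ + P) - (Sig₀ + P) * Y) - (X' * (Sig₀ + P) - (Sig₀ + P) * Y') := by
      rw [Matrix.sub_mul, Matrix.mul_sub]; abel
    rw [e, h.eq', h'.eq', hSS, sub_self])
  exact ⟨hSS, sub_eq_zero.1 h1, sub_eq_zero.1 h2⟩

/-- Solvability at `Sig₀ + P`. The equation is equivalent to a fixed point equation for an affine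
map whose linear part has norm less than one; a linear endomorphism of a finite-dimensional space
without kernel is onto. -/
lemma SolvableWith.exists (hS : SolvableWith c Sig₀ x y) (hP : blockDiag c P = P)
    (hρ : (x + y) * mnorm P < 1) (D : Matrix (Fin l) (Fin q) ℂ) :
    ∃ X Y, SolvesLinear c (Sig₀ + P) D (blockDiag c D) X Y := by
  obtain ⟨f, hf⟩ := hS.solve
  -- the part of the equation that is due to the perturbation
  let g : Matrix (Fin l) (Fin l) ℂ × Matrix (Fin q) (Fin q) ℂ →ₗ[ℝ] Matrix (Fin l) (Fin q) ℂ :=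
    { toFun := fun z => (P * z.2 - z.1 * P) - blockDiag c (P * z.2 - z.1 * P)
      map_add' := fun z w => by
        simp only [Prod.fst_add, Prod.snd_add, Matrix.mul_add, Matrix.add_mul, blockDiag_sub,
          blockDiag_add]
        abel
      map_smul' := fun r z => by
        simp only [Prod.smul_fst, Prod.smul_snd, Matrix.mul_smul, Matrix.smul_mul, blockDiag_sub,
          blockDiag_smul, ← smul_sub, RingHom.id_apply] }
  have hg : ∀ z, blockDiag c (g z) = 0 := fun z => blockDiag_sub_self _
  have hkey : ∀ X Y, Normalized c X Y → g (X, Y) = P * Y - X * P := fun X Y hN => by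
    have h1 : blockDiag c (P * Y - X * P) = 0 := by
      rw [blockDiag_sub, blockDiag_mul_left hP hN.Y_diag, blockDiag_mul_right hN.X_diag hP,
        sub_zero]
    have h2 : g (X, Y) = (P * Y - X * P) - blockDiag c (P * Y - X * P) := rfl
    rw [h2, h1, sub_zero]
  let φ : Matrix (Fin l) (Fin l) ℂ × Matrix (Fin q) (Fin q) ℂ →ₗ[ℝ]
      Matrix (Fin l) (Fin l) ℂ × Matrix (Fin q) (Fin q) ℂ := LinearMap.id - f.comp g
  have hφ : ∀ z, φ z = z - f (g z) := fun z => rfl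
  have hinj : Function.Injective φ := by
    rw [← LinearMap.ker_eq_bot, LinearMap.ker_eq_bot']
    intro z hz
    rw [hφ, sub_eq_zero] at hz
    have hN : Normalized c z.1 z.2 := by rw [hz]; exact (hf _).1
    have h1 : z.1 * Sig₀ - Sig₀ * z.2 = P * z.2 - z.1 * P := by
      rw [← hkey z.1 z.2 hN]
      have h2 := (hf (g z)).2 (hg z)
      rw [← hz] at h2
      exact h2
    have h3 : z.1 * (Sig₀ + P) - (Sig₀ + P) * z.2 = 0 := by
      rw [Matrix.mul_add, Matrix.add_mul]
      rw [sub_eq_sub_iff_add_eq_add] at h1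
      rw [h1]
      abel
    obtain ⟨h4, h5⟩ := hS.eq_zero hρ hN h3
    exact Prod.ext h4 h5
  obtain ⟨z, hz⟩ := LinearMap.surjective_of_injective hinj (f (D - blockDiag c D))
  have hz' : z = f (D - blockDiag c D + g z) := by
    rw [map_add, ← hz, hφ]; abel
  have hN : Normalized c z.1 z.2 := by rw [hz']; exact (hf _).1
  have h1 : z.1 * Sig₀ - Sig₀ * z.2 = D - blockDiag c D + g z := by
    have h2 := (hf (D - blockDiag c D + g z)).2
      (by rw [blockDiag_add, blockDiag_sub_self, hg, add_zero])
    rw [← hz'] at h2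
    exact h2
  refine ⟨z.1, z.2, rfl, hN.X_skew, hN.Y_skew, hN.X_diag, hN.X_corner, hN.Y_diag, ?_⟩
  have h3 : g z = P * z.2 - z.1 * P := hkey z.1 z.2 hN
  rw [h3] at h1
  have h4 : D - blockDiag c D = z.1 * Sig₀ - Sig₀ * z.2 - (P * z.2 - z.1 * P) := by
    rw [h1]; abel
  rw [h4, Matrix.mul_add, Matrix.add_mul]
  abel

variable {σ : Fin q → ℝ} {κ K : ℝ}

lemma Conditioned.solvable_diag (hql : q ≤ l) (hC : Conditioned c σ κ K) :
    ∃ f : Matrix (Fin l) (Fin q) ℂ →ₗ[ℝ]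
      Matrix (Fin l) (Fin l) ℂ × Matrix (Fin q) (Fin q) ℂ,
    ∀ A, Normalized c (f A).1 (f A).2 ∧
      (blockDiag c A = 0 →
        (f A).1 * rectDiagonal l σ - rectDiagonal l σ * (f A).2 = A) :=
  ⟨{ toFun := fun A => (diagSolX c σ A, diagSolY hql c σ A)
     map_add' := fun A B => Prod.ext (diagSolX_add A B) (diagSolY_add hql A B)
     map_smul' := fun r A => Prod.ext (diagSolX_smul r A) (diagSolY_smul hql r A) },
    fun A => ⟨diagSol_normalized hql A, diagSol_eq hql hC⟩⟩

/-- With two blocks or more, `κ K ≥ 2` makes up for the factor `3/2` in the bound for `X`. With one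
block `Y = 0`. -/
lemma Conditioned.solvableWith (hql : q ≤ l) (hC : Conditioned c σ κ K) :
    (2 ≤ κ * K ∧ SolvableWith c (rectDiagonal l σ) (3 / 2 * κ) κ) ∨
      SolvableWith c (rectDiagonal l σ) κ 0 := by
  have hκ : 0 ≤ κ := zero_le_one.trans hC.one_le_kappa
  by_cases h : ∀ i j, c.index i = c.index j
  · refine Or.inr ⟨hκ, le_rfl, fun X Y hN => ⟨?_, ?_⟩, hC.solvable_diag hql⟩
    · exact mnorm_X_le_of_one_block hql hC h hN rfl
    · rw [Y_eq_zero_of_one_block h hN, mnorm_zero, zero_mul]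
  · push Not at h
    obtain ⟨i, j, hij⟩ := h
    refine Or.inl ⟨hC.two_le_mul hij, by positivity, hκ, fun X Y hN => ⟨?_, ?_⟩,
      hC.solvable_diag hql⟩
    · exact mnorm_X_le hql hC hN rfl
    · exact mnorm_Y_le hql hC hN rfl

lemma mnorm_rectDiagonal_le (hC : Conditioned c σ κ K) : mnorm (rectDiagonal l σ) ≤ K := by
  have hK : 0 ≤ K := zero_le_one.trans hC.one_le_K
  have h : ∀ (i : Fin l) (j : Fin q), ‖rectDiagonal l σ i j‖ = if (i : ℕ) = j then |σ j| else 0 := by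
    intro i j
    simp only [rectDiagonal, Matrix.of_apply]
    split_ifs <;> simp
  refine mnorm_le hK (fun i => ?_) (fun j => ?_)
  · simp only [h]
    rcases lt_or_ge (i : ℕ) q with hi | hi
    · rw [Finset.sum_eq_single (⟨i, hi⟩ : Fin q)]
      · rw [if_pos rfl]; exact hC.le_K _
      · intro k _ hk
        exact if_neg fun h => hk (Fin.ext h.symm)
      · simp
    · rw [Finset.sum_eq_zero]
      · exact hK
      · intro k _
        exact if_neg (by have := k.2; omega)
  · simp only [h]
    rw [← Finset.sum_filter, Finset.sum_const, nsmul_eq_mul]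
    have h1 : (Finset.univ.filter fun i : Fin l => (i : ℕ) = j).card ≤ 1 :=
      Finset.card_le_one.2 fun a ha b hb => Fin.ext
        ((Finset.mem_filter.1 ha).2.trans (Finset.mem_filter.1 hb).2.symm)
    have h2 : ((Finset.univ.filter fun i : Fin l => (i : ℕ) = j).card : ℝ) ≤ 1 := by
      exact_mod_cast h1
    exact (mul_le_of_le_one_left (abs_nonneg _) h2).trans (hC.le_K j)

lemma conditioned_of_isClustered {δ : ℝ} (hδ : 0 ≤ δ) (hσ : IsClustered c δ σ)
    (hnd : Nondegenerate δ σ) : Conditioned c σ (kappa δ σ) (bigK σ) where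
  one_le_kappa := le_max_left _ _
  one_le_K := le_max_left _ _
  le_K := fun i => (le_ciSup (f := fun i => |σ i|) (Set.finite_range _).bddAbove i).trans
    (le_max_right _ _)
  inv_le := fun i => by
    have h1 : 1 / |σ i| ≤ kappa δ σ :=
      ((le_ciSup (f := fun i => 1 / |σ i|) (Set.finite_range _).bddAbove i).trans
        (le_max_left _ _)).trans (le_max_right _ _)
    rwa [div_le_iff₀ (abs_pos.2 (hnd.1 i))] at h1
  sep := fun i j hij => by
    have hd : ∀ i j : Fin q, i < j → c.index i ≠ c.index j →
        1 / |σ j - σ i| + 1 / |σ j + σ i| ≤ kappa δ σ := fun i j h hij =>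
      ((le_ciSup (f := fun r : {r : Fin q × Fin q // r.1 < r.2 ∧ δ < |σ r.2 - σ r.1|} =>
        (1 / |σ r.1.2 - σ r.1.1| + 1 / |σ r.1.2 + σ r.1.1|)) (Set.finite_range _).bddAbove
        ⟨(i, j), h, hσ.2 i j hij⟩).trans (le_max_right _ _)).trans (le_max_right _ _)
    have h1 : 1 / |σ j - σ i| + 1 / |σ j + σ i| ≤ kappa δ σ := by
      rcases lt_or_gt_of_ne (fun h => hij (congrArg c.index h) : i ≠ j) with h | h
      · exact hd i j h hij
      · rw [abs_sub_comm, add_comm (σ j)]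
        exact hd j i h hij.symm
    have hlt := hσ.2 i j hij
    have ha : 0 < |σ j - σ i| := lt_of_le_of_lt hδ hlt
    have hb : 0 < |σ j + σ i| := abs_pos.2 (hnd.2 i j hlt)
    have h2 : |σ j ^ 2 - σ i ^ 2| = |σ j - σ i| * |σ j + σ i| := by
      rw [← abs_mul]; congr 1; ring
    have h3 : 2 * |σ i| ≤ |σ j - σ i| + |σ j + σ i| := by
      have := abs_sub (σ j + σ i) (σ j - σ i)
      rw [show σ j + σ i - (σ j - σ i) = 2 * σ i by ring, abs_mul, abs_two] at this
      linarith
    rw [div_add_div _ _ ha.ne' hb.ne', div_le_iff₀ (mul_pos ha hb)] at h1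
    rw [h2]
    linarith

end Perturbed

/-! ### One step of the iteration -/

section Step

variable {m n l q : ℕ} {c : Composition q} {p : ℕ} {B Sig : Matrix (Fin l) (Fin q) ℂ}

/-- The auxiliary families of one step: `B` stands for `Δ₁ + Σ`, and `D k` is the remainder after
`k - 1` corrections. The formula for `D k` holds for `k = 1` too, where all sums are empty. -/
structure IsChain {q : ℕ} (c : Composition q) (p : ℕ) {l : ℕ} (B Sig : Matrix (Fin l) (Fin q) ℂ)
    (D S : ℕ → Matrix (Fin l) (Fin q) ℂ) (X : ℕ → Matrix (Fin l) (Fin l) ℂ)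
    (Y : ℕ → Matrix (Fin q) (Fin q) ℂ) : Prop where
  D_eq : ∀ k < p, D (k + 1) = (1 + (cMat p (∑ j ∈ Finset.Icc 1 k, X j))ᴴ) * B *
    (1 + cMat p (∑ j ∈ Finset.Icc 1 k, Y j)) - Sig - ∑ j ∈ Finset.Icc 1 k, S j
  solves : ∀ k < p, SolvesLinear c Sig (D (k + 1)) (S (k + 1)) (X (k + 1)) (Y (k + 1))

/-- The matrix `Δ₁ + Σ` of the step that starts at `T`. -/
noncomputable def stepB (p : ℕ) (M : Matrix (Fin m) (Fin n) ℂ) (T : Triplet m n l q) :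
    Matrix (Fin l) (Fin q) ℂ :=
  (1 + sMat p (defect T.1)) * (T.1ᴴ * M * T.2.1) * (1 + sMat p (defect T.2.1))

lemma isStep_iff (hp : 1 ≤ p) {M : Matrix (Fin m) (Fin n) ℂ} {T T' : Triplet m n l q} :
    IsStep p c M T T' ↔ ∃ (D S : ℕ → Matrix (Fin l) (Fin q) ℂ)
      (X : ℕ → Matrix (Fin l) (Fin l) ℂ) (Y : ℕ → Matrix (Fin q) (Fin q) ℂ),
      IsChain c p (stepB p M T) T.2.2 D S X Y ∧
      T' = (T.1 * (1 + sMat p (defect T.1)) * (1 + cMat p (∑ j ∈ Finset.Icc 1 p, X j)),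
          T.2.1 * (1 + sMat p (defect T.2.1)) * (1 + cMat p (∑ j ∈ Finset.Icc 1 p, Y j)),
          T.2.2 + ∑ j ∈ Finset.Icc 1 p, S j) := by
  simp only [IsStep, sub_add_cancel]
  constructor
  · rintro ⟨D, S, X, Y, h1, h2, h3, h4⟩
    refine ⟨D, S, X, Y, ⟨fun k hk => ?_, fun k hk => h3 _ (Finset.mem_Icc.2 ⟨by omega, hk⟩)⟩, h4⟩
    cases k with
    | zero => simpa [cMat_zero, stepB] using h1
    | succ k => exact h2 (k + 1 + 1) (Finset.mem_Icc.2 ⟨by omega, hk⟩)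
  · rintro ⟨D, S, X, Y, h, h4⟩
    refine ⟨D, S, X, Y, ?_, fun k hk => ?_, fun k hk => ?_, h4⟩
    · simpa [cMat_zero, stepB] using h.D_eq 0 hp
    · obtain ⟨hk1, hk2⟩ := Finset.mem_Icc.1 hk
      obtain ⟨j, rfl⟩ := Nat.exists_eq_add_of_le' (show 1 ≤ k by omega)
      exact h.D_eq j hk2
    · obtain ⟨hk1, hk2⟩ := Finset.mem_Icc.1 hk
      obtain ⟨j, rfl⟩ := Nat.exists_eq_add_of_le' hk1
      exact h.solves j hk2

lemma sum_Icc_one_succ {α : Type*} [AddCommMonoid α] (f : ℕ → α) (k : ℕ) :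
    ∑ j ∈ Finset.Icc 1 (k + 1), f j = ∑ j ∈ Finset.Icc 1 k, f j + f (k + 1) :=
  Finset.sum_Icc_succ_top (by omega) f

lemma exists_isChain (p : ℕ) (B : Matrix (Fin l) (Fin q) ℂ)
    (h : ∀ D, ∃ X Y, SolvesLinear c Sig D (blockDiag c D) X Y) :
    ∃ D S X Y, IsChain c p B Sig D S X Y := by
  choose fX fY hf using h
  -- the sums of the first `k` corrections, computed recursively
  let R : Matrix (Fin l) (Fin l) ℂ × Matrix (Fin q) (Fin q) ℂ × Matrix (Fin l) (Fin q) ℂ →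
      Matrix (Fin l) (Fin q) ℂ :=
    fun w => (1 + (cMat p w.1)ᴴ) * B * (1 + cMat p w.2.1) - Sig - w.2.2
  let st : ℕ → Matrix (Fin l) (Fin l) ℂ × Matrix (Fin q) (Fin q) ℂ × Matrix (Fin l) (Fin q) ℂ :=
    fun k => Nat.rec 0
      (fun _ w => (w.1 + fX (R w), w.2.1 + fY (R w), w.2.2 + blockDiag c (R w))) k
  have hst : ∀ k, st (k + 1) = ((st k).1 + fX (R (st k)), (st k).2.1 + fY (R (st k)),
      (st k).2.2 + blockDiag c (R (st k))) := fun k => rfl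
  have hsum : ∀ k, ∑ j ∈ Finset.Icc 1 k, fX (R (st (j - 1))) = (st k).1 ∧
      ∑ j ∈ Finset.Icc 1 k, fY (R (st (j - 1))) = (st k).2.1 ∧
      ∑ j ∈ Finset.Icc 1 k, blockDiag c (R (st (j - 1))) = (st k).2.2 := by
    intro k
    induction k with
    | zero => exact ⟨rfl, rfl, rfl⟩
    | succ k ih =>
      obtain ⟨h1, h2, h3⟩ := ih
      simp only [sum_Icc_one_succ, h1, h2, h3, hst, Nat.add_sub_cancel]
      exact ⟨trivial, trivial, trivial⟩
  refine ⟨fun k => R (st (k - 1)), fun k => blockDiag c (R (st (k - 1))),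
    fun k => fX (R (st (k - 1))), fun k => fY (R (st (k - 1))), fun k _ => ?_, fun k _ => hf _⟩
  rw [(hsum k).1, (hsum k).2.1, (hsum k).2.2]
  rfl

lemma IsChain.sums_unique {D S D' S' : ℕ → Matrix (Fin l) (Fin q) ℂ}
    {X X' : ℕ → Matrix (Fin l) (Fin l) ℂ} {Y Y' : ℕ → Matrix (Fin q) (Fin q) ℂ}
    (hu : ∀ {D S S' X X' Y Y'}, SolvesLinear c Sig D S X Y → SolvesLinear c Sig D S' X' Y' →
      S = S' ∧ X = X' ∧ Y = Y')
    (h : IsChain c p B Sig D S X Y) (h' : IsChain c p B Sig D' S' X' Y') :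
    ∀ k ≤ p, ∑ j ∈ Finset.Icc 1 k, X j = ∑ j ∈ Finset.Icc 1 k, X' j ∧
      ∑ j ∈ Finset.Icc 1 k, Y j = ∑ j ∈ Finset.Icc 1 k, Y' j ∧
      ∑ j ∈ Finset.Icc 1 k, S j = ∑ j ∈ Finset.Icc 1 k, S' j := by
  intro k
  induction k with
  | zero => intro _; simp
  | succ k ih =>
    intro hk
    obtain ⟨h1, h2, h3⟩ := ih (by omega)
    have hD : D (k + 1) = D' (k + 1) := by
      rw [h.D_eq k hk, h'.D_eq k hk, h1, h2, h3]
    have hs := h.solves k hk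
    rw [hD] at hs
    obtain ⟨e1, e2, e3⟩ := hu hs (h'.solves k hk)
    simp only [sum_Icc_one_succ, h1, h2, h3, e1, e2, e3, and_self]

end Step

/-! ### The remainder after one more correction -/

section Expansion

variable {l q : ℕ}

/-- The non-linear part of `(1 + c_p(-W)) (D + Σ) (1 + c_p(Z))`, for `p ≥ 2`. The terms of degree
two and three in `(W, Z)` that contain `Σ` are written with `Q = W Σ - Σ Z`, which is of the size of
`D`: this is where the factor `‖Σ‖` is saved. -/
noncomputable def nonlin (p : ℕ) (D Sig : Matrix (Fin l) (Fin q) ℂ) (W : Matrix (Fin l) (Fin l) ℂ)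
    (Z : Matrix (Fin q) (Fin q) ℂ) : Matrix (Fin l) (Fin q) ℂ :=
  (D - (1 / 2 : ℝ) • (W * Sig - Sig * Z)) * Z - W * (D - (1 / 2 : ℝ) • (W * Sig - Sig * Z))
  + (1 / 2 : ℝ) • (W ^ 2 * D) + (1 / 2 : ℝ) • (D * Z ^ 2) - W * D * Z
  + (1 / 2 : ℝ) • (W * (W * Sig - Sig * Z) * Z)
  + (1 / 2 : ℝ) • (W ^ 2 * D * Z) - (1 / 2 : ℝ) • (W * D * Z ^ 2)
  + (1 / 4 : ℝ) • (W ^ 2 * (D + Sig) * Z ^ 2)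
  + cTail p W * (D + Sig) * (1 + cMat p Z)
  + (1 - W + (1 / 2 : ℝ) • W ^ 2) * (D + Sig) * cTail p Z

lemma conj_mul_eq_nonlin {p : ℕ} (hp : 2 ≤ p) (D Sig : Matrix (Fin l) (Fin q) ℂ)
    (W : Matrix (Fin l) (Fin l) ℂ) (Z : Matrix (Fin q) (Fin q) ℂ) :
    (1 + cMat p (-W)) * (D + Sig) * (1 + cMat p Z)
      = D + Sig - (W * Sig - Sig * Z) + nonlin p D Sig W Z := by
  rw [nonlin, cMat_eq hp Z, cMat_eq hp (-W), cTail_neg, neg_sq]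
  simp only [Matrix.mul_add, Matrix.add_mul, Matrix.mul_sub, Matrix.sub_mul, Matrix.mul_one,
    Matrix.one_mul, Matrix.neg_mul, Matrix.smul_mul, Matrix.mul_smul, sq,
    Matrix.mul_assoc, smul_add, smul_sub, smul_smul]
  module

end Expansion

section Increment

variable {l q a : ℕ}

lemma mnorm_cMat_le {p : ℕ} (hp : 2 ≤ p) {W : Matrix (Fin a) (Fin a) ℂ} {w : ℝ}
    (hW : mnorm W ≤ w) (hw : w ≤ 1 / 5) : mnorm (cMat p W) ≤ 13 / 10 * w := by
  have hw0 : 0 ≤ w := (mnorm_nonneg W).trans hW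
  have h2 : mnorm (W ^ 2) ≤ w ^ 2 :=
    (mnorm_pow_le W 2).trans (pow_le_pow_left₀ (mnorm_nonneg W) hW 2)
  rw [cMat_eq hp]
  refine (mnorm_add_le_of_le (mnorm_add_le_of_le hW (mnorm_smul_le_of_le (by norm_num) h2))
    (mnorm_cTail_le p hW hw)).trans ?_
  have h3 : w ^ 2 ≤ 1 / 5 * w := by nlinarith
  have h4 : w ^ 4 ≤ 1 / 25 * (1 / 5 * w) := by
    have : w ^ 4 = w ^ 2 * w ^ 2 := by ring
    rw [this]
    exact mul_le_mul (by nlinarith) h3 (by positivity) (by norm_num)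
  linarith

lemma mnorm_sq_sub_sq_le {W W' : Matrix (Fin a) (Fin a) ℂ} {w w' t : ℝ} (hW : mnorm W ≤ w)
    (hW' : mnorm W' ≤ w') (ht : mnorm (W' - W) ≤ t) :
    mnorm (W' ^ 2 - W ^ 2) ≤ (w + w') * t := by
  rw [sq, sq]
  exact (mnorm_mul_sub_mul_le hW ht hW' ht).trans (le_of_eq (by ring))

lemma mnorm_cMat_sub_le {p : ℕ} (hp : 2 ≤ p) {W W' : Matrix (Fin a) (Fin a) ℂ} {w t : ℝ}
    (hW : mnorm W ≤ w) (hW' : mnorm W' ≤ w) (ht : mnorm (W' - W) ≤ t) (hw : w ≤ 1 / 5) :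
    mnorm (cMat p W' - cMat p W) ≤ 13 / 10 * t := by
  have hw0 : 0 ≤ w := (mnorm_nonneg W).trans hW
  have ht0 : 0 ≤ t := (mnorm_nonneg _).trans ht
  have e : cMat p W' - cMat p W = (W' - W) + (1 / 2 : ℝ) • (W' ^ 2 - W ^ 2)
      + (cTail p W' - cTail p W) := by
    rw [cMat_eq hp, cMat_eq hp, smul_sub]; abel
  rw [e]
  refine (mnorm_add_le_of_le (mnorm_add_le_of_le ht (mnorm_smul_le_of_le (by norm_num)
    (mnorm_sq_sub_sq_le hW hW' ht))) (mnorm_cTail_sub_le p hW hW' ht hw)).trans ?_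
  have h3 : w * t ≤ 1 / 5 * t := mul_le_mul_of_nonneg_right hw ht0
  have h4 : w ^ 3 * t ≤ 1 / 125 * t :=
    mul_le_mul_of_nonneg_right ((pow_le_pow_left₀ hw0 hw 3).trans (by norm_num)) ht0
  nlinarith

lemma mnorm_mul_sub_mul_le' {b d : ℕ} {A A' : Matrix (Fin a) (Fin b) ℂ}
    {B B' : Matrix (Fin b) (Fin d) ℂ} {x x' y y' : ℝ} (hA : mnorm A' ≤ x)
    (hA' : mnorm (A' - A) ≤ x') (hB : mnorm B ≤ y) (hB' : mnorm (B' - B) ≤ y') :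
    mnorm (A' * B' - A * B) ≤ x * y' + x' * y := by
  have : A' * B' - A * B = A' * (B' - B) + (A' - A) * B := by
    rw [Matrix.sub_mul, Matrix.mul_sub]; abel
  rw [this]
  exact mnorm_add_le_of_le (mnorm_mul_le_of_le hA hB') (mnorm_mul_le_of_le hA' hB)

/-- The Lipschitz estimate for `nonlin`. Here `s` and `s + d` bound the sums of the remainders
before and after the correction `(X, Y)`, and `u`, `v` are the bounds for the solution of the linear
equation. -/
lemma mnorm_nonlin_sub_le {p : ℕ} (hp : 2 ≤ p) {D Sig : Matrix (Fin l) (Fin q) ℂ}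
    {W X : Matrix (Fin l) (Fin l) ℂ} {Z Y : Matrix (Fin q) (Fin q) ℂ} {u v d s e k : ℝ}
    (hu : 0 ≤ u) (hv : 0 ≤ v) (hs : 0 ≤ s)
    (hX : mnorm X ≤ u * d) (hY : mnorm Y ≤ v * d) (hW : mnorm W ≤ u * s) (hZ : mnorm Z ≤ v * s)
    (hQ : mnorm (W * Sig - Sig * Z) ≤ s) (hXY : mnorm (X * Sig - Sig * Y) ≤ d)
    (hD : mnorm D ≤ e)
    (hA : mnorm (D - (1 / 2 : ℝ) • ((W + X) * Sig - Sig * (Z + Y))) ≤ 1 / 2 * (e + (s + d)))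
    (hB : mnorm (D + Sig) ≤ k) (hus : u * (s + d) ≤ 1 / 5) (hvs : v * (s + d) ≤ 1 / 5) :
    mnorm (nonlin p D Sig (W + X) (Z + Y) - nonlin p D Sig W Z) ≤
      d * ((u + v) * (1 / 2 * (e + (s + d)) + 1 / 2 * s)
        + 1 / 2 * e * (u + v) ^ 2 * (s + (s + d))
        + 1 / 2 * (u * v) * ((s + d) ^ 2 + s * (s + d) + s ^ 2)
        + 3 / 2 * e * (u * v) * (u + v) * (s + d) ^ 2
        + k * (s + d) ^ 3 * (u ^ 2 * v ^ 2 + 41 / 50 * (u ^ 4 + v ^ 4))) := by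
  have hd : 0 ≤ d := (mnorm_nonneg _).trans hXY
  have he : 0 ≤ e := (mnorm_nonneg _).trans hD
  have hk : 0 ≤ k := (mnorm_nonneg _).trans hB
  set s' := s + d with hs'
  have hs'0 : 0 ≤ s' := add_nonneg hs hd
  have hss : s ≤ s' := by linarith
  set W' := W + X with hW'd
  set Z' := Z + Y with hZ'd
  have hWX : mnorm (W' - W) ≤ u * d := by rwa [hW'd, add_sub_cancel_left]
  have hZY : mnorm (Z' - Z) ≤ v * d := by rwa [hZ'd, add_sub_cancel_left]
  have hW' : mnorm W' ≤ u * s' := (mnorm_add_le_of_le hW hX).trans (le_of_eq (by rw [hs']; ring))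
  have hZ' : mnorm Z' ≤ v * s' := (mnorm_add_le_of_le hZ hY).trans (le_of_eq (by rw [hs']; ring))
  have hWs : mnorm W ≤ u * s' := hW.trans (mul_le_mul_of_nonneg_left hss hu)
  have hZs : mnorm Z ≤ v * s' := hZ.trans (mul_le_mul_of_nonneg_left hss hv)
  have hW2 := mnorm_sq_sub_sq_le hW hW' hWX
  have hZ2 := mnorm_sq_sub_sq_le hZ hZ' hZY
  have hWsq : mnorm (W ^ 2) ≤ (u * s) ^ 2 :=
    (mnorm_pow_le W 2).trans (pow_le_pow_left₀ (mnorm_nonneg W) hW 2)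
  have hZ'sq : mnorm (Z' ^ 2) ≤ (v * s') ^ 2 :=
    (mnorm_pow_le Z' 2).trans (pow_le_pow_left₀ (mnorm_nonneg Z') hZ' 2)
  have hWsq' : mnorm (W ^ 2) ≤ 1 / 25 :=
    hWsq.trans ((pow_le_pow_left₀ (by positivity)
      ((mul_le_mul_of_nonneg_left hss hu).trans hus) 2).trans (by norm_num))
  set Q := W * Sig - Sig * Z with hQd
  set Q' := W' * Sig - Sig * Z' with hQ'd
  clear_value s' W' Z' Q Q'
  have hQQ : Q' - Q = X * Sig - Sig * Y := by
    rw [hQ'd, hQd, hW'd, hZ'd, Matrix.add_mul, Matrix.mul_add]; abel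
  have hQ' : mnorm Q' ≤ s' := by
    rw [← sub_add_cancel Q' Q, hQQ, hs', add_comm s d]
    exact mnorm_add_le_of_le hXY hQ
  have hq : mnorm (Q' - Q) ≤ d := by rwa [hQQ]
  have hAA : mnorm ((D - (1 / 2 : ℝ) • Q') - (D - (1 / 2 : ℝ) • Q)) ≤ 1 / 2 * d := by
    have : (D - (1 / 2 : ℝ) • Q') - (D - (1 / 2 : ℝ) • Q) = -((1 / 2 : ℝ) • (Q' - Q)) := by
      rw [smul_sub]; abel
    rw [this, mnorm_neg]
    exact mnorm_smul_le_of_le (by norm_num) hq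
  -- the eleven increments
  have t1 := mnorm_mul_sub_mul_le' hA hAA hZ hZY
  have t2 := mnorm_mul_sub_mul_le hW hWX hA hAA
  have hWD : mnorm (W' ^ 2 * D - W ^ 2 * D) ≤ (u * s + u * s') * (u * d) * e := by
    rw [← Matrix.sub_mul]; exact mnorm_mul_le_of_le hW2 hD
  have hDZ : mnorm (D * Z' ^ 2 - D * Z ^ 2) ≤ e * ((v * s + v * s') * (v * d)) := by
    rw [← Matrix.mul_sub]; exact mnorm_mul_le_of_le hD hZ2
  have t3 := mnorm_smul_le_of_le (r := 1 / 2) (by norm_num) hWD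
  have t4 := mnorm_smul_le_of_le (r := 1 / 2) (by norm_num) hDZ
  have hWD1 : mnorm (W' * D - W * D) ≤ u * d * e := by
    rw [← Matrix.sub_mul]; exact mnorm_mul_le_of_le hWX hD
  have t5 := mnorm_mul_sub_mul_le (mnorm_mul_le_of_le hW hD) hWD1 hZ' hZY
  have t6 := mnorm_smul_le_of_le (r := 1 / 2) (by norm_num)
    (mnorm_mul_sub_mul_le (mnorm_mul_le_of_le hW hQ) (mnorm_mul_sub_mul_le hW hWX hQ' hq) hZ' hZY)
  have t7 := mnorm_smul_le_of_le (r := 1 / 2) (by norm_num)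
    (mnorm_mul_sub_mul_le (mnorm_mul_le_of_le hWsq hD) hWD hZ' hZY)
  have t8 := mnorm_smul_le_of_le (r := 1 / 2) (by norm_num)
    (mnorm_mul_sub_mul_le (mnorm_mul_le_of_le hW hD) hWD1 hZ'sq hZ2)
  have hWB : mnorm (W' ^ 2 * (D + Sig) - W ^ 2 * (D + Sig))
      ≤ (u * s + u * s') * (u * d) * k := by
    rw [← Matrix.sub_mul]; exact mnorm_mul_le_of_le hW2 hB
  have t9 := mnorm_smul_le_of_le (r := 1 / 4) (by norm_num)
    (mnorm_mul_sub_mul_le (mnorm_mul_le_of_le hWsq hB) hWB hZ'sq hZ2)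
  have hfB : mnorm (cTail p W' * (D + Sig) - cTail p W * (D + Sig))
      ≤ 3 / 5 * (u * s') ^ 3 * (u * d) * k := by
    rw [← Matrix.sub_mul]
    exact mnorm_mul_le_of_le (mnorm_cTail_sub_le p hWs hW' hWX hus) hB
  have hC' : mnorm (1 + cMat p Z') ≤ 13 / 10 :=
    (mnorm_one_add_le (mnorm_cMat_le hp hZ' hvs)).trans (by linarith)
  have hCC : mnorm ((1 + cMat p Z') - (1 + cMat p Z)) ≤ 13 / 10 * (v * d) := by
    rw [add_sub_add_left_eq_sub]; exact mnorm_cMat_sub_le hp hZs hZ' hZY hvs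
  have t10 := mnorm_mul_sub_mul_le (mnorm_mul_le_of_le (mnorm_cTail_le p hWs hus) hB) hfB hC' hCC
  have hG : mnorm (1 - W + (1 / 2 : ℝ) • W ^ 2) ≤ 13 / 10 := by
    refine (mnorm_add_le_of_le (mnorm_sub_le_of_le mnorm_one_le (hWs.trans hus))
      (mnorm_smul_le_of_le (by norm_num) hWsq')).trans (by norm_num)
  have hGG : mnorm ((1 - W' + (1 / 2 : ℝ) • W' ^ 2) * (D + Sig)
      - (1 - W + (1 / 2 : ℝ) • W ^ 2) * (D + Sig)) ≤ 13 / 10 * (u * d) * k := by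
    rw [← Matrix.sub_mul]
    refine mnorm_mul_le_of_le ?_ hB
    have e1 : (1 - W' + (1 / 2 : ℝ) • W' ^ 2) - (1 - W + (1 / 2 : ℝ) • W ^ 2)
        = (1 / 2 : ℝ) • (W' ^ 2 - W ^ 2) - (W' - W) := by
      rw [smul_sub]; abel
    rw [e1]
    refine (mnorm_sub_le_of_le (mnorm_smul_le_of_le (by norm_num)
      (mnorm_sq_sub_sq_le hWs hW' hWX)) hWX).trans ?_
    have h1 : 0 ≤ u * d := by positivity
    have h2 := mul_le_mul_of_nonneg_right hus h1
    linarith only [h1, h2]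
  have t11 := mnorm_mul_sub_mul_le (mnorm_mul_le_of_le hG hB) hGG (mnorm_cTail_le p hZ' hvs)
    (mnorm_cTail_sub_le p hZs hZ' hZY hvs)
  have hsplit : nonlin p D Sig W' Z' - nonlin p D Sig W Z
      = ((D - (1 / 2 : ℝ) • Q') * Z' - (D - (1 / 2 : ℝ) • Q) * Z)
        - (W' * (D - (1 / 2 : ℝ) • Q') - W * (D - (1 / 2 : ℝ) • Q))
        + (1 / 2 : ℝ) • (W' ^ 2 * D - W ^ 2 * D) + (1 / 2 : ℝ) • (D * Z' ^ 2 - D * Z ^ 2)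
        - (W' * D * Z' - W * D * Z) + (1 / 2 : ℝ) • (W' * Q' * Z' - W * Q * Z)
        + (1 / 2 : ℝ) • (W' ^ 2 * D * Z' - W ^ 2 * D * Z)
        - (1 / 2 : ℝ) • (W' * D * Z' ^ 2 - W * D * Z ^ 2)
        + (1 / 4 : ℝ) • (W' ^ 2 * (D + Sig) * Z' ^ 2 - W ^ 2 * (D + Sig) * Z ^ 2)
        + (cTail p W' * (D + Sig) * (1 + cMat p Z') - cTail p W * (D + Sig) * (1 + cMat p Z))
        + ((1 - W' + (1 / 2 : ℝ) • W' ^ 2) * (D + Sig) * cTail p Z'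
          - (1 - W + (1 / 2 : ℝ) • W ^ 2) * (D + Sig) * cTail p Z) := by
    simp only [nonlin, ← hQd, ← hQ'd, smul_sub]
    abel
  rw [hsplit]
  refine (mnorm_add_le_of_le (mnorm_add_le_of_le (mnorm_add_le_of_le (mnorm_sub_le_of_le
    (mnorm_add_le_of_le (mnorm_add_le_of_le (mnorm_sub_le_of_le (mnorm_add_le_of_le
    (mnorm_add_le_of_le (mnorm_sub_le_of_le t1 t2) t3) t4) t5) t6) t7) t8) t9) t10) t11).trans ?_
  -- comparison of the bounds, the higher ones after replacing `s` by `s'`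
  have e12 : (1 / 2 * (e + s') * (v * d) + 1 / 2 * d * (v * s))
      + (u * d * (1 / 2 * (e + s')) + u * s * (1 / 2 * d))
      = d * ((u + v) * (1 / 2 * (e + s') + 1 / 2 * s)) := by ring
  have e345 : 1 / 2 * ((u * s + u * s') * (u * d) * e) + 1 / 2 * (e * ((v * s + v * s') * (v * d)))
      + (u * d * e * (v * s') + u * s * e * (v * d))
      = d * (1 / 2 * e * (u + v) ^ 2 * (s + s')) := by ring
  have e6 : 1 / 2 * ((u * d * s' + u * s * d) * (v * s') + u * s * s * (v * d))
      = d * (1 / 2 * (u * v) * (s' ^ 2 + s * s' + s ^ 2)) := by ring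
  have e78 : 1 / 2 * ((u * s + u * s') * (u * d) * e * (v * s') + (u * s) ^ 2 * e * (v * d))
      + 1 / 2 * (u * d * e * (v * s') ^ 2 + u * s * e * ((v * s + v * s') * (v * d)))
      ≤ d * (3 / 2 * e * (u * v) * (u + v) * s' ^ 2) := by
    calc _ ≤ 1 / 2 * ((u * s' + u * s') * (u * d) * e * (v * s') + (u * s') ^ 2 * e * (v * d))
        + 1 / 2 * (u * d * e * (v * s') ^ 2 + u * s' * e * ((v * s' + v * s') * (v * d))) := by
          gcongr
      _ = _ := by ring
  have e9 : 1 / 4 * ((u * s + u * s') * (u * d) * k * (v * s') ^ 2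
      + (u * s) ^ 2 * k * ((v * s + v * s') * (v * d))) ≤ d * (k * s' ^ 3 * (u ^ 2 * v ^ 2)) := by
    calc _ ≤ 1 / 4 * ((u * s' + u * s') * (u * d) * k * (v * s') ^ 2
      + (u * s') ^ 2 * k * ((v * s' + v * s') * (v * d))) := by gcongr
      _ = _ := by ring
  have e10 : 3 / 5 * (u * s') ^ 3 * (u * d) * k * (13 / 10)
      + 3 / 20 * (u * s') ^ 4 * k * (13 / 10 * (v * d)) ≤ d * (k * s' ^ 3 * (41 / 50 * u ^ 4)) := by
    have h1 : 0 ≤ d * (k * s' ^ 3 * u ^ 4) := by positivity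
    have h2 := mul_le_mul_of_nonneg_left hvs h1
    linarith only [h1, h2]
  have e11 : 13 / 10 * (u * d) * k * (3 / 20 * (v * s') ^ 4)
      + 13 / 10 * k * (3 / 5 * (v * s') ^ 3 * (v * d)) ≤ d * (k * s' ^ 3 * (41 / 50 * v ^ 4)) := by
    have h1 : 0 ≤ d * (k * s' ^ 3 * v ^ 4) := by positivity
    have h2 := mul_le_mul_of_nonneg_left hus h1
    linarith only [h1, h2]
  linarith only [e12, e345, e6, e78, e9, e10, e11]

end Increment

/-! ### Estimates for one step -/

section StepEstimates

variable {m n l q : ℕ} {c : Composition q} {p : ℕ}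

lemma conjTranspose_defect {a b : ℕ} (U : Matrix (Fin a) (Fin b) ℂ) : (defect U)ᴴ = defect U := by
  simp [defect, Matrix.conjTranspose_sub, Matrix.conjTranspose_mul]

lemma conjTranspose_sMat_defect {a b : ℕ} (p : ℕ) (U : Matrix (Fin a) (Fin b) ℂ) :
    (sMat p (defect U))ᴴ = sMat p (defect U) := by
  rw [sMat, conjTranspose_aeval, conjTranspose_defect]

lemma mnorm_stepB_sub_le {M : Matrix (Fin m) (Fin n) ℂ} {T : Triplet m n l q} {w e k : ℝ}
    (hU : mnorm (sMat p (defect T.1)) ≤ w) (hV : mnorm (sMat p (defect T.2.1)) ≤ w)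
    (he : mnorm (T.1ᴴ * M * T.2.1 - T.2.2) ≤ e) (hk : mnorm T.2.2 ≤ k) :
    mnorm (stepB p M T - T.2.2) ≤ (1 + w) ^ 2 * e + k * (2 * w + w ^ 2) := by
  set D := T.1ᴴ * M * T.2.1 - T.2.2 with hD
  have hw : 0 ≤ w := (mnorm_nonneg _).trans hU
  have e1 : stepB p M T - T.2.2
      = (1 + sMat p (defect T.1)) * D * (1 + sMat p (defect T.2.1))
        + (sMat p (defect T.1) * T.2.2 * (1 + sMat p (defect T.2.1))
          + T.2.2 * sMat p (defect T.2.1)) := by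
    have h : T.1ᴴ * M * T.2.1 = D + T.2.2 := by rw [hD, sub_add_cancel]
    rw [stepB, h]
    simp only [Matrix.add_mul, Matrix.mul_add, Matrix.one_mul, Matrix.mul_one]
    abel
  rw [e1]
  have hU1 := mnorm_one_add_le hU
  have hV1 := mnorm_one_add_le hV
  refine (mnorm_add_le_of_le (mnorm_mul_le_of_le (mnorm_mul_le_of_le hU1 he) hV1)
    (mnorm_add_le_of_le (mnorm_mul_le_of_le (mnorm_mul_le_of_le hU hk) hV1)
      (mnorm_mul_le_of_le hk hV))).trans (le_of_eq (by ring))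

/-- The defect after one step: a polar iteration step of order `p + 1`, followed by the
multiplication with a matrix that is unitary up to terms of order `p + 1`. -/
lemma mnorm_defect_step_le {a b : ℕ} (U : Matrix (Fin a) (Fin b) ℂ) {W : Matrix (Fin b) (Fin b) ℂ}
    (hW : Wᴴ = -W) {w t r : ℝ} (hE : mnorm (defect U) ≤ w) (hw : w < 1)
    (ht : mnorm (cMat p W) ≤ t) (hr : mnorm ((1 + cMat p (-W)) * (1 + cMat p W) - 1) ≤ r) :
    mnorm (defect (U * (1 + sMat p (defect U)) * (1 + cMat p W)))
      ≤ r + (1 + t) ^ 2 * (2 * w ^ (p + 1) / (1 - w)) := by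
  set O := sMat p (defect U) with hO
  have hOs : Oᴴ = O := conjTranspose_sMat_defect p U
  have hUU : Uᴴ * U = 1 + defect U := by simp [defect]
  have hconj := conjTranspose_cMat p hW
  have e1 : defect (U * (1 + O) * (1 + cMat p W))
      = ((1 + cMat p (-W)) * (1 + cMat p W) - 1)
        + (1 + cMat p (-W)) * ((1 + O) * (1 + defect U) * (1 + O) - 1) * (1 + cMat p W) := by
    have h : (U * (1 + O) * (1 + cMat p W))ᴴ * (U * (1 + O) * (1 + cMat p W))
        = (1 + cMat p (-W)) * ((1 + O) * (Uᴴ * U) * (1 + O)) * (1 + cMat p W) := by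
      rw [Matrix.conjTranspose_mul, Matrix.conjTranspose_mul, Matrix.conjTranspose_add,
        Matrix.conjTranspose_add, hOs, hconj, Matrix.conjTranspose_one]
      simp only [Matrix.mul_assoc]
    rw [defect, h, hUU]
    noncomm_ring
  have ht' : mnorm (cMat p (-W)) ≤ t := by rwa [← hconj, mnorm_conjTranspose]
  rw [e1]
  refine (mnorm_add_le_of_le hr (mnorm_mul_le_of_le (mnorm_mul_le_of_le (mnorm_one_add_le ht')
    (mnorm_sMat_residual_le p hE hw)) (mnorm_one_add_le ht))).trans (le_of_eq (by ring))

/-- The remainder after the whole step is given by the formula for the remainder after `p`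
corrections. -/
lemma remainder_step (M : Matrix (Fin m) (Fin n) ℂ) (T : Triplet m n l q)
    (W : Matrix (Fin l) (Fin l) ℂ) (Z : Matrix (Fin q) (Fin q) ℂ) :
    (T.1 * (1 + sMat p (defect T.1)) * (1 + cMat p W))ᴴ * M *
        (T.2.1 * (1 + sMat p (defect T.2.1)) * (1 + cMat p Z))
      = (1 + (cMat p W)ᴴ) * stepB p M T * (1 + cMat p Z) := by
  rw [Matrix.conjTranspose_mul, Matrix.conjTranspose_mul, Matrix.conjTranspose_add,
    Matrix.conjTranspose_add, conjTranspose_sMat_defect, Matrix.conjTranspose_one,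
    stepB]
  simp only [Matrix.mul_assoc]

lemma mnorm_step_sub_le {a b : ℕ} (U : Matrix (Fin a) (Fin b) ℂ) {O C : Matrix (Fin b) (Fin b) ℂ}
    {w t : ℝ} (hO : mnorm O ≤ w) (hC : mnorm C ≤ t) :
    mnorm (U * (1 + O) * (1 + C) - U) ≤ mnorm U * (w + (1 + w) * t) := by
  have e1 : U * (1 + O) * (1 + C) - U = U * (O + (1 + O) * C) := by
    simp only [Matrix.add_mul, Matrix.mul_add, Matrix.mul_one, Matrix.one_mul, Matrix.mul_assoc]
    abel
  rw [e1]
  exact mnorm_mul_le_of_le le_rfl (mnorm_add_le_of_le hO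
    (mnorm_mul_le_of_le (mnorm_one_add_le hO) hC))

/-- A sequence that contracts as long as its partial sums stay below `s`, and whose geometric
majorant has sum at most `s`. -/
lemma decay_of_contraction {d : ℕ → ℝ} (hd : ∀ k, 0 ≤ d k) {p : ℕ} {t₁ t s : ℝ} (ht0 : 0 ≤ t)
    (ht1 : t < 1) (hs : d 0 + t₁ * d 0 / (1 - t) ≤ s) (h0 : d 0 ≤ s → d 1 ≤ t₁ * d 0)
    (ht₁ : 0 ≤ t₁)
    (h : ∀ k, 1 ≤ k → k < p → ∑ j ∈ Finset.range (k + 1), d j ≤ s → d (k + 1) ≤ t * d k) :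
    ∀ k < p, d (k + 1) ≤ t₁ * t ^ k * d 0 ∧ ∑ j ∈ Finset.range (k + 1), d j ≤ s := by
  have hpos : 0 < 1 - t := by linarith
  have key : ∀ k < p, d (k + 1) ≤ t₁ * t ^ k * d 0 ∧
      ∑ j ∈ Finset.range (k + 1), d j + d (k + 1) / (1 - t) ≤ s := by
    intro k
    induction k with
    | zero =>
      intro _
      have h2 : 0 ≤ t₁ * d 0 / (1 - t) := div_nonneg (mul_nonneg ht₁ (hd 0)) hpos.le
      have h1 := h0 (by linarith)
      refine ⟨by simpa using h1, ?_⟩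
      rw [zero_add, Finset.sum_range_one]
      have := div_le_div_of_nonneg_right h1 hpos.le
      linarith
    | succ k ih =>
      intro hk
      obtain ⟨h1, h2⟩ := ih (by omega)
      have e1 : d (k + 1) / (1 - t) = d (k + 1) + t * d (k + 1) / (1 - t) := by
        field_simp; ring
      have h3 : 0 ≤ t * d (k + 1) / (1 - t) := div_nonneg (mul_nonneg ht0 (hd _)) hpos.le
      have h4 : ∑ j ∈ Finset.range (k + 1 + 1), d j ≤ s := by
        rw [Finset.sum_range_succ]; linarith
      have h5 := h (k + 1) (by omega) hk h4
      constructor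
      · calc d (k + 1 + 1) ≤ t * d (k + 1) := h5
          _ ≤ t * (t₁ * t ^ k * d 0) := mul_le_mul_of_nonneg_left h1 ht0
          _ = _ := by ring
      · rw [Finset.sum_range_succ]
        have := div_le_div_of_nonneg_right h5 hpos.le
        linarith
  intro k hk
  obtain ⟨h1, h2⟩ := key k hk
  exact ⟨h1, by have := div_nonneg (hd (k + 1)) hpos.le; linarith⟩

end StepEstimates

section ChainEstimates

variable {l q : ℕ} {c : Composition q} {p : ℕ} {B Sig : Matrix (Fin l) (Fin q) ℂ}
  {D S : ℕ → Matrix (Fin l) (Fin q) ℂ} {X : ℕ → Matrix (Fin l) (Fin l) ℂ}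
  {Y : ℕ → Matrix (Fin q) (Fin q) ℂ}

/-- The remainder after `k` corrections, for every `k ≤ p`. -/
noncomputable def remainder (p : ℕ) (B Sig : Matrix (Fin l) (Fin q) ℂ)
    (S : ℕ → Matrix (Fin l) (Fin q) ℂ) (X : ℕ → Matrix (Fin l) (Fin l) ℂ)
    (Y : ℕ → Matrix (Fin q) (Fin q) ℂ) (k : ℕ) : Matrix (Fin l) (Fin q) ℂ :=
  (1 + (cMat p (∑ j ∈ Finset.Icc 1 k, X j))ᴴ) * B * (1 + cMat p (∑ j ∈ Finset.Icc 1 k, Y j))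
    - Sig - ∑ j ∈ Finset.Icc 1 k, S j

lemma remainder_zero : remainder p B Sig S X Y 0 = B - Sig := by
  simp [remainder, cMat_zero]

lemma conjTranspose_sum_skew {a : ℕ} {X : ℕ → Matrix (Fin a) (Fin a) ℂ} {k : ℕ}
    (h : ∀ j ∈ Finset.Icc 1 k, (X j)ᴴ = -X j) :
    (∑ j ∈ Finset.Icc 1 k, X j)ᴴ = -∑ j ∈ Finset.Icc 1 k, X j := by
  rw [Matrix.conjTranspose_sum, ← Finset.sum_neg_distrib]
  exact Finset.sum_congr rfl h

lemma IsChain.solves' (h : IsChain c p B Sig D S X Y) {k : ℕ} (hk : k < p) :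
    SolvesLinear c Sig (remainder p B Sig S X Y k) (S (k + 1)) (X (k + 1)) (Y (k + 1)) := by
  have := h.solves k hk
  rwa [h.D_eq k hk] at this

lemma IsChain.skew (h : IsChain c p B Sig D S X Y) {k : ℕ} (hk : k ≤ p) :
    (∑ j ∈ Finset.Icc 1 k, X j)ᴴ = -∑ j ∈ Finset.Icc 1 k, X j ∧
      (∑ j ∈ Finset.Icc 1 k, Y j)ᴴ = -∑ j ∈ Finset.Icc 1 k, Y j := by
  constructor <;> refine conjTranspose_sum_skew fun j hj => ?_ <;>
    obtain ⟨h1, h2⟩ := Finset.mem_Icc.1 hj <;>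
    obtain ⟨i, rfl⟩ := Nat.exists_eq_add_of_le' h1
  · exact (h.solves i (by omega)).X_skew
  · exact (h.solves i (by omega)).Y_skew

lemma IsChain.sum_S_bounds (h : IsChain c p B Sig D S X Y) {k : ℕ} (hk : k ≤ p) :
    blockDiag c (∑ j ∈ Finset.Icc 1 k, S j) = ∑ j ∈ Finset.Icc 1 k, S j ∧
      mnorm (∑ j ∈ Finset.Icc 1 k, S j)
        ≤ ∑ j ∈ Finset.range k, mnorm (remainder p B Sig S X Y j) := by
  induction k with
  | zero => simp [blockDiag_zero]
  | succ k ih =>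
    obtain ⟨h1, h2⟩ := ih (by omega)
    have hS := (h.solves' hk).S_eq
    rw [sum_Icc_one_succ, Finset.sum_range_succ]
    constructor
    · rw [blockDiag_add, h1, hS, blockDiag_blockDiag]
    · refine mnorm_add_le_of_le h2 ?_
      rw [hS]
      exact mnorm_blockDiag_le _

/-- The sums of the corrections are bounded by the sums of the remainders, provided that the
solution of the linear equation is bounded by `u` resp. `v` times the right-hand side. -/
lemma IsChain.sum_XY_bounds (h : IsChain c p B Sig D S X Y) {u v : ℝ}
    (hb : ∀ {X Y t}, Normalized c X Y → mnorm (X * Sig - Sig * Y) ≤ t →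
      mnorm X ≤ u * t ∧ mnorm Y ≤ v * t) {k : ℕ} (hk : k ≤ p) :
    mnorm (∑ j ∈ Finset.Icc 1 k, X j)
        ≤ u * ∑ j ∈ Finset.range k, mnorm (remainder p B Sig S X Y j) ∧
      mnorm (∑ j ∈ Finset.Icc 1 k, Y j)
        ≤ v * ∑ j ∈ Finset.range k, mnorm (remainder p B Sig S X Y j) ∧
      mnorm ((∑ j ∈ Finset.Icc 1 k, X j) * Sig - Sig * ∑ j ∈ Finset.Icc 1 k, Y j)
        ≤ ∑ j ∈ Finset.range k, mnorm (remainder p B Sig S X Y j) := by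
  induction k with
  | zero => simp
  | succ k ih =>
    obtain ⟨h1, h2, h3⟩ := ih (by omega)
    have hs := h.solves' hk
    have h4 : mnorm (X (k + 1) * Sig - Sig * Y (k + 1))
        ≤ mnorm (remainder p B Sig S X Y k) := by
      rw [hs.eq', hs.S_eq]
      exact mnorm_sub_blockDiag_le _
    obtain ⟨h5, h6⟩ := hb hs.normalized h4
    rw [sum_Icc_one_succ, sum_Icc_one_succ, Finset.sum_range_succ, mul_add, mul_add]
    refine ⟨mnorm_add_le_of_le h1 h5, mnorm_add_le_of_le h2 h6, ?_⟩
    have e1 : (∑ j ∈ Finset.Icc 1 k, X j + X (k + 1)) * Sig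
        - Sig * (∑ j ∈ Finset.Icc 1 k, Y j + Y (k + 1))
        = ((∑ j ∈ Finset.Icc 1 k, X j) * Sig - Sig * ∑ j ∈ Finset.Icc 1 k, Y j)
          + (X (k + 1) * Sig - Sig * Y (k + 1)) := by
      rw [Matrix.add_mul, Matrix.mul_add]; abel
    rw [e1]
    exact mnorm_add_le_of_le h3 h4

/-- The first remainder minus half of `W Σ - Σ Z`. Since the first correction removes from the
remainder all but its block-diagonal part `S₁`, this is `(D₁ + S₁)/2` up to later remainders. -/
lemma IsChain.mnorm_sub_half_le (h : IsChain c p B Sig D S X Y) {k : ℕ} (hk : k < p) :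
    mnorm ((B - Sig) - (1 / 2 : ℝ) • ((∑ j ∈ Finset.Icc 1 (k + 1), X j) * Sig
        - Sig * ∑ j ∈ Finset.Icc 1 (k + 1), Y j))
      ≤ 1 / 2 * (mnorm (B - Sig)
        + ∑ j ∈ Finset.range (k + 1), mnorm (remainder p B Sig S X Y j)) := by
  induction k with
  | zero =>
    have hs := h.solves' hk
    simp only [zero_add, Finset.Icc_self, Finset.sum_singleton, Finset.sum_range_one] at hs ⊢
    rw [hs.eq', remainder_zero]
    have e1 : (B - Sig) - (1 / 2 : ℝ) • ((B - Sig) - S 1)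
        = (1 / 2 : ℝ) • ((B - Sig) + S 1) := by module
    rw [e1]
    refine mnorm_smul_le_of_le (by norm_num) (mnorm_add_le_of_le le_rfl ?_)
    rw [hs.S_eq, remainder_zero]
    exact mnorm_blockDiag_le _
  | succ k ih =>
    have h1 := ih (by omega)
    have hs := h.solves' hk
    have h4 : mnorm (X (k + 1 + 1) * Sig - Sig * Y (k + 1 + 1))
        ≤ mnorm (remainder p B Sig S X Y (k + 1)) := by
      rw [hs.eq', hs.S_eq]
      exact mnorm_sub_blockDiag_le _
    rw [sum_Icc_one_succ X, sum_Icc_one_succ Y, Finset.sum_range_succ]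
    have e1 : (B - Sig) - (1 / 2 : ℝ) • ((∑ j ∈ Finset.Icc 1 (k + 1), X j + X (k + 1 + 1)) * Sig
        - Sig * (∑ j ∈ Finset.Icc 1 (k + 1), Y j + Y (k + 1 + 1)))
        = ((B - Sig) - (1 / 2 : ℝ) • ((∑ j ∈ Finset.Icc 1 (k + 1), X j) * Sig
          - Sig * ∑ j ∈ Finset.Icc 1 (k + 1), Y j))
          - (1 / 2 : ℝ) • (X (k + 1 + 1) * Sig - Sig * Y (k + 1 + 1)) := by
      rw [Matrix.add_mul, Matrix.mul_add]; module
    rw [e1]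
    refine (mnorm_sub_le_of_le h1 (mnorm_smul_le_of_le (by norm_num) h4)).trans (le_of_eq ?_)
    ring

/-- By the linear equation, the remainder after a correction is the increment of the non-linear
part. -/
lemma IsChain.remainder_succ (hp : 2 ≤ p) (h : IsChain c p B Sig D S X Y) {k : ℕ} (hk : k < p) :
    remainder p B Sig S X Y (k + 1)
      = nonlin p (B - Sig) Sig (∑ j ∈ Finset.Icc 1 k, X j + X (k + 1))
          (∑ j ∈ Finset.Icc 1 k, Y j + Y (k + 1))
        - nonlin p (B - Sig) Sig (∑ j ∈ Finset.Icc 1 k, X j) (∑ j ∈ Finset.Icc 1 k, Y j) := by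
  have hs := (h.solves' hk).eq'
  have e1 : ∀ i ≤ p, remainder p B Sig S X Y i = (B - Sig)
      - ((∑ j ∈ Finset.Icc 1 i, X j) * Sig - Sig * ∑ j ∈ Finset.Icc 1 i, Y j)
      + nonlin p (B - Sig) Sig (∑ j ∈ Finset.Icc 1 i, X j) (∑ j ∈ Finset.Icc 1 i, Y j)
      - ∑ j ∈ Finset.Icc 1 i, S j := by
    intro i hi
    have h2 := conj_mul_eq_nonlin hp (B - Sig) Sig (∑ j ∈ Finset.Icc 1 i, X j)
      (∑ j ∈ Finset.Icc 1 i, Y j)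
    rw [sub_add_cancel] at h2
    rw [remainder, conjTranspose_cMat p (h.skew hi).1, h2]
    abel
  have hk1 := e1 k hk.le
  rw [e1 (k + 1) hk]
  rw [hk1] at hs
  simp only [sum_Icc_one_succ, Matrix.add_mul, Matrix.mul_add]
  have e2 : X (k + 1) * Sig = Sig * Y (k + 1) + (X (k + 1) * Sig - Sig * Y (k + 1)) := by abel
  rw [e2, hs]
  abel

lemma IsChain.mnorm_remainder_succ_le (hp : 2 ≤ p) (h : IsChain c p B Sig D S X Y) {u v t κ : ℝ}
    (hu : 0 ≤ u) (hv : 0 ≤ v)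
    (hb : ∀ {X Y t}, Normalized c X Y → mnorm (X * Sig - Sig * Y) ≤ t →
      mnorm X ≤ u * t ∧ mnorm Y ≤ v * t) (hB : mnorm B ≤ κ) {k : ℕ} (hk : k < p)
    (ht : ∑ j ∈ Finset.range (k + 1), mnorm (remainder p B Sig S X Y j) ≤ t)
    (hut : u * t ≤ 1 / 5) (hvt : v * t ≤ 1 / 5) :
    mnorm (remainder p B Sig S X Y (k + 1)) ≤ mnorm (remainder p B Sig S X Y k) *
      ((u + v) * (1 / 2 * (mnorm (B - Sig) + t)
          + 1 / 2 * ∑ j ∈ Finset.range k, mnorm (remainder p B Sig S X Y j))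
        + 1 / 2 * mnorm (B - Sig) * (u + v) ^ 2
          * (∑ j ∈ Finset.range k, mnorm (remainder p B Sig S X Y j) + t)
        + 1 / 2 * (u * v) * (t ^ 2
          + (∑ j ∈ Finset.range k, mnorm (remainder p B Sig S X Y j)) * t
          + (∑ j ∈ Finset.range k, mnorm (remainder p B Sig S X Y j)) ^ 2)
        + 3 / 2 * mnorm (B - Sig) * (u * v) * (u + v) * t ^ 2
        + κ * t ^ 3 * (u ^ 2 * v ^ 2 + 41 / 50 * (u ^ 4 + v ^ 4))) := by
  have hs := h.solves' hk
  have h4 : mnorm (X (k + 1) * Sig - Sig * Y (k + 1))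
      ≤ mnorm (remainder p B Sig S X Y k) := by
    rw [hs.eq', hs.S_eq]
    exact mnorm_sub_blockDiag_le _
  obtain ⟨h5, h6⟩ := hb hs.normalized h4
  obtain ⟨h1, h2, h3⟩ := h.sum_XY_bounds hb hk.le
  have h7 := h.mnorm_sub_half_le hk
  rw [sum_Icc_one_succ X, sum_Icc_one_succ Y, Finset.sum_range_succ] at h7
  rw [Finset.sum_range_succ] at ht
  have h0 : 0 ≤ ∑ j ∈ Finset.range k, mnorm (remainder p B Sig S X Y j) :=
    Finset.sum_nonneg fun _ _ => mnorm_nonneg _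
  have hd := mnorm_nonneg (remainder p B Sig S X Y k)
  have he := mnorm_nonneg (B - Sig)
  have hκ : 0 ≤ κ := (mnorm_nonneg _).trans hB
  rw [h.remainder_succ hp hk]
  refine (mnorm_nonlin_sub_le (k := κ) hp hu hv h0 h5 h6 h1 h2 h3 h4 le_rfl h7
    (by rwa [sub_add_cancel]) ((mul_le_mul_of_nonneg_left ht hu).trans hut)
    ((mul_le_mul_of_nonneg_left ht hv).trans hvt)).trans ?_
  clear h hb hs h1 h2 h3 h4 h5 h6 h7 hut hvt
  generalize ∑ j ∈ Finset.range k, mnorm (remainder p B Sig S X Y j) = s at *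
  generalize mnorm (remainder p B Sig S X Y k) = d at *
  generalize mnorm (B - Sig) = e at *
  have hsd : 0 ≤ s + d := add_nonneg h0 hd
  refine mul_le_mul_of_nonneg_left ?_ hd
  gcongr

end ChainEstimates

/-! ### Contraction of the scaled errors -/

/-- `T` is a state of the iteration whose scaled defects and scaled residual are at most `ε`, and
whose last component differs from the initial one by a block-diagonal matrix of scaled norm at most
`R`. The scaling factors are `a` for the defects and `ω` for the matrices of size `l × q`. -/
structure Near {m n l q : ℕ} (c : Composition q) (σ : Fin q → ℝ) (M : Matrix (Fin m) (Fin n) ℂ)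
    (a ω ε R : ℝ) (T : Triplet m n l q) : Prop where
  defect_U : a * mnorm (defect T.1) ≤ ε
  defect_V : a * mnorm (defect T.2.1) ≤ ε
  residual : ω * mnorm (T.1ᴴ * M * T.2.1 - T.2.2) ≤ ε
  diag : blockDiag c (T.2.2 - rectDiagonal l σ) = T.2.2 - rectDiagonal l σ
  dist : ω * mnorm (T.2.2 - rectDiagonal l σ) ≤ R

/-- On the states with parameters up to `ε₀` and `R₀` the step is uniquely defined, reduces the
scaled errors from `ε` to `(G ε)^p ε`, and moves the iterate by a multiple of `ε`. -/
def Contracts {q : ℕ} (m n l p : ℕ) (c : Composition q) (σ : Fin q → ℝ) (a ω ε₀ R₀ G s : ℝ) :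
    Prop :=
  ∀ (M : Matrix (Fin m) (Fin n) ℂ) (ε R : ℝ) (T : Triplet m n l q), ε ≤ ε₀ → R ≤ R₀ →
    Near c σ M a ω ε R T → ∃ T' : Triplet m n l q, IsStep p c M T T' ∧
      (∀ T'', IsStep p c M T T'' → T'' = T') ∧
      Near c σ M a ω ((G * ε) ^ p * ε) (R + s * ε) T' ∧
      mnorm (T'.1 - T.1) ≤ mnorm T.1 * (30 * ε) ∧
      mnorm (T'.2.1 - T.2.1) ≤ mnorm T.2.1 * (30 * ε) ∧
      ω * mnorm (T'.2.2 - T.2.2) ≤ s * ε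

section Contraction

variable {m n l q : ℕ} {c : Composition q} {p : ℕ} {σ : Fin q → ℝ} {κ K : ℝ}

lemma Near.eps_nonneg {M : Matrix (Fin m) (Fin n) ℂ} {a ω ε R : ℝ} {T : Triplet m n l q}
    (h : Near c σ M a ω ε R T) (ha : 0 ≤ a) : 0 ≤ ε :=
  (mul_nonneg ha (mnorm_nonneg _)).trans h.defect_U

lemma Near.R_nonneg {M : Matrix (Fin m) (Fin n) ℂ} {a ω ε R : ℝ} {T : Triplet m n l q}
    (h : Near c σ M a ω ε R T) (hω : 0 ≤ ω) : 0 ≤ R :=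
  (mul_nonneg hω (mnorm_nonneg _)).trans h.dist

lemma exists_unique_isStep (hp : 1 ≤ p) (M : Matrix (Fin m) (Fin n) ℂ) (T : Triplet m n l q)
    {Sig₀ : Matrix (Fin l) (Fin q) ℂ} {x y : ℝ} (hS : SolvableWith c Sig₀ x y)
    (hP : blockDiag c (T.2.2 - Sig₀) = T.2.2 - Sig₀)
    (hρ : (x + y) * mnorm (T.2.2 - Sig₀) < 1) :
    ∃ T', IsStep p c M T T' ∧ ∀ T'', IsStep p c M T T'' → T'' = T' := by
  have hSig : Sig₀ + (T.2.2 - Sig₀) = T.2.2 := add_sub_cancel _ _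
  obtain ⟨D, S, X, Y, hch⟩ := exists_isChain (c := c) (Sig := T.2.2) p (stepB p M T)
    (fun D => by
      have := hS.exists hP hρ D
      rwa [hSig] at this)
  refine ⟨_, (isStep_iff hp).2 ⟨D, S, X, Y, hch, rfl⟩, fun T'' hT'' => ?_⟩
  obtain ⟨D', S', X', Y', hch', rfl⟩ := (isStep_iff hp).1 hT''
  obtain ⟨h1, h2, h3⟩ := IsChain.sums_unique (fun {D S S' X X' Y Y'} h h' => by
    rw [← hSig] at h h'
    exact hS.unique hρ h h') hch' hch p le_rfl
  rw [h1, h2, h3]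

/-- The scaled bound for the first remainder. -/
lemma Near.mnorm_stepB_sub_le {M : Matrix (Fin m) (Fin n) ℂ} {H ω ε R η : ℝ}
    {T : Triplet m n l q} (hC : Conditioned c σ κ K) (h : Near c σ M H ω ε R T) (hω : 0 ≤ ω)
    (hH : 1 ≤ H) (hK : ω * K ≤ H) (hη : 1 ≤ η * H) (hε : ε ≤ 1 / 4) :
    ω * mnorm (stepB p M T - T.2.2) ≤
      ((1 + ε * η / 2 * (1 + ε * η)) ^ 2
        + (1 + R * η) * ((1 + ε * η) + (1 + ε * η) ^ 2 * (ε * η) / 4)) * ε := by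
  have hε0 := h.eps_nonneg (by linarith)
  have hR0 := h.R_nonneg hω
  have hH0 : 0 < H := by linarith
  have hη0 : 0 < η := by
    by_contra hneg
    push Not at hneg
    nlinarith
  set E := ε / H with hE
  have hE0 : 0 ≤ E := by positivity
  have hHE : H * E = ε := by rw [hE]; field_simp
  have hEε : E ≤ ε := by nlinarith
  have hEη : E ≤ ε * η := by
    rw [hE, div_le_iff₀ hH0]; nlinarith
  have hU : mnorm (defect T.1) ≤ E := by
    rw [hE, le_div_iff₀ hH0, mul_comm]; exact h.defect_U
  have hV : mnorm (defect T.2.1) ≤ E := by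
    rw [hE, le_div_iff₀ hH0, mul_comm]; exact h.defect_V
  have hU' := mnorm_sMat_le p hU (by linarith)
  have hV' := mnorm_sMat_le p hV (by linarith)
  have hSig : mnorm T.2.2 ≤ K + mnorm (T.2.2 - rectDiagonal l σ) := by
    have := mnorm_add_le_of_le (mnorm_rectDiagonal_le (l := l) hC)
      (le_refl (mnorm (T.2.2 - rectDiagonal l σ)))
    rwa [add_sub_cancel] at this
  have h1 := ClusterSVD.mnorm_stepB_sub_le (p := p) hU' hV'
    (le_refl (mnorm (T.1ᴴ * M * T.2.1 - T.2.2))) hSig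
  set w := E / 2 + E ^ 2 / 2 with hw
  have hw0 : 0 ≤ w := by positivity
  have hwle : w ≤ ε * η / 2 * (1 + ε * η) := by
    have : w = E / 2 * (1 + E) := by rw [hw]; ring
    rw [this]; gcongr
  have h2 : ω * (K + mnorm (T.2.2 - rectDiagonal l σ)) ≤ H + R := by
    rw [mul_add]; exact add_le_add hK h.dist
  have h3 : 2 * w + w ^ 2 = E * ((1 + E) + (1 + E) ^ 2 * E / 4) := by rw [hw]; ring
  calc ω * mnorm (stepB p M T - T.2.2)
      ≤ ω * ((1 + w) ^ 2 * mnorm (T.1ᴴ * M * T.2.1 - T.2.2)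
        + (K + mnorm (T.2.2 - rectDiagonal l σ)) * (2 * w + w ^ 2)) :=
        mul_le_mul_of_nonneg_left h1 hω
    _ = (1 + w) ^ 2 * (ω * mnorm (T.1ᴴ * M * T.2.1 - T.2.2))
        + ω * (K + mnorm (T.2.2 - rectDiagonal l σ)) * (2 * w + w ^ 2) := by ring
    _ ≤ (1 + w) ^ 2 * ε + (H + R) * (2 * w + w ^ 2) := by
        refine add_le_add (mul_le_mul_of_nonneg_left h.residual (by positivity))
          (mul_le_mul_of_nonneg_right h2 (by positivity))
    _ = (1 + w) ^ 2 * ε + (H * E + R * E) * ((1 + E) + (1 + E) ^ 2 * E / 4) := by rw [h3]; ring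
    _ ≤ (1 + ε * η / 2 * (1 + ε * η)) ^ 2 * ε
        + (ε + R * (ε * η)) * ((1 + ε * η) + (1 + ε * η) ^ 2 * (ε * η) / 4) := by
        rw [hHE]; gcongr
    _ = _ := by ring

/-- The coefficient in the linear bound for the contraction factor of one correction. -/
noncomputable def thetaCoeff (r μ R C x ε s t : ℝ) : ℝ :=
  r * μ * (x + t + s) / 2
    + ε * (1 / 2 * (r * μ) ^ 2 * x * (s + t) + (r * μ) ^ 2 / 8 * (t ^ 2 + s * t + s ^ 2))
    + ε ^ 2 * (3 / 8 * (r * μ) ^ 3 * x * t ^ 2 + (1 + R + x * ε) * r ^ 4 * t ^ 3 * C)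

/-- The contraction factor of `mnorm_nonlin_sub_le` in scaled quantities. The terms of degree at
least four carry the factor `‖Σ‖ ≤ k`, which is absorbed since `κ K = h³`. -/
lemma theta_le {h ω u v gX gY r μ R C x ε ε₀ s t e k ρ S T : ℝ} (hκ : 1 ≤ κ) (hh : 1 ≤ h)
    (hh3 : h ^ 3 = κ * K) (hω : ω = κ * h) (hu0 : 0 ≤ u) (hv0 : 0 ≤ v) (hgX : 0 ≤ gX)
    (hgY : 0 ≤ gY) (hr : 0 ≤ r) (hu : u ≤ gX * κ * r) (hv : v ≤ gY * κ * r)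
    (hμ : gX + gY ≤ μ * h) (hC : gX ^ 2 * gY ^ 2 + 41 / 50 * (gX ^ 4 + gY ^ 4) ≤ C)
    (he0 : 0 ≤ e) (hS0 : 0 ≤ S) (hT0 : 0 ≤ T) (hρ0 : 0 ≤ ρ) (hk0 : 0 ≤ k)
    (hε0 : 0 ≤ ε) (hε : ε ≤ ε₀) (he : ω * e ≤ x * ε) (hS : ω * S ≤ s * ε) (hT : ω * T ≤ t * ε)
    (hρ : ω * ρ ≤ R) (hk : k ≤ K + ρ + e) (hx : 0 ≤ x) (hs : 0 ≤ s) (ht : 0 ≤ t) :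
    (u + v) * (1 / 2 * (e + T) + 1 / 2 * S) + 1 / 2 * e * (u + v) ^ 2 * (S + T)
        + 1 / 2 * (u * v) * (T ^ 2 + S * T + S ^ 2) + 3 / 2 * e * (u * v) * (u + v) * T ^ 2
        + k * T ^ 3 * (u ^ 2 * v ^ 2 + 41 / 50 * (u ^ 4 + v ^ 4))
      ≤ thetaCoeff r μ R C x ε₀ s t * ε := by
  have hκ0 : 0 < κ := by linarith
  have hh0 : 0 < h := by linarith
  have hω0 : 0 < ω := by rw [hω]; positivity
  have hμ0 : 0 ≤ μ := by
    by_contra hneg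
    push Not at hneg
    nlinarith
  have hR0 : 0 ≤ R := (mul_nonneg hω0.le hρ0).trans hρ
  have hC0 : 0 ≤ C := le_trans (by positivity) hC
  set g := r * μ with hg
  have hg0 : 0 ≤ g := mul_nonneg hr hμ0
  have huv : u + v ≤ g * ω := by
    calc u + v ≤ gX * κ * r + gY * κ * r := add_le_add hu hv
      _ = κ * r * (gX + gY) := by ring
      _ ≤ κ * r * (μ * h) := mul_le_mul_of_nonneg_left hμ (by positivity)
      _ = _ := by rw [hg, hω]; ring
  have huv4 : u * v ≤ (g * ω) ^ 2 / 4 := by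
    have h1 : (u + v) ^ 2 ≤ (g * ω) ^ 2 := pow_le_pow_left₀ (by positivity) huv 2
    linarith [sq_nonneg (u - v), h1]
  have t1 : (u + v) * (1 / 2 * (e + T) + 1 / 2 * S) ≤ g * (x + t + s) / 2 * ε := by
    calc _ ≤ g * ω * (1 / 2 * (e + T) + 1 / 2 * S) :=
          mul_le_mul_of_nonneg_right huv (by positivity)
      _ = g / 2 * (ω * e + ω * T + ω * S) := by ring
      _ ≤ g / 2 * (x * ε + t * ε + s * ε) := by gcongr
      _ = _ := by ring
  have t2 : 1 / 2 * e * (u + v) ^ 2 * (S + T) ≤ ε₀ * (1 / 2 * g ^ 2 * x * (s + t)) * ε := by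
    calc _ ≤ 1 / 2 * e * (g * ω) ^ 2 * (S + T) := by gcongr
      _ = 1 / 2 * g ^ 2 * (ω * e) * (ω * S + ω * T) := by ring
      _ ≤ 1 / 2 * g ^ 2 * (x * ε) * (s * ε + t * ε) := by gcongr
      _ = ε * (1 / 2 * g ^ 2 * x * (s + t)) * ε := by ring
      _ ≤ _ := by gcongr
  have t3 : 1 / 2 * (u * v) * (T ^ 2 + S * T + S ^ 2)
      ≤ ε₀ * (g ^ 2 / 8 * (t ^ 2 + s * t + s ^ 2)) * ε := by
    calc _ ≤ 1 / 2 * ((g * ω) ^ 2 / 4) * (T ^ 2 + S * T + S ^ 2) := by gcongr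
      _ = g ^ 2 / 8 * ((ω * T) ^ 2 + (ω * S) * (ω * T) + (ω * S) ^ 2) := by ring
      _ ≤ g ^ 2 / 8 * ((t * ε) ^ 2 + (s * ε) * (t * ε) + (s * ε) ^ 2) := by gcongr
      _ = ε * (g ^ 2 / 8 * (t ^ 2 + s * t + s ^ 2)) * ε := by ring
      _ ≤ _ := by gcongr
  have t4 : 3 / 2 * e * (u * v) * (u + v) * T ^ 2
      ≤ ε₀ ^ 2 * (3 / 8 * g ^ 3 * x * t ^ 2) * ε := by
    calc _ ≤ 3 / 2 * e * ((g * ω) ^ 2 / 4) * (g * ω) * T ^ 2 := by gcongr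
      _ = 3 / 8 * g ^ 3 * (ω * e) * (ω * T) ^ 2 := by ring
      _ ≤ 3 / 8 * g ^ 3 * (x * ε) * (t * ε) ^ 2 := by gcongr
      _ = ε ^ 2 * (3 / 8 * g ^ 3 * x * t ^ 2) * ε := by ring
      _ ≤ _ := by gcongr
  have hκk : κ * k ≤ h ^ 3 * (1 + R + x * ε) := by
    have hle : ∀ z, 0 ≤ z → κ * z ≤ ω * z := fun z hz => by
      rw [hω]; exact mul_le_mul_of_nonneg_right (le_mul_of_one_le_right hκ0.le hh) hz
    have h1 := (hle ρ hρ0).trans hρ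
    have h2 := (hle e he0).trans he
    have h3 : κ * k ≤ κ * (K + ρ + e) := mul_le_mul_of_nonneg_left hk hκ0.le
    have h4 : (1 : ℝ) ≤ h ^ 3 := one_le_pow₀ hh
    have h5 : 0 ≤ x * ε := by positivity
    have h6 : R + x * ε ≤ h ^ 3 * (R + x * ε) := le_mul_of_one_le_left (by positivity) h4
    linarith
  have t5 : k * T ^ 3 * (u ^ 2 * v ^ 2 + 41 / 50 * (u ^ 4 + v ^ 4))
      ≤ ε₀ ^ 2 * ((1 + R + x * ε₀) * r ^ 4 * t ^ 3 * C) * ε := by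
    calc _ ≤ k * T ^ 3 * ((gX * κ * r) ^ 2 * (gY * κ * r) ^ 2
          + 41 / 50 * ((gX * κ * r) ^ 4 + (gY * κ * r) ^ 4)) := by gcongr
      _ = κ * k * (κ * T) ^ 3 * r ^ 4 * (gX ^ 2 * gY ^ 2 + 41 / 50 * (gX ^ 4 + gY ^ 4)) := by ring
      _ ≤ h ^ 3 * (1 + R + x * ε) * (κ * T) ^ 3 * r ^ 4 * C := by gcongr
      _ = (1 + R + x * ε) * (ω * T) ^ 3 * r ^ 4 * C := by rw [hω]; ring
      _ ≤ (1 + R + x * ε) * (t * ε) ^ 3 * r ^ 4 * C := by gcongr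
      _ = ε ^ 2 * ((1 + R + x * ε) * r ^ 4 * t ^ 3 * C) * ε := by ring
      _ ≤ _ := by gcongr
  have e1 : thetaCoeff r μ R C x ε₀ s t * ε = g * (x + t + s) / 2 * ε
      + ε₀ * (1 / 2 * g ^ 2 * x * (s + t)) * ε + ε₀ * (g ^ 2 / 8 * (t ^ 2 + s * t + s ^ 2)) * ε
      + ε₀ ^ 2 * (3 / 8 * g ^ 3 * x * t ^ 2) * ε
      + ε₀ ^ 2 * ((1 + R + x * ε₀) * r ^ 4 * t ^ 3 * C) * ε := by
    rw [thetaCoeff, ← hg]; ring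
  rw [e1]
  linarith

end Contraction

/-! ### Contraction for orders at least two -/

/-- Numerical conditions on the constants of the error analysis that do not depend on the order:
`gX κ` and `gY κ` bound the inverse of the linear equation at the initial point, `r` is the loss due
to the perturbation of size `R₀`, and `x` bounds the first remainder. -/
structure StepConstants (ε₀ R₀ gX gY μ η r x : ℝ) : Prop where
  ε₀_le : ε₀ ≤ 1 / 10
  gX_nonneg : 0 ≤ gX
  gY_nonneg : 0 ≤ gY
  gX_le : gX ≤ 3 / 2
  gY_le : gY ≤ 3 / 2
  η_nonneg : 0 ≤ η
  μ_nonneg : 0 ≤ μ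
  μR_lt : μ * R₀ < 1
  le_r : 1 / (1 - μ * R₀) ≤ r
  le_x : (1 + ε₀ * η / 2 * (1 + ε₀ * η)) ^ 2
    + (1 + R₀ * η) * ((1 + ε₀ * η) + (1 + ε₀ * η) ^ 2 * (ε₀ * η) / 4) ≤ x

/-- Numerical conditions under which the steps of order at least two contract with constant `G`:
`c₁ ε` and `c₂ ε` are the contraction factors of the first and of the later corrections, and `s`
bounds the sum of all remainders. -/
structure HighOrderConstants (ε₀ R₀ gX gY μ η r x c₁ c₂ s G : ℝ) : Prop
    extends StepConstants ε₀ R₀ gX gY μ η r x where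
  c₁_nonneg : 0 ≤ c₁
  c₂_nonneg : 0 ≤ c₂
  le_c₁ : thetaCoeff r μ R₀ (gX ^ 2 * gY ^ 2 + 41 / 50 * (gX ^ 4 + gY ^ 4)) x ε₀ 0 x ≤ c₁
  le_c₂ : thetaCoeff r μ R₀ (gX ^ 2 * gY ^ 2 + 41 / 50 * (gX ^ 4 + gY ^ 4)) x ε₀ s s ≤ c₂
  c₂_lt : c₂ * ε₀ < 1
  le_s : x + c₁ * ε₀ * x / (1 - c₂ * ε₀) ≤ s
  sum_le : 3 / 2 * r * s * ε₀ ≤ 1 / 5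
  z_le : 3 / 2 * r * s ≤ 10
  G_one : 1 ≤ G
  c₂_le : c₂ ≤ G
  z_le_G : 3 / 2 * r * s ≤ G
  prod_le : x * c₁ * c₂ ≤ G ^ 2
  defect_le : 18 / 5 + 27 / 100 * (3 / 2 * r * s) ^ 3 ≤ G ^ 2

section StepBounds

variable {m n l q : ℕ} {c : Composition q} {p : ℕ} {σ : Fin q → ℝ} {κ K : ℝ}
  {ε₀ R₀ gX gY μ η r x : ℝ}

lemma StepConstants.one_le_r (hc : StepConstants ε₀ R₀ gX gY μ η r x) (hR : 0 ≤ R₀) : 1 ≤ r := by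
  refine le_trans ?_ hc.le_r
  rw [le_div_iff₀ (by linarith [hc.μR_lt])]
  linarith [mul_nonneg hc.μ_nonneg hR]

lemma StepConstants.one_le_x (hc : StepConstants ε₀ R₀ gX gY μ η r x) (hR : 0 ≤ R₀)
    (hε : 0 ≤ ε₀) : 1 ≤ x := by
  refine le_trans ?_ hc.le_x
  have := hc.η_nonneg
  have h1 : 0 ≤ ε₀ * η / 2 * (1 + ε₀ * η) := by positivity
  have h2 : 0 ≤ (1 + R₀ * η) * ((1 + ε₀ * η) + (1 + ε₀ * η) ^ 2 * (ε₀ * η) / 4) := by positivity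
  nlinarith

/-- The bound of the first remainder in terms of the constants. -/
lemma StepConstants.mnorm_stepB_sub_le (hc : StepConstants ε₀ R₀ gX gY μ η r x)
    {M : Matrix (Fin m) (Fin n) ℂ} {H ω ε R : ℝ} {T : Triplet m n l q}
    (hC : Conditioned c σ κ K) (h : Near c σ M H ω ε R T) (hω : 0 ≤ ω) (hH : 1 ≤ H)
    (hK : ω * K ≤ H) (hη : 1 ≤ η * H) (hε : ε ≤ ε₀) (hR : R ≤ R₀) :
    ω * mnorm (stepB p M T - T.2.2) ≤ x * ε := by
  have hε0 := h.eps_nonneg (by linarith)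
  have hR0 := h.R_nonneg hω
  have hη0 := hc.η_nonneg
  have hε₀ := hε0.trans hε
  have hR₀ := hR0.trans hR
  refine (h.mnorm_stepB_sub_le hC hω hH hK hη (by linarith [hc.ε₀_le])).trans ?_
  refine mul_le_mul_of_nonneg_right (le_trans ?_ hc.le_x) hε0
  gcongr

/-- The linear equation at the current point is solved with the loss `r`. -/
lemma StepConstants.solution_le (hc : StepConstants ε₀ R₀ gX gY μ η r x)
    {M : Matrix (Fin m) (Fin n) ℂ} {H h ε R : ℝ} {T : Triplet m n l q}
    (hS : SolvableWith c (rectDiagonal l σ) (gX * κ) (gY * κ)) (hκ : 0 < κ)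
    (hμ : gX + gY ≤ μ * h) (hN : Near c σ M H (κ * h) ε R T) (hR : R ≤ R₀) :
    (gX * κ + gY * κ) * mnorm (T.2.2 - rectDiagonal l σ) < 1 ∧
    ∀ {X : Matrix (Fin l) (Fin l) ℂ} {Y : Matrix (Fin q) (Fin q) ℂ} {t : ℝ}, Normalized c X Y →
      mnorm (X * T.2.2 - T.2.2 * Y) ≤ t → mnorm X ≤ gX * κ * r * t ∧ mnorm Y ≤ gY * κ * r * t := by
  have hρ0 := mnorm_nonneg (T.2.2 - rectDiagonal l σ)
  set ρ := mnorm (T.2.2 - rectDiagonal l σ) with hρ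
  have h1 : (gX * κ + gY * κ) * ρ ≤ μ * R₀ := by
    calc (gX * κ + gY * κ) * ρ = (gX + gY) * (κ * ρ) := by ring
      _ ≤ μ * h * (κ * ρ) := mul_le_mul_of_nonneg_right hμ (by positivity)
      _ = μ * (κ * h * ρ) := by ring
      _ ≤ μ * R₀ := mul_le_mul_of_nonneg_left (hN.dist.trans hR) hc.μ_nonneg
  have h2 := hc.μR_lt
  refine ⟨by linarith, fun {X Y t} hXY ht => ?_⟩
  have ht0 : 0 ≤ t := (mnorm_nonneg _).trans ht
  have e : rectDiagonal l σ + (T.2.2 - rectDiagonal l σ) = T.2.2 := add_sub_cancel _ _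
  have h3 := hS.bound_perturbed (P := T.2.2 - rectDiagonal l σ) (ρ := ρ) le_rfl (by linarith) hXY
    (t := t) (by rwa [e])
  have h4 : 1 / (1 - (gX * κ + gY * κ) * ρ) ≤ r :=
    le_trans (one_div_le_one_div_of_le (by linarith) (by linarith)) hc.le_r
  have hgX := hc.gX_nonneg
  have hgY := hc.gY_nonneg
  exact ⟨h3.1.trans (by gcongr), h3.2.trans (by gcongr)⟩

/-- The defect after a step of order at least two. -/
lemma scaled_defect_step_le {a b : ℕ} (hp : 2 ≤ p) (U : Matrix (Fin a) (Fin b) ℂ)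
    {W : Matrix (Fin b) (Fin b) ℂ} (hW : Wᴴ = -W) {h ε z G : ℝ} (hh : 1 ≤ h) (hε : ε ≤ 1 / 10)
    (hU : h ^ 4 * mnorm (defect U) ≤ ε) (hz : 0 ≤ z) (hWz : h * mnorm W ≤ z * ε)
    (hzε : z * ε ≤ 1 / 5) (hG : 1 ≤ G) (hzG : z ≤ G) (hG2 : 18 / 5 + 27 / 100 * z ^ 3 ≤ G ^ 2) :
    h ^ 4 * mnorm (defect (U * (1 + sMat p (defect U)) * (1 + cMat p W))) ≤ (G * ε) ^ p * ε := by
  have hh0 : 0 < h := by linarith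
  have hε0 : 0 ≤ ε := le_trans (mul_nonneg (by positivity) (mnorm_nonneg _)) hU
  have hw0 := mnorm_nonneg W
  set w := mnorm W with hw
  have hwz : w ≤ z * ε := by nlinarith
  have hE0 := mnorm_nonneg (defect U)
  set E := mnorm (defect U) with hE
  have hEε : E ≤ ε := le_trans (le_mul_of_one_le_left hE0 (one_le_pow₀ hh)) hU
  have hw5 : w ≤ 1 / 5 := hwz.trans hzε
  have h1 := mnorm_defect_step_le (p := p) U hW (le_refl E) (by linarith)
    (mnorm_cMat_le hp (le_refl w) hw5) (mnorm_cMat_residual_le hp (le_refl w) (by linarith))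
  have h2 : h ^ 4 * (1 / 4 * (w ^ 2) ^ (p / 2 + 1) / (1 - w ^ 2))
      ≤ 27 / 100 * (z * ε) ^ (p + 1) := by
    have hw2 : w ^ 2 ≤ 1 / 25 := by nlinarith
    have a1 : h ^ 4 * (w ^ 2) ^ (p / 2 + 1) ≤ (z * ε) ^ (p + 1) := by
      calc h ^ 4 * (w ^ 2) ^ (p / 2 + 1) ≤ h ^ (2 * (p / 2 + 1)) * (w ^ 2) ^ (p / 2 + 1) :=
            mul_le_mul_of_nonneg_right (pow_le_pow_right₀ hh (by omega)) (by positivity)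
        _ = (h * w) ^ (2 * (p / 2 + 1)) := by rw [mul_pow, ← pow_mul]
        _ ≤ (z * ε) ^ (2 * (p / 2 + 1)) := pow_le_pow_left₀ (by positivity) hWz _
        _ ≤ (z * ε) ^ (p + 1) :=
            pow_le_pow_of_le_one (by positivity) (by linarith) (by omega)
    have a2 : 1 / (1 - w ^ 2) ≤ 25 / 24 := by
      rw [div_le_div_iff₀ (by linarith) (by norm_num)]; linarith
    calc h ^ 4 * (1 / 4 * (w ^ 2) ^ (p / 2 + 1) / (1 - w ^ 2))
        = 1 / 4 * (h ^ 4 * (w ^ 2) ^ (p / 2 + 1)) * (1 / (1 - w ^ 2)) := by ring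
      _ ≤ 1 / 4 * (z * ε) ^ (p + 1) * (25 / 24) := by
          refine mul_le_mul (by linarith) a2 ?_ (by positivity)
          exact one_div_nonneg.2 (by linarith)
      _ ≤ _ := by
          have : 0 ≤ (z * ε) ^ (p + 1) := by positivity
          linarith
  have h3 : h ^ 4 * ((1 + 13 / 10 * w) ^ 2 * (2 * E ^ (p + 1) / (1 - E)))
      ≤ 18 / 5 * ε ^ (p + 1) := by
    have b1 : (1 + 13 / 10 * w) ^ 2 ≤ (63 / 50) ^ 2 :=
      pow_le_pow_left₀ (by positivity) (by linarith) 2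
    have b2 : 1 / (1 - E) ≤ 10 / 9 := by
      rw [div_le_div_iff₀ (by linarith) (by norm_num)]; linarith
    have b3 : h ^ 4 * E * E ^ p ≤ ε * ε ^ p := by gcongr
    calc h ^ 4 * ((1 + 13 / 10 * w) ^ 2 * (2 * E ^ (p + 1) / (1 - E)))
        = 2 * (1 + 13 / 10 * w) ^ 2 * (1 / (1 - E)) * (h ^ 4 * E * E ^ p) := by ring
      _ ≤ 2 * (63 / 50) ^ 2 * (10 / 9) * (ε * ε ^ p) := by
          have : 0 ≤ 1 / (1 - E) := one_div_nonneg.2 (by linarith)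
          gcongr
      _ ≤ 18 / 5 * ε ^ (p + 1) := by
          have : 0 ≤ ε ^ p * ε := by positivity
          rw [pow_succ ε p]; linarith
  -- it suffices to know this for `p = 2`, as `z ≤ G` and `1 ≤ G`
  have h4 : 27 / 100 * z ^ (p + 1) + 18 / 5 ≤ G ^ p := by
    obtain ⟨k, rfl⟩ := Nat.exists_eq_add_of_le hp
    have c1 : z ^ k ≤ G ^ k := pow_le_pow_left₀ hz hzG k
    have c2 : 1 ≤ G ^ k := one_le_pow₀ hG
    calc 27 / 100 * z ^ (2 + k + 1) + 18 / 5 = 27 / 100 * z ^ 3 * z ^ k + 18 / 5 * 1 := by ring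
      _ ≤ 27 / 100 * z ^ 3 * G ^ k + 18 / 5 * G ^ k := by gcongr
      _ = (18 / 5 + 27 / 100 * z ^ 3) * G ^ k := by ring
      _ ≤ G ^ 2 * G ^ k := by gcongr
      _ = _ := by ring
  calc h ^ 4 * mnorm (defect (U * (1 + sMat p (defect U)) * (1 + cMat p W)))
      ≤ h ^ 4 * (1 / 4 * (w ^ 2) ^ (p / 2 + 1) / (1 - w ^ 2)
        + (1 + 13 / 10 * w) ^ 2 * (2 * E ^ (p + 1) / (1 - E))) :=
        mul_le_mul_of_nonneg_left h1 (by positivity)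
    _ ≤ 27 / 100 * (z * ε) ^ (p + 1) + 18 / 5 * ε ^ (p + 1) := by rw [mul_add]; linarith
    _ = (27 / 100 * z ^ (p + 1) + 18 / 5) * ε ^ (p + 1) := by ring
    _ ≤ G ^ p * ε ^ (p + 1) := by gcongr
    _ = _ := by ring

lemma displacement_le {a b : ℕ} (U : Matrix (Fin a) (Fin b) ℂ) {W : Matrix (Fin b) (Fin b) ℂ}
    {ε : ℝ} (hε : ε ≤ 1 / 10) (hU : mnorm (defect U) ≤ ε)
    (hW : mnorm (cMat p W) ≤ 13 * ε) :
    mnorm (U * (1 + sMat p (defect U)) * (1 + cMat p W) - U) ≤ mnorm U * (30 * ε) := by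
  have hε0 : 0 ≤ ε := (mnorm_nonneg _).trans hU
  have h1 := mnorm_sMat_le p hU (by linarith)
  refine (mnorm_step_sub_le U h1 hW).trans
    (mul_le_mul_of_nonneg_left ?_ (mnorm_nonneg _))
  nlinarith [mul_nonneg hε0 hε0, mul_nonneg (mul_nonneg hε0 hε0) hε0]

/-- A step of order at least two, for states whose errors are scaled with the powers of
`h = (κ K)^{1/3}`. -/
lemma HighOrderConstants.contracts {c₁ c₂ s G h : ℝ} (hp : 2 ≤ p)
    (hc : HighOrderConstants ε₀ R₀ gX gY μ η r x c₁ c₂ s G) (hC : Conditioned c σ κ K)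
    (hS : SolvableWith c (rectDiagonal l σ) (gX * κ) (gY * κ)) (hh : 1 ≤ h)
    (hh3 : h ^ 3 = κ * K) (hμ : gX + gY ≤ μ * h) (hη : 1 ≤ η * h ^ 4) :
    Contracts m n l p c σ (h ^ 4) (κ * h) ε₀ R₀ G s := by
  intro M ε R T hε hR hN
  have hκ1 := hC.one_le_kappa
  have hκ0 : 0 < κ := by linarith
  have hh0 : 0 < h := by linarith
  have hω0 : 0 < κ * h := mul_pos hκ0 hh0
  have hH : 1 ≤ h ^ 4 := one_le_pow₀ hh
  have hωK : κ * h * K ≤ h ^ 4 := le_of_eq (by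
    calc κ * h * K = κ * K * h := by ring
      _ = h ^ 4 := by rw [← hh3]; ring)
  have hε0 : 0 ≤ ε := hN.eps_nonneg (by positivity)
  have hR₀ : 0 ≤ R₀ := (hN.R_nonneg hω0.le).trans hR
  have hε₀ : 0 ≤ ε₀ := hε0.trans hε
  have hr := hc.one_le_r hR₀
  have hx := hc.one_le_x hR₀ hε₀
  have hgX := hc.gX_nonneg
  have hgY := hc.gY_nonneg
  have hc₁ := hc.c₁_nonneg
  have hc₂ := hc.c₂_nonneg
  have hc₂ε : c₂ * ε ≤ c₂ * ε₀ := mul_le_mul_of_nonneg_left hε hc₂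
  have hlt : 0 < 1 - c₂ * ε₀ := by linarith [hc.c₂_lt]
  have hxs : x ≤ s := by
    refine le_trans ?_ hc.le_s
    have : 0 ≤ c₁ * ε₀ * x / (1 - c₂ * ε₀) := by positivity
    linarith
  have hs0 : 0 ≤ s := by linarith
  obtain ⟨hρ, hb⟩ := hc.solution_le hS hκ0 hμ hN hR
  obtain ⟨T', hT', huniq⟩ := exists_unique_isStep (p := p) (by omega) M T hS hN.diag hρ
  obtain ⟨D, S, X, Y, hch, hTeq⟩ := (isStep_iff (by omega)).1 hT'
  refine ⟨T', hT', huniq, ?_⟩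
  set Sig := T.2.2 with hSig
  set B := stepB p M T with hB
  set u := gX * κ * r with hu
  set v := gY * κ * r with hv
  have hu0 : 0 ≤ u := by positivity
  have hv0 : 0 ≤ v := by positivity
  set d : ℕ → ℝ := fun k => mnorm (remainder p B Sig S X Y k) with hd
  have hd0 : ∀ k, 0 ≤ d k := fun k => mnorm_nonneg _
  have hde : d 0 = mnorm (B - Sig) := by rw [hd]; simp only [remainder_zero]
  have hx0 : κ * h * d 0 ≤ x * ε := by
    rw [hde]
    exact hc.mnorm_stepB_sub_le hC hN hω0.le hH hωK hη hε hR
  have hωd : 0 ≤ κ * h * d 0 := mul_nonneg hω0.le (hd0 0)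
  -- the total correction is small enough for the power series estimates
  set z := 3 / 2 * r * s with hz
  have hz0 : 0 ≤ z := by positivity
  have hzε : z * ε ≤ 1 / 5 :=
    (mul_le_mul_of_nonneg_left hε hz0).trans hc.sum_le
  have hguz : ∀ {g t : ℝ}, 0 ≤ g → g ≤ 3 / 2 → κ * h * t ≤ s * ε → h * (g * κ * r * t) ≤ z * ε := by
    intro g t hg hg' ht
    calc h * (g * κ * r * t) = g * r * (κ * h * t) := by ring
      _ ≤ g * r * (s * ε) := mul_le_mul_of_nonneg_left ht (by positivity)
      _ ≤ 3 / 2 * r * (s * ε) := by gcongr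
      _ = z * ε := by rw [hz]; ring
  have hgu5 : ∀ {g t : ℝ}, 0 ≤ g → g ≤ 3 / 2 → 0 ≤ t → κ * h * t ≤ s * ε →
      g * κ * r * t ≤ 1 / 5 := by
    intro g t hg hg' ht0 ht
    have h1 : 0 ≤ g * κ * r * t := by positivity
    exact ((le_mul_of_one_le_left h1 hh).trans (hguz hg hg' ht)).trans hzε
  have hk : mnorm B ≤ K + mnorm (Sig - rectDiagonal l σ) + d 0 := by
    have h1 := mnorm_add_le_of_le (mnorm_add_le_of_le (mnorm_rectDiagonal_le (l := l) hC)
      (le_refl (mnorm (Sig - rectDiagonal l σ)))) (le_refl (mnorm (B - Sig)))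
    rw [add_sub_cancel, add_sub_cancel] at h1
    rwa [hde]
  have htheta : ∀ {S' t' T₁ : ℝ}, 0 ≤ S' → 0 ≤ T₁ → 0 ≤ t' → ∀ s', 0 ≤ s' →
      κ * h * S' ≤ s' * ε → κ * h * T₁ ≤ t' * ε → _ :=
    fun {S' t' T₁} hS' hT₁ ht' s' hs' hSs hTt =>
      theta_le (C := gX ^ 2 * gY ^ 2 + 41 / 50 * (gX ^ 4 + gY ^ 4)) (K := K) hκ1 hh hh3
        rfl hu0 hv0 hgX hgY (by linarith) le_rfl le_rfl hμ le_rfl (hd0 0) hS' hT₁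
        (mnorm_nonneg (Sig - rectDiagonal l σ)) (mnorm_nonneg B) hε0 hε hx0 hSs hTt
        (hN.dist.trans hR) hk (by linarith) hs' ht'
  have hωs : ∀ {t : ℝ}, t ≤ s * ε / (κ * h) → κ * h * t ≤ s * ε := fun {t} ht => by
    rw [le_div_iff₀ hω0] at ht
    linarith
  -- the remainders decay geometrically as long as their sum stays below `s ε / (κ h)`
  have hdec := decay_of_contraction (d := d) hd0 (p := p) (t₁ := c₁ * ε) (t := c₂ * ε)
    (s := s * ε / (κ * h)) (by positivity) (by linarith [hc.c₂_lt]) (by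
      rw [le_div_iff₀ hω0]
      calc (d 0 + c₁ * ε * d 0 / (1 - c₂ * ε)) * (κ * h)
          = κ * h * d 0 + c₁ * ε * (κ * h * d 0) / (1 - c₂ * ε) := by ring
        _ ≤ x * ε + c₁ * ε₀ * (x * ε) / (1 - c₂ * ε₀) := by gcongr
        _ = (x + c₁ * ε₀ * x / (1 - c₂ * ε₀)) * ε := by ring
        _ ≤ s * ε := mul_le_mul_of_nonneg_right hc.le_s hε0)
    (fun _ => by
      have h0s : κ * h * d 0 ≤ s * ε := hx0.trans (mul_le_mul_of_nonneg_right hxs hε0)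
      have h1 := hch.mnorm_remainder_succ_le hp hu0 hv0 hb le_rfl (k := 0) (by omega)
        (t := d 0) (by rw [zero_add, Finset.sum_range_one]) (hgu5 hgX hc.gX_le (hd0 0) h0s)
        (hgu5 hgY hc.gY_le (hd0 0) h0s)
      rw [Finset.sum_range_zero, ← hde] at h1
      have h2 := htheta (S' := 0) (t' := x) (T₁ := d 0) le_rfl (hd0 0) (by linarith) 0 le_rfl
        (by simp) hx0
      calc d 1 ≤ _ := h1
        _ ≤ d 0 * (thetaCoeff r μ R₀ _ x ε₀ 0 x * ε) := mul_le_mul_of_nonneg_left h2 (hd0 0)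
        _ ≤ d 0 * (c₁ * ε) :=
            mul_le_mul_of_nonneg_left (mul_le_mul_of_nonneg_right hc.le_c₁ hε0) (hd0 0)
        _ = _ := mul_comm _ _)
    (by positivity)
    (fun k _ hkp hsum => by
      set t := s * ε / (κ * h) with ht
      have ht0 : 0 ≤ t := by positivity
      have hts : κ * h * t ≤ s * ε := hωs le_rfl
      have h1 := hch.mnorm_remainder_succ_le hp hu0 hv0 hb le_rfl hkp hsum
        (hgu5 hgX hc.gX_le ht0 hts) (hgu5 hgY hc.gY_le ht0 hts)
      rw [← hde] at h1
      have hS0 : 0 ≤ ∑ j ∈ Finset.range k, d j := Finset.sum_nonneg fun _ _ => hd0 _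
      have hSle : κ * h * ∑ j ∈ Finset.range k, d j ≤ s * ε := by
        refine hωs (le_trans ?_ hsum)
        rw [Finset.sum_range_succ]
        linarith [hd0 k]
      have h2 := htheta (t' := s) (T₁ := t) hS0 ht0 hs0 s hs0 hSle hts
      calc d (k + 1) ≤ _ := h1
        _ ≤ d k * (thetaCoeff r μ R₀ _ x ε₀ s s * ε) := mul_le_mul_of_nonneg_left h2 (hd0 k)
        _ ≤ d k * (c₂ * ε) :=
            mul_le_mul_of_nonneg_left (mul_le_mul_of_nonneg_right hc.le_c₂ hε0) (hd0 k)
        _ = _ := mul_comm _ _)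
  obtain ⟨k, rfl⟩ := Nat.exists_eq_add_of_le' hp
  obtain ⟨hlast, hsum⟩ := hdec (k + 1) (by omega)
  have hsum' := hωs hsum
  set N := ∑ j ∈ Finset.range (k + 2), d j with hNdef
  obtain ⟨hX, hY, -⟩ := hch.sum_XY_bounds hb (k := k + 2) le_rfl
  obtain ⟨hSd, hSb⟩ := hch.sum_S_bounds (k := k + 2) le_rfl
  obtain ⟨hXs, hYs⟩ := hch.skew (k := k + 2) le_rfl
  have hG0 : 0 ≤ G := by linarith [hc.G_one]
  have hXz : h * mnorm (∑ j ∈ Finset.Icc 1 (k + 2), X j) ≤ z * ε :=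
    (mul_le_mul_of_nonneg_left hX hh0.le).trans (hguz hgX hc.gX_le hsum')
  have hYz : h * mnorm (∑ j ∈ Finset.Icc 1 (k + 2), Y j) ≤ z * ε :=
    (mul_le_mul_of_nonneg_left hY hh0.le).trans (hguz hgY hc.gY_le hsum')
  have hcz : ∀ {a : ℕ} {W : Matrix (Fin a) (Fin a) ℂ}, h * mnorm W ≤ z * ε →
      mnorm (cMat (k + 2) W) ≤ 13 * ε := fun {a W} hW => by
    have h1 : mnorm W ≤ z * ε := (le_mul_of_one_le_left (mnorm_nonneg W) hh).trans hW
    have h2 : z * ε ≤ 10 * ε := mul_le_mul_of_nonneg_right hc.z_le hε0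
    linarith [mnorm_cMat_le (p := k + 2) (by omega) h1 hzε]
  have hε10 : ε ≤ 1 / 10 := hε.trans hc.ε₀_le
  have hSω : κ * h * mnorm (∑ j ∈ Finset.Icc 1 (k + 2), S j) ≤ s * ε :=
    (mul_le_mul_of_nonneg_left hSb hω0.le).trans hsum'
  have hdist : Sig + ∑ j ∈ Finset.Icc 1 (k + 2), S j - rectDiagonal l σ
      = (Sig - rectDiagonal l σ) + ∑ j ∈ Finset.Icc 1 (k + 2), S j := by abel
  rw [hTeq]
  refine ⟨⟨?_, ?_, ?_, ?_, ?_⟩, ?_, ?_, ?_⟩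
  · exact scaled_defect_step_le hp T.1 hXs hh hε10 hN.defect_U hz0 hXz hzε hc.G_one hc.z_le_G
      hc.defect_le
  · exact scaled_defect_step_le hp T.2.1 hYs hh hε10 hN.defect_V hz0 hYz hzε hc.G_one hc.z_le_G
      hc.defect_le
  · have e1 : remainder (k + 2) B Sig S X Y (k + 2)
        = (T.1 * (1 + sMat (k + 2) (defect T.1)) *
            (1 + cMat (k + 2) (∑ j ∈ Finset.Icc 1 (k + 2), X j)))ᴴ * M *
          (T.2.1 * (1 + sMat (k + 2) (defect T.2.1)) *
            (1 + cMat (k + 2) (∑ j ∈ Finset.Icc 1 (k + 2), Y j)))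
          - (Sig + ∑ j ∈ Finset.Icc 1 (k + 2), S j) := by
      rw [remainder_step, remainder]; abel
    rw [← e1]
    calc κ * h * d (k + 2) ≤ κ * h * (c₁ * ε * (c₂ * ε) ^ (k + 1) * d 0) :=
          mul_le_mul_of_nonneg_left hlast hω0.le
      _ = c₁ * ε * (c₂ * ε) ^ (k + 1) * (κ * h * d 0) := by ring
      _ ≤ c₁ * ε * (c₂ * ε) ^ (k + 1) * (x * ε) := by gcongr
      _ = x * c₁ * c₂ * c₂ ^ k * ε ^ (k + 2) * ε := by ring
      _ ≤ G ^ 2 * G ^ k * ε ^ (k + 2) * ε := by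
          have := hc.prod_le
          have := hc.c₂_le
          gcongr
      _ = (G * ε) ^ (k + 2) * ε := by ring
  · rw [hdist, blockDiag_add, hN.diag, hSd]
  · rw [hdist]
    have := mnorm_add_le (Sig - rectDiagonal l σ) (∑ j ∈ Finset.Icc 1 (k + 2), S j)
    calc _ ≤ κ * h * (mnorm (Sig - rectDiagonal l σ) + mnorm (∑ j ∈ Finset.Icc 1 (k + 2), S j)) :=
          mul_le_mul_of_nonneg_left this hω0.le
      _ ≤ R + s * ε := by rw [mul_add]; exact add_le_add hN.dist hSω
  · exact displacement_le T.1 hε10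
      ((le_mul_of_one_le_left (mnorm_nonneg _) hH).trans hN.defect_U) (hcz hXz)
  · exact displacement_le T.2.1 hε10
      ((le_mul_of_one_le_left (mnorm_nonneg _) hH).trans hN.defect_V) (hcz hYz)
  · rw [add_sub_cancel_left]
    exact hSω

end StepBounds

/-! ### Contraction for order one -/

/-- Numerical conditions under which the step of order one contracts with constant `G`. -/
structure FirstOrderConstants (ε₀ R₀ gX gY μ η r x G : ℝ) : Prop
    extends StepConstants ε₀ R₀ gX gY μ η r x where
  sum_le : 3 / 2 * r * x * ε₀ ≤ 13 / 50
  z_le : 3 / 2 * r * x ≤ 13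
  residual_le : r * μ * x ^ 2 + gX * gY * r ^ 2 * (1 + η * (R₀ + x * ε₀)) * x ^ 2 ≤ G
  defect_X_le : (gX * r * x) ^ 2 + 18 / 5 ≤ G
  defect_Y_le : (gY * r * x) ^ 2 + 18 / 5 ≤ G

section FirstOrder

variable {m n l q : ℕ} {c : Composition q} {σ : Fin q → ℝ} {κ K : ℝ}
  {ε₀ R₀ gX gY μ η r x : ℝ}

/-- The defect after a step of order one. -/
lemma scaled_defect_step_one_le {a b : ℕ} (U : Matrix (Fin a) (Fin b) ℂ)
    {W : Matrix (Fin b) (Fin b) ℂ} (hW : Wᴴ = -W) {h ε z G : ℝ} (hh : 1 ≤ h) (hε : ε ≤ 1 / 10)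
    (hU : h ^ 2 * mnorm (defect U) ≤ ε) (hWz : h * mnorm W ≤ z * ε)
    (hzε : z * ε ≤ 13 / 50) (hG : z ^ 2 + 18 / 5 ≤ G) :
    h ^ 2 * mnorm (defect (U * (1 + sMat 1 (defect U)) * (1 + cMat 1 W))) ≤ (G * ε) ^ 1 * ε := by
  have hh0 : 0 < h := by linarith
  have hε0 : 0 ≤ ε := le_trans (mul_nonneg (by positivity) (mnorm_nonneg _)) hU
  have hw0 := mnorm_nonneg W
  have hres : mnorm ((1 + cMat 1 (-W)) * (1 + cMat 1 W) - 1) ≤ mnorm W ^ 2 := by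
    have e : (1 + cMat 1 (-W)) * (1 + cMat 1 W) - 1 = -(W * W) := by
      rw [cMat_one, cMat_one]; noncomm_ring
    rw [e, mnorm_neg, sq]
    exact mnorm_mul_le W W
  have hcm : mnorm (cMat 1 W) ≤ mnorm W := by rw [cMat_one]
  set w := mnorm W with hw
  have hwz : w ≤ z * ε := (le_mul_of_one_le_left hw0 hh).trans hWz
  have hE0 := mnorm_nonneg (defect U)
  set E := mnorm (defect U) with hE
  have hEε : E ≤ ε := le_trans (le_mul_of_one_le_left hE0 (one_le_pow₀ hh)) hU
  have h1 := mnorm_defect_step_le (p := 1) U hW (le_refl E) (by linarith) hcm hres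
  have h2 : h ^ 2 * w ^ 2 ≤ (z * ε) ^ 2 := by
    rw [← mul_pow]; exact pow_le_pow_left₀ (by positivity) hWz 2
  have h3 : h ^ 2 * ((1 + w) ^ 2 * (2 * E ^ (1 + 1) / (1 - E))) ≤ 18 / 5 * ε ^ 2 := by
    have b1 : (1 + w) ^ 2 ≤ (63 / 50) ^ 2 := pow_le_pow_left₀ (by positivity) (by linarith) 2
    have b2 : 1 / (1 - E) ≤ 10 / 9 := by
      rw [div_le_div_iff₀ (by linarith) (by norm_num)]; linarith
    have b3 : h ^ 2 * E * E ≤ ε * ε := by gcongr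
    calc h ^ 2 * ((1 + w) ^ 2 * (2 * E ^ (1 + 1) / (1 - E)))
        = 2 * (1 + w) ^ 2 * (1 / (1 - E)) * (h ^ 2 * E * E) := by ring
      _ ≤ 2 * (63 / 50) ^ 2 * (10 / 9) * (ε * ε) := by
          have : 0 ≤ 1 / (1 - E) := one_div_nonneg.2 (by linarith)
          gcongr
      _ ≤ 18 / 5 * ε ^ 2 := by nlinarith [mul_nonneg hε0 hε0]
  calc h ^ 2 * mnorm (defect (U * (1 + sMat 1 (defect U)) * (1 + cMat 1 W)))
      ≤ h ^ 2 * (w ^ 2 + (1 + w) ^ 2 * (2 * E ^ (1 + 1) / (1 - E))) :=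
        mul_le_mul_of_nonneg_left h1 (by positivity)
    _ ≤ (z * ε) ^ 2 + 18 / 5 * ε ^ 2 := by rw [mul_add]; exact add_le_add h2 h3
    _ = (z ^ 2 + 18 / 5) * ε ^ 2 := by ring
    _ ≤ G * ε ^ 2 := by gcongr
    _ = _ := by ring

/-- A step of order one, for states whose errors are scaled with the powers of `h = κ K`. -/
lemma FirstOrderConstants.contracts {G h : ℝ} (hc : FirstOrderConstants ε₀ R₀ gX gY μ η r x G)
    (hC : Conditioned c σ κ K) (hS : SolvableWith c (rectDiagonal l σ) (gX * κ) (gY * κ))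
    (hh1 : h = κ * K) (hμ : gX + gY ≤ μ * h) (hη : 1 ≤ η * h ^ 2) :
    Contracts m n l 1 c σ (h ^ 2) (κ * h) ε₀ R₀ G x := by
  intro M ε R T hε hR hN
  have hκ1 := hC.one_le_kappa
  have hκ0 : 0 < κ := by linarith
  have hh : 1 ≤ h := by rw [hh1]; exact one_le_mul_of_one_le_of_one_le hκ1 hC.one_le_K
  have hh0 : 0 < h := by linarith
  have hω0 : 0 < κ * h := mul_pos hκ0 hh0
  have hH : 1 ≤ h ^ 2 := one_le_pow₀ hh
  have hωK : κ * h * K ≤ h ^ 2 := le_of_eq (by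
    calc κ * h * K = κ * K * h := by ring
      _ = h ^ 2 := by rw [← hh1]; ring)
  have hε0 : 0 ≤ ε := hN.eps_nonneg (by positivity)
  have hR0 : 0 ≤ R := hN.R_nonneg hω0.le
  have hR₀ : 0 ≤ R₀ := hR0.trans hR
  have hε₀ : 0 ≤ ε₀ := hε0.trans hε
  have hr := hc.one_le_r hR₀
  have hx := hc.one_le_x hR₀ hε₀
  have hgX := hc.gX_nonneg
  have hgY := hc.gY_nonneg
  have hη0 := hc.η_nonneg
  obtain ⟨hρ, hb⟩ := hc.solution_le hS hκ0 hμ hN hR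
  obtain ⟨T', hT', huniq⟩ := exists_unique_isStep (p := 1) le_rfl M T hS hN.diag hρ
  obtain ⟨D, S, X, Y, hch, hTeq⟩ := (isStep_iff le_rfl).1 hT'
  refine ⟨T', hT', huniq, ?_⟩
  have hx0 : κ * h * mnorm (stepB 1 M T - T.2.2) ≤ x * ε :=
    hc.mnorm_stepB_sub_le hC hN hω0.le hH hωK hη hε hR
  have hs := hch.solves' (k := 0) one_pos
  rw [remainder_zero, zero_add] at hs
  have heq := hs.eq'
  simp only [Finset.Icc_self, Finset.sum_singleton] at hTeq
  set Sig := T.2.2 with hSig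
  set B := stepB 1 M T with hB
  obtain ⟨hX, hY⟩ := hb hs.normalized (t := mnorm (B - Sig)) (by
    rw [heq, hs.S_eq]; exact mnorm_sub_blockDiag_le _)
  have hd0 := mnorm_nonneg (B - Sig)
  have hkB : mnorm B ≤ K + mnorm (Sig - rectDiagonal l σ) + mnorm (B - Sig) := by
    have h1 := mnorm_add_le_of_le (mnorm_add_le_of_le (mnorm_rectDiagonal_le (l := l) hC)
      (le_refl (mnorm (Sig - rectDiagonal l σ)))) (le_refl (mnorm (B - Sig)))
    rwa [add_sub_cancel, add_sub_cancel] at h1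
  have hSd : mnorm (S 1) ≤ mnorm (B - Sig) := by rw [hs.S_eq]; exact mnorm_blockDiag_le _
  set d := mnorm (B - Sig) with hd
  have hXz : h * mnorm (X 1) ≤ gX * r * x * ε := by
    calc h * mnorm (X 1) ≤ h * (gX * κ * r * d) := mul_le_mul_of_nonneg_left hX hh0.le
      _ = gX * r * (κ * h * d) := by ring
      _ ≤ gX * r * (x * ε) := mul_le_mul_of_nonneg_left hx0 (by positivity)
      _ = _ := by ring
  have hYz : h * mnorm (Y 1) ≤ gY * r * x * ε := by
    calc h * mnorm (Y 1) ≤ h * (gY * κ * r * d) := mul_le_mul_of_nonneg_left hY hh0.le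
      _ = gY * r * (κ * h * d) := by ring
      _ ≤ gY * r * (x * ε) := mul_le_mul_of_nonneg_left hx0 (by positivity)
      _ = _ := by ring
  have hgz : ∀ {g : ℝ}, 0 ≤ g → g ≤ 3 / 2 → g * r * x * ε ≤ 13 / 50 := by
    intro g hg hg'
    calc g * r * x * ε ≤ 3 / 2 * r * x * ε₀ := by gcongr
      _ ≤ 13 / 50 := hc.sum_le
  have hcz : ∀ {g : ℝ} {a : ℕ} {W : Matrix (Fin a) (Fin a) ℂ}, g ≤ 3 / 2 →
      h * mnorm W ≤ g * r * x * ε → mnorm (cMat 1 W) ≤ 13 * ε := by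
    intro g a W hg' hW
    rw [cMat_one]
    calc mnorm W ≤ h * mnorm W := le_mul_of_one_le_left (mnorm_nonneg W) hh
      _ ≤ g * r * x * ε := hW
      _ ≤ 3 / 2 * r * x * ε := by gcongr
      _ ≤ 13 * ε := mul_le_mul_of_nonneg_right hc.z_le hε0
  have hε10 : ε ≤ 1 / 10 := hε.trans hc.ε₀_le
  have hSω : κ * h * mnorm (S 1) ≤ x * ε := (mul_le_mul_of_nonneg_left hSd hω0.le).trans hx0
  have hdist : Sig + S 1 - rectDiagonal l σ = (Sig - rectDiagonal l σ) + S 1 := by abel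
  rw [hTeq]
  refine ⟨⟨?_, ?_, ?_, ?_, ?_⟩, ?_, ?_, ?_⟩
  · exact scaled_defect_step_one_le T.1 hs.X_skew hh hε10 hN.defect_U hXz (hgz hgX hc.gX_le)
      hc.defect_X_le
  · exact scaled_defect_step_one_le T.2.1 hs.Y_skew hh hε10 hN.defect_V hYz (hgz hgY hc.gY_le)
      hc.defect_Y_le
  · -- the linear terms of the remainder cancel by the equation for `X` and `Y`
    have e1 : (T.1 * (1 + sMat 1 (defect T.1)) * (1 + cMat 1 (X 1)))ᴴ * M *
          (T.2.1 * (1 + sMat 1 (defect T.2.1)) * (1 + cMat 1 (Y 1))) - (Sig + S 1)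
        = ((B - Sig) * Y 1 - X 1 * (B - Sig)) - X 1 * B * Y 1 := by
      have h1 : Sig + S 1 = B - (X 1 * Sig - Sig * Y 1) := by rw [heq]; abel
      rw [remainder_step, cMat_one, cMat_one, hs.X_skew, h1]
      simp only [Matrix.add_mul, Matrix.mul_add, Matrix.sub_mul, Matrix.mul_sub, Matrix.one_mul,
        Matrix.mul_one, Matrix.neg_mul]
      abel
    have h1 : mnorm (((B - Sig) * Y 1 - X 1 * (B - Sig)) - X 1 * B * Y 1)
        ≤ (d * (gY * κ * r * d) + gX * κ * r * d * d)
          + gX * κ * r * d * (K + mnorm (Sig - rectDiagonal l σ) + d) * (gY * κ * r * d) :=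
      mnorm_sub_le_of_le (mnorm_sub_le_of_le (mnorm_mul_le_of_le le_rfl hY)
        (mnorm_mul_le_of_le hX le_rfl)) (mnorm_mul_le_of_le (mnorm_mul_le_of_le hX hkB) hY)
    have hρ0 := mnorm_nonneg (Sig - rectDiagonal l σ)
    have hρω := hN.dist.trans hR
    rw [← hSig] at hρω
    set ρ := mnorm (Sig - rectDiagonal l σ) with hρdef
    have h2 : κ * (K + ρ + d) ≤ h * (1 + η * (R₀ + x * ε₀)) := by
      have a1 : κ * h * ρ + κ * h * d ≤ R₀ + x * ε₀ := by
        have : x * ε ≤ x * ε₀ := by gcongr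
        linarith
      have a2 : κ * ρ + κ * d ≤ h * (η * (R₀ + x * ε₀)) := by
        calc κ * ρ + κ * d = 1 * (κ * ρ + κ * d) := (one_mul _).symm
          _ ≤ η * h ^ 2 * (κ * ρ + κ * d) := mul_le_mul_of_nonneg_right hη (by positivity)
          _ = η * h * (κ * h * ρ + κ * h * d) := by ring
          _ ≤ η * h * (R₀ + x * ε₀) := mul_le_mul_of_nonneg_left a1 (by positivity)
          _ = _ := by ring
      rw [hh1] at a2 ⊢
      linarith
    rw [e1]
    calc κ * h * mnorm (((B - Sig) * Y 1 - X 1 * (B - Sig)) - X 1 * B * Y 1)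
        ≤ κ * h * ((d * (gY * κ * r * d) + gX * κ * r * d * d)
          + gX * κ * r * d * (K + ρ + d) * (gY * κ * r * d)) :=
          mul_le_mul_of_nonneg_left h1 hω0.le
      _ = κ * h * d ^ 2 * κ * r * (gX + gY)
          + gX * gY * r ^ 2 * κ ^ 2 * h * d ^ 2 * (κ * (K + ρ + d)) := by ring
      _ ≤ κ * h * d ^ 2 * κ * r * (μ * h)
          + gX * gY * r ^ 2 * κ ^ 2 * h * d ^ 2 * (h * (1 + η * (R₀ + x * ε₀))) := by gcongr
      _ = (r * μ + gX * gY * r ^ 2 * (1 + η * (R₀ + x * ε₀))) * (κ * h * d) ^ 2 := by ring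
      _ ≤ (r * μ + gX * gY * r ^ 2 * (1 + η * (R₀ + x * ε₀))) * (x * ε) ^ 2 := by
          have := hc.μ_nonneg
          gcongr
      _ = (r * μ * x ^ 2 + gX * gY * r ^ 2 * (1 + η * (R₀ + x * ε₀)) * x ^ 2) * ε ^ 2 := by ring
      _ ≤ G * ε ^ 2 := mul_le_mul_of_nonneg_right hc.residual_le (by positivity)
      _ = _ := by ring
  · rw [hdist, blockDiag_add, hN.diag, hs.S_eq, blockDiag_blockDiag]
  · rw [hdist]
    have := mnorm_add_le (Sig - rectDiagonal l σ) (S 1)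
    calc _ ≤ κ * h * (mnorm (Sig - rectDiagonal l σ) + mnorm (S 1)) :=
          mul_le_mul_of_nonneg_left this hω0.le
      _ ≤ R + x * ε := by rw [mul_add]; exact add_le_add hN.dist hSω
  · exact displacement_le T.1 hε10
      ((le_mul_of_one_le_left (mnorm_nonneg _) hH).trans hN.defect_U) (hcz hc.gX_le hXz)
  · exact displacement_le T.2.1 hε10
      ((le_mul_of_one_le_left (mnorm_nonneg _) hH).trans hN.defect_V) (hcz hc.gY_le hYz)
  · rw [add_sub_cancel_left]
    exact hSω

end FirstOrder

/-! ### The numerical constants -/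

section Constants

variable {m n l q : ℕ} {c : Composition q} {p : ℕ} {σ : Fin q → ℝ} {κ K : ℝ}

/-- The first step and the later steps contract, with constants that suffice for the convergence
from `u₀ = 0.046` on, for the orders at least two. In each case `μ` and `η` are upper bounds for
`(gX + gY) / h` and for the inverse of the weight of the defects, and `r`, `x`, `c₁`, `c₂`, `s` are
their bounds in `HighOrderConstants` at `ε₀`, `R₀`, rounded up. -/
lemma Conditioned.contracts_of_two_le (hp : 2 ≤ p) (hql : q ≤ l) (hC : Conditioned c σ κ K) {h : ℝ}
    (hh : 1 ≤ h) (hh3 : h ^ 3 = κ * K) : ∃ s₀ s₁ : ℝ, 0 ≤ s₁ ∧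
      Contracts m n l p c σ (h ^ 4) (κ * h) 0.046 0 9.9 s₀ ∧
      Contracts m n l p c σ (h ^ 4) (κ * h) (0.83 * 0.046 / 4) 0.175 13.09 s₁ ∧
      s₀ * 0.046 + 2 * s₁ * (0.83 * 0.046 / 4) ≤ 0.175 := by
  rcases hC.solvableWith hql with ⟨hκ, hS⟩ | hS
  · rw [show κ = 1 * κ by ring, ← mul_assoc, mul_one] at hS
    -- `κ K ≥ 2` implies `h ≥ 1.2595`
    have hh' : 1.2595 ≤ h := by
      by_contra hneg
      push Not at hneg
      have : h ^ 3 < 1.2595 ^ 3 := pow_lt_pow_left₀ hneg (by linarith) (by norm_num)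
      norm_num at this
      linarith
    have hh4 : 2.519 ≤ h ^ 4 := by
      have : h ^ 4 = h * (κ * K) := by rw [← hh3]; ring
      rw [this]
      nlinarith
    have hc₀ : HighOrderConstants 0.046 0 (3 / 2) 1 1.985 0.397 1 2.042 4.721 9.8 2.855 9.9 := by
      refine ⟨⟨?_, ?_, ?_, ?_, ?_, ?_, ?_, ?_, ?_, ?_⟩, ?_, ?_, ?_, ?_, ?_, ?_, ?_, ?_, ?_, ?_, ?_,
        ?_, ?_⟩ <;> norm_num [thetaCoeff]
    have hc₁ : HighOrderConstants (0.83 * 0.046 / 4) 0.175 (3 / 2) 1 1.985 0.397 1.5323 2.079 6.62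
        10.6 2.23 13.09 := by
      refine ⟨⟨?_, ?_, ?_, ?_, ?_, ?_, ?_, ?_, ?_, ?_⟩, ?_, ?_, ?_, ?_, ?_, ?_, ?_, ?_, ?_, ?_, ?_,
        ?_, ?_⟩ <;> norm_num [thetaCoeff]
    exact ⟨2.855, 2.23, by norm_num,
      hc₀.contracts hp hC hS hh hh3 (by linarith) (by linarith),
      hc₁.contracts hp hC hS hh hh3 (by linarith) (by linarith), by norm_num⟩
  · rw [show SolvableWith c (rectDiagonal l σ) κ 0
      = SolvableWith c (rectDiagonal l σ) (1 * κ) (0 * κ) by rw [one_mul, zero_mul]] at hS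
    have hh4 : 1 ≤ h ^ 4 := one_le_pow₀ hh
    have hc₀ : HighOrderConstants 0.046 0 1 0 1 1 1 2.11 2.27 3.83 2.4 9.9 := by
      refine ⟨⟨?_, ?_, ?_, ?_, ?_, ?_, ?_, ?_, ?_, ?_⟩, ?_, ?_, ?_, ?_, ?_, ?_, ?_, ?_, ?_, ?_, ?_,
        ?_, ?_⟩ <;> norm_num [thetaCoeff]
    have hc₁ : HighOrderConstants (0.83 * 0.046 / 4) 0.175 1 0 1 1 1.2122 2.2 2.72 4.19 2.27
        13.09 := by
      refine ⟨⟨?_, ?_, ?_, ?_, ?_, ?_, ?_, ?_, ?_, ?_⟩, ?_, ?_, ?_, ?_, ?_, ?_, ?_, ?_, ?_, ?_, ?_,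
        ?_, ?_⟩ <;> norm_num [thetaCoeff]
    exact ⟨2.4, 2.27, by norm_num,
      hc₀.contracts hp hC hS hh hh3 (by linarith) (by linarith),
      hc₁.contracts hp hC hS hh hh3 (by linarith) (by linarith), by norm_num⟩

/-- The first step and the later steps contract, with constants that suffice for the convergence
from `u₀ = 0.0289` on, for the order one. -/
lemma Conditioned.contracts_one (hql : q ≤ l) (hC : Conditioned c σ κ K) {h : ℝ}
    (hh : h = κ * K) : ∃ s₀ s₁ : ℝ, 0 ≤ s₁ ∧
      Contracts m n l 1 c σ (h ^ 2) (κ * h) 0.0289 0 13.84 s₀ ∧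
      Contracts m n l 1 c σ (h ^ 2) (κ * h) (0.8 * 0.0289 / 2) 0.11 21.6 s₁ ∧
      s₀ * 0.0289 + 2 * s₁ * (0.8 * 0.0289 / 2) ≤ 0.11 := by
  rcases hC.solvableWith hql with ⟨hκ, hS⟩ | hS
  · rw [show κ = 1 * κ by ring, ← mul_assoc, mul_one] at hS
    have hh2 : 4 ≤ h ^ 2 := by rw [hh]; nlinarith
    have hc₀ : FirstOrderConstants 0.0289 0 (3 / 2) 1 1.25 0.25 1 2.04 13.84 := by
      refine ⟨⟨?_, ?_, ?_, ?_, ?_, ?_, ?_, ?_, ?_, ?_⟩, ?_, ?_, ?_, ?_, ?_⟩ <;> norm_num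
    have hc₁ : FirstOrderConstants (0.8 * 0.0289 / 2) 0.11 (3 / 2) 1 1.25 0.25 1.16 2.04 21.6 := by
      refine ⟨⟨?_, ?_, ?_, ?_, ?_, ?_, ?_, ?_, ?_, ?_⟩, ?_, ?_, ?_, ?_, ?_⟩ <;> norm_num
    exact ⟨2.04, 2.04, by norm_num,
      hc₀.contracts hC hS hh (by linarith) (by linarith),
      hc₁.contracts hC hS hh (by linarith) (by linarith), by norm_num⟩
  · rw [show SolvableWith c (rectDiagonal l σ) κ 0
      = SolvableWith c (rectDiagonal l σ) (1 * κ) (0 * κ) by rw [one_mul, zero_mul]] at hS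
    have hh1 : 1 ≤ h := by
      rw [hh]; exact one_le_mul_of_one_le_of_one_le hC.one_le_kappa hC.one_le_K
    have hh2 : 1 ≤ h ^ 2 := one_le_pow₀ hh1
    have hc₀ : FirstOrderConstants 0.0289 0 1 0 1 1 1 2.07 13.84 := by
      refine ⟨⟨?_, ?_, ?_, ?_, ?_, ?_, ?_, ?_, ?_, ?_⟩, ?_, ?_, ?_, ?_, ?_⟩ <;> norm_num
    have hc₁ : FirstOrderConstants (0.8 * 0.0289 / 2) 0.11 1 0 1 1 1.124 2.14 21.6 := by
      refine ⟨⟨?_, ?_, ?_, ?_, ?_, ?_, ?_, ?_, ?_, ?_⟩, ?_, ?_, ?_, ?_, ?_⟩ <;> norm_num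
    exact ⟨2.07, 2.14, by norm_num,
      hc₀.contracts hC hS hh (by linarith) (by linarith),
      hc₁.contracts hC hS hh (by linarith) (by linarith), by norm_num⟩

end Constants

/-! ### Sequences that converge of order `p + 1` -/

section Convergence

open Filter Topology

variable {m n l q : ℕ} {c : Composition q} {p : ℕ} {σ : Fin q → ℝ}

/-- A relation that is uniquely solvable along invariants `P i`, which it propagates, has exactly
one orbit from every starting point with the invariant `P 0`. -/
lemma exists_unique_orbit {α : Type*} {step : α → α → Prop} {P : ℕ → α → Prop}
    {Q : ℕ → α → α → Prop} {x₀ : α} (h0 : P 0 x₀)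
    (h : ∀ i x, P i x → ∃ y, step x y ∧ (∀ y', step x y' → y' = y) ∧ P (i + 1) y ∧ Q i x y) :
    ∃ T : ℕ → α, (T 0 = x₀ ∧ ∀ i, step (T i) (T (i + 1))) ∧
      (∀ T' : ℕ → α, (T' 0 = x₀ ∧ ∀ i, step (T' i) (T' (i + 1))) → T' = T) ∧
      ∀ i, P i (T i) ∧ Q i (T i) (T (i + 1)) := by
  choose f hstep huniq hP hQ using h
  let s : ∀ i, {x // P i x} :=
    fun i => Nat.rec ⟨x₀, h0⟩ (fun i x => ⟨f i x.1 x.2, hP i x.1 x.2⟩) i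
  refine ⟨fun i => (s i).1, ⟨rfl, fun i => hstep i _ (s i).2⟩, fun T' hT' => ?_,
    fun i => ⟨(s i).2, hQ i _ (s i).2⟩⟩
  funext i
  induction i with
  | zero => exact hT'.1
  | succ i ih =>
    refine huniq i _ (s i).2 _ ?_
    have := hT'.2 i
    rwa [ih] at this

/-- The sequence `2 ^ (-(p + 1) ^ i + 1)` that measures the convergence of order `p + 1`. -/
noncomputable def rate (p i : ℕ) : ℝ := 2 * (1 / 2) ^ (p + 1) ^ i

lemma rate_eq_zpow (p i : ℕ) : rate p i = (2 : ℝ) ^ (-((p + 1 : ℕ) : ℤ) ^ i + 1) := by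
  rw [rate, zpow_add₀ two_ne_zero, _root_.zpow_neg, zpow_one, ← Nat.cast_pow, zpow_natCast, one_div,
    inv_pow, mul_comm]

lemma rate_pos (p i : ℕ) : 0 < rate p i := by rw [rate]; positivity

lemma rate_zero (p : ℕ) : rate p 0 = 1 := by rw [rate, pow_zero]; norm_num

lemma rate_one (p : ℕ) : rate p 1 = (1 / 2) ^ p := by rw [rate, pow_one, pow_succ]; ring

lemma rate_succ (p i : ℕ) : rate p (i + 1) = (rate p i / 2) ^ p * rate p i := by
  have h : rate p i / 2 = (1 / 2) ^ (p + 1) ^ i := by rw [rate]; ring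
  rw [h, rate, rate, pow_succ (p + 1) i, pow_mul, pow_succ]
  ring

lemma rate_le_one (p i : ℕ) : rate p i ≤ 1 := by
  have h : ((1 : ℝ) / 2) ^ (p + 1) ^ i ≤ (1 / 2) ^ 1 :=
    pow_le_pow_of_le_one (by norm_num) (by norm_num) (Nat.one_le_pow _ _ (by omega))
  rw [rate]
  linarith

lemma rate_succ_le (hp : 1 ≤ p) (i : ℕ) : rate p (i + 1) ≤ rate p i / 2 := by
  have h0 := rate_pos p i
  have h1 := rate_le_one p i
  have h2 : (rate p i / 2) ^ p ≤ (rate p i / 2) ^ 1 :=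
    pow_le_pow_of_le_one (by positivity) (by linarith) hp
  rw [rate_succ]
  nlinarith

lemma rate_add_le (hp : 1 ≤ p) (i k : ℕ) : rate p (i + k) ≤ rate p i * (1 / 2) ^ k := by
  induction k with
  | zero => simp
  | succ k ih =>
    have := rate_succ_le hp (i + k)
    rw [← add_assoc, pow_succ]
    linarith

lemma rate_le_rate_one (hp : 1 ≤ p) (i : ℕ) : rate p (i + 1) ≤ rate p 1 := by
  have h := rate_add_le hp 1 i
  have h1 : ((1 : ℝ) / 2) ^ i ≤ 1 := pow_le_one₀ (by norm_num) (by norm_num)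
  rw [add_comm]
  nlinarith [rate_pos p 1]

lemma tendsto_rate (hp : 1 ≤ p) : Tendsto (rate p) atTop (𝓝 0) := by
  refine squeeze_zero (fun i => (rate_pos p i).le) (fun i => ?_)
    (tendsto_pow_atTop_nhds_zero_of_lt_one (r := (1 / 2 : ℝ)) (by norm_num) (by norm_num))
  have := rate_add_le hp 0 i
  rwa [zero_add, rate_zero, one_mul] at this

/-- Increments bounded by the rate of convergence imply convergence with this rate. -/
lemma exists_limit_of_increments {a b : ℕ} (hp : 1 ≤ p) {W : ℕ → Matrix (Fin a) (Fin b) ℂ} {C : ℝ}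
    (hW : ∀ i, mnorm (W (i + 1) - W i) ≤ C * rate p i) :
    ∃ L, Tendsto W atTop (𝓝 L) ∧ ∀ i, mnorm (W i - L) ≤ (a + b) * (2 * C) * rate p i := by
  have hC : 0 ≤ C := by
    have := (mnorm_nonneg _).trans (hW 0)
    rwa [rate_zero, mul_one] at this
  have hd : ∀ j k i t, dist (W (i + t) j k) (W (i + t + 1) j k)
      ≤ C * rate p i * (1 / 2) ^ t := fun j k i t => by
    have h1 := norm_entry_le_mnorm (W (i + t + 1) - W (i + t)) j k
    rw [Matrix.sub_apply] at h1
    rw [dist_comm, dist_eq_norm]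
    calc _ ≤ C * rate p (i + t) := h1.trans (hW _)
      _ ≤ C * (rate p i * (1 / 2) ^ t) := mul_le_mul_of_nonneg_left (rate_add_le hp i t) hC
      _ = _ := by ring
  have hL : ∀ j k, ∃ z, Tendsto (fun i => W i j k) atTop (𝓝 z) := fun j k =>
    cauchySeq_tendsto_of_complete (cauchySeq_of_le_geometric (1 / 2) (C * rate p 0) (by norm_num)
      (fun t => by have := hd j k 0 t; rwa [zero_add] at this))
  choose L hL using hL
  refine ⟨Matrix.of L, tendsto_pi_nhds.2 fun j => tendsto_pi_nhds.2 fun k => hL j k, fun i => ?_⟩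
  refine (mnorm_le_of_norm_entry_le (C := 2 * C * rate p i)
    (by have := rate_pos p i; positivity) fun j k => ?_).trans (le_of_eq (by ring))
  have h1 := dist_le_of_le_geometric_of_tendsto₀ (1 / 2) (C * rate p i) (by norm_num) (hd j k i)
    ((hL j k).comp (tendsto_add_atTop_nat i) |>.congr fun t => by
      simp only [Function.comp_apply]; rw [add_comm])
  rw [dist_eq_norm] at h1
  refine h1.trans (le_of_eq ?_)
  norm_num
  ring

lemma eq_zero_of_tendsto {a b : ℕ} (hp : 1 ≤ p) {W : ℕ → Matrix (Fin a) (Fin b) ℂ}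
    {L : Matrix (Fin a) (Fin b) ℂ} (hL : Tendsto W atTop (𝓝 L)) {C : ℝ}
    (hW : ∀ i, mnorm (W i) ≤ C * rate p i) : L = 0 := by
  ext j k
  refine tendsto_nhds_unique (tendsto_pi_nhds.1 (tendsto_pi_nhds.1 hL j) k) ?_
  refine squeeze_zero_norm (fun i => (norm_entry_le_mnorm (W i) j k).trans (hW i)) ?_
  simpa using (tendsto_rate hp).const_mul C

lemma mnorm_le_of_defect_le {a b : ℕ} {U : Matrix (Fin a) (Fin b) ℂ} (h : mnorm (defect U) ≤ 1) :
    mnorm U ≤ (a + b) * 2 := by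
  refine mnorm_le_of_norm_entry_le (by norm_num) fun i j => ?_
  have h1 : ‖(Uᴴ * U) j j‖ ≤ 2 := by
    have h2 : Uᴴ * U = 1 + defect U := by simp [defect]
    rw [h2, Matrix.add_apply, Matrix.one_apply_eq]
    refine (norm_add_le _ _).trans ?_
    rw [norm_one]
    linarith [norm_entry_le_mnorm (defect U) j j]
  have h3 : (Uᴴ * U) j j = ((∑ k, ‖U k j‖ ^ 2 : ℝ) : ℂ) := by
    rw [Matrix.mul_apply]
    push_cast
    refine Finset.sum_congr rfl fun k _ => ?_
    rw [Matrix.conjTranspose_apply]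
    exact Complex.conj_mul' (U k j)
  rw [h3, Complex.norm_real, Real.norm_eq_abs] at h1
  have h4 : ‖U i j‖ ^ 2 ≤ ∑ k, ‖U k j‖ ^ 2 :=
    Finset.single_le_sum (f := fun k => ‖U k j‖ ^ 2) (fun _ _ => by positivity) (Finset.mem_univ i)
  have h5 := le_abs_self (∑ k, ‖U k j‖ ^ 2)
  nlinarith [norm_nonneg (U i j)]

end Convergence

/-! ### The iteration and its limit -/

section MainConvergence

open Filter Topology

variable {m n l q : ℕ} {c : Composition q} {p : ℕ} {σ : Fin q → ℝ}

lemma Near.mono {M : Matrix (Fin m) (Fin n) ℂ} {a ω ε ε' R R' : ℝ} {T : Triplet m n l q}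
    (h : Near c σ M a ω ε R T) (hε : ε ≤ ε') (hR : R ≤ R') : Near c σ M a ω ε' R' T :=
  ⟨h.defect_U.trans hε, h.defect_V.trans hε, h.residual.trans hε, h.diag, h.dist.trans hR⟩

lemma Contracts.mono {a ω ε₀ ε₁ R₀ G s : ℝ} (h : Contracts m n l p c σ a ω ε₀ R₀ G s)
    (hε : ε₁ ≤ ε₀) : Contracts m n l p c σ a ω ε₁ R₀ G s :=
  fun M ε R T hε' hR => h M ε R T (hε'.trans hε) hR

lemma blockDiag_rectDiagonal : blockDiag c (rectDiagonal l σ) = rectDiagonal l σ := by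
  rw [blockDiag_eq_self_iff]
  intro i j hij
  rw [rectDiagonal, Matrix.of_apply, if_neg]
  intro h
  exact hij (by rw [h]; exact sameBlock_iff.2 rfl)

/-- The bound for the scaled errors after `i` steps. -/
noncomputable def errorBound (p : ℕ) (u lam : ℝ) (i : ℕ) : ℝ :=
  if i = 0 then u else lam * u * rate p i

/-- The iteration is defined and unique if the first and the later steps contract suitably. The
errors are bounded by `errorBound`, and the sum of the displacements of `Σ` stays within `R₀`. -/
lemma exists_unique_iteration (hp : 1 ≤ p) {a ω u lam R₀ G₀ G₁ s₀ s₁ : ℝ} (ha : 0 ≤ a)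
    (hu : 0 ≤ u) (hlam : 0 ≤ lam) (hs₁ : 0 ≤ s₁) (hG₁ : 0 ≤ G₁)
    (h₀ : Contracts m n l p c σ a ω u 0 G₀ s₀)
    (h₁ : Contracts m n l p c σ a ω (lam * u * (1 / 2) ^ p) R₀ G₁ s₁)
    (hG₀u : (G₀ * u) ^ p ≤ lam * (1 / 2) ^ p) (hG₁u : G₁ * (lam * u) ≤ 1 / 2)
    (hR : s₀ * u + 2 * s₁ * (lam * u * (1 / 2) ^ p) ≤ R₀) (M : Matrix (Fin m) (Fin n) ℂ)
    (T₀ : Triplet m n l q) (hT₀ : Near c σ M a ω u 0 T₀) :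
    ∃ T : ℕ → Triplet m n l q, IsIteration p c M T₀ T ∧
      (∀ T', IsIteration p c M T₀ T' → T' = T) ∧
      ∀ i, (∃ R, Near c σ M a ω (errorBound p u lam i) R (T i)) ∧
        mnorm ((T (i + 1)).1 - (T i).1) ≤ mnorm (T i).1 * (30 * errorBound p u lam i) ∧
        mnorm ((T (i + 1)).2.1 - (T i).2.1) ≤ mnorm (T i).2.1 * (30 * errorBound p u lam i) ∧
        ω * mnorm ((T (i + 1)).2.2 - (T i).2.2) ≤ max s₀ s₁ * errorBound p u lam i := by
  have hlu : 0 ≤ lam * u := mul_nonneg hlam hu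
  have he : ∀ i, errorBound p u lam (i + 1) = lam * u * rate p (i + 1) := fun i => by
    rw [errorBound, if_neg (Nat.succ_ne_zero i)]
  have he0 : errorBound p u lam 0 = u := by rw [errorBound, if_pos rfl]
  obtain ⟨T, h1, h2, h3⟩ := exists_unique_orbit (step := IsStep p c M) (x₀ := T₀)
    (P := fun i T => ∃ R, Near c σ M a ω (errorBound p u lam i) R T ∧ (i = 0 → R ≤ 0) ∧
      (i ≠ 0 → R + 2 * s₁ * errorBound p u lam i ≤ R₀))
    (Q := fun i T T' => mnorm (T'.1 - T.1) ≤ mnorm T.1 * (30 * errorBound p u lam i) ∧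
      mnorm (T'.2.1 - T.2.1) ≤ mnorm T.2.1 * (30 * errorBound p u lam i) ∧
      ω * mnorm (T'.2.2 - T.2.2) ≤ max s₀ s₁ * errorBound p u lam i)
    ⟨0, by rwa [he0], fun _ => le_rfl, fun h => absurd rfl h⟩ (by
      rintro i T ⟨R, hN, hi0, hi1⟩
      have hε0 := hN.eps_nonneg ha
      cases i with
      | zero =>
        have hR0 : R ≤ 0 := hi0 rfl
        obtain ⟨T', a1, a2, a3, a4, a5, a6⟩ := h₀ M _ R T (le_of_eq he0) hR0 hN
        refine ⟨T', a1, a2, ⟨_, a3.mono ?_ le_rfl, fun h => absurd h (Nat.succ_ne_zero 0),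
          fun _ => ?_⟩, a4, a5, a6.trans (mul_le_mul_of_nonneg_right (le_max_left _ _) hε0)⟩
        · rw [he, he0, zero_add, rate_one]
          calc (G₀ * u) ^ p * u ≤ lam * (1 / 2) ^ p * u := mul_le_mul_of_nonneg_right hG₀u hu
            _ = _ := by ring
        · rw [he, he0, zero_add, rate_one]
          linarith
      | succ i =>
        rw [he] at hN hi1 hε0 ⊢
        have hR0 := hi1 (Nat.succ_ne_zero i)
        have h4 : lam * u * rate p (i + 1) ≤ lam * u * (1 / 2) ^ p := by
          rw [← rate_one]
          exact mul_le_mul_of_nonneg_left (rate_le_rate_one hp i) hlu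
        have h5 : 0 ≤ 2 * s₁ * (lam * u * rate p (i + 1)) := by positivity
        obtain ⟨T', a1, a2, a3, a4, a5, a6⟩ := h₁ M _ R T h4 (by linarith) hN
        refine ⟨T', a1, a2, ⟨_, a3.mono ?_ le_rfl, fun h => absurd h (Nat.succ_ne_zero _),
          fun _ => ?_⟩, a4, a5, a6.trans (mul_le_mul_of_nonneg_right (le_max_right _ _) hε0)⟩
        · rw [rate_succ p (i + 1)]
          have h6 : 0 ≤ rate p (i + 1) := (rate_pos p _).le
          have h7 : G₁ * (lam * u * rate p (i + 1)) ≤ rate p (i + 1) / 2 := by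
            calc G₁ * (lam * u * rate p (i + 1)) = G₁ * (lam * u) * rate p (i + 1) := by ring
              _ ≤ 1 / 2 * rate p (i + 1) := mul_le_mul_of_nonneg_right hG₁u h6
              _ = _ := by ring
          calc (G₁ * (lam * u * rate p (i + 1))) ^ p * (lam * u * rate p (i + 1))
              ≤ (rate p (i + 1) / 2) ^ p * (lam * u * rate p (i + 1)) := by gcongr
            _ = _ := by ring
        · have h6 : lam * u * rate p (i + 1 + 1) ≤ lam * u * (rate p (i + 1) / 2) :=
            mul_le_mul_of_nonneg_left (rate_succ_le hp _) hlu
          have h7 := mul_le_mul_of_nonneg_left h6 hs₁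
          linarith)
  exact ⟨T, h1, h2, fun i => ⟨(h3 i).1.imp fun R h => h.1, (h3 i).2⟩⟩

/-- The iterates converge because their increments are bounded by `errorBound`, and the defects and
the residual of the limit vanish by continuity. -/
lemma converges_of_bounds (hp : 1 ≤ p) {a ω u lam s : ℝ} (ha : 1 ≤ a) (hω : 0 < ω)
    (hu : 0 ≤ u) (hu1 : u ≤ 1) (hlam1 : lam ≤ 1) {M : Matrix (Fin m) (Fin n) ℂ}
    {T : ℕ → Triplet m n l q}
    (h : ∀ i, (∃ R, Near c σ M a ω (errorBound p u lam i) R (T i)) ∧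
        mnorm ((T (i + 1)).1 - (T i).1) ≤ mnorm (T i).1 * (30 * errorBound p u lam i) ∧
        mnorm ((T (i + 1)).2.1 - (T i).2.1) ≤ mnorm (T i).2.1 * (30 * errorBound p u lam i) ∧
        ω * mnorm ((T (i + 1)).2.2 - (T i).2.2) ≤ s * errorBound p u lam i) :
    ∃ Uinf ∈ Stiefel m l, ∃ Vinf ∈ Stiefel n q, ∃ Sinf ∈ BlockDiagonal c l,
      ConvergesWithOrder (p + 1) T (Uinf, Vinf, Sinf) ∧ Uinfᴴ * M * Vinf = Sinf := by
  have he : ∀ i, errorBound p u lam i ≤ rate p i := fun i => by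
    have hr := rate_pos p i
    rw [errorBound]
    split_ifs with hi
    · rw [hi, rate_zero]; exact hu1
    · exact mul_le_of_le_one_left hr.le (mul_le_one₀ hlam1 hu hu1)
  have he0 : ∀ i, 0 ≤ errorBound p u lam i := fun i => by
    obtain ⟨R, hN⟩ := (h i).1
    exact hN.eps_nonneg (by linarith)
  have hdU : ∀ i, mnorm (defect (T i).1) ≤ 1 * rate p i := fun i => by
    obtain ⟨R, hN⟩ := (h i).1
    rw [one_mul]
    exact ((le_mul_of_one_le_left (mnorm_nonneg _) ha).trans hN.defect_U).trans (he i)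
  have hdV : ∀ i, mnorm (defect (T i).2.1) ≤ 1 * rate p i := fun i => by
    obtain ⟨R, hN⟩ := (h i).1
    rw [one_mul]
    exact ((le_mul_of_one_le_left (mnorm_nonneg _) ha).trans hN.defect_V).trans (he i)
  have hbound : ∀ {a b : ℕ} {U : Matrix (Fin a) (Fin b) ℂ} {i : ℕ},
      mnorm (defect U) ≤ 1 * rate p i →
      mnorm U * (30 * errorBound p u lam i) ≤ ((a + b) * 2 * 30) * rate p i := by
    intro a b U i hU
    have h1 : mnorm U ≤ (a + b) * 2 :=
      mnorm_le_of_defect_le (by linarith [rate_le_one p i])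
    have h2 := he i
    have h3 := he0 i
    calc mnorm U * (30 * errorBound p u lam i) ≤ (a + b) * 2 * (30 * rate p i) := by gcongr
      _ = _ := by ring
  obtain ⟨U, hU, hU'⟩ := exists_limit_of_increments hp (W := fun i => (T i).1)
    fun i => (h i).2.1.trans (hbound (hdU i))
  obtain ⟨V, hV, hV'⟩ := exists_limit_of_increments hp (W := fun i => (T i).2.1)
    fun i => (h i).2.2.1.trans (hbound (hdV i))
  obtain ⟨S, hS, hS'⟩ := exists_limit_of_increments hp (W := fun i => (T i).2.2)
    (C := |s| / ω) fun i => by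
      have h1 := (h i).2.2.2
      have h2 : s * errorBound p u lam i ≤ |s| * rate p i :=
        mul_le_mul (le_abs_self s) (he i) (he0 i) (abs_nonneg s)
      rw [div_mul_eq_mul_div, le_div_iff₀ hω]
      linarith
  have hdefect : ∀ {a b : ℕ} {W : ℕ → Matrix (Fin a) (Fin b) ℂ} {L : Matrix (Fin a) (Fin b) ℂ},
      Tendsto W atTop (𝓝 L) → (∀ i, mnorm (defect (W i)) ≤ 1 * rate p i) → defect L = 0 := by
    intro a b W L hL hW
    have hcont : Continuous fun W : Matrix (Fin a) (Fin b) ℂ => defect W :=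
      (continuous_id.matrix_conjTranspose.matrix_mul continuous_id).sub continuous_const
    exact eq_zero_of_tendsto hp ((hcont.tendsto L).comp hL) hW
  have hres : Uᴴ * M * V - S = 0 := by
    have hcont : Continuous fun z : Matrix (Fin m) (Fin l) ℂ × Matrix (Fin n) (Fin q) ℂ =>
        z.1ᴴ * M * z.2 :=
      (continuous_fst.matrix_conjTranspose.matrix_mul continuous_const).matrix_mul continuous_snd
    have hT : Tendsto (fun i => (T i).1ᴴ * M * (T i).2.1 - (T i).2.2) atTop
        (𝓝 (Uᴴ * M * V - S)) :=
      ((hcont.tendsto (U, V)).comp (hU.prodMk_nhds hV)).sub hS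
    refine eq_zero_of_tendsto hp hT (C := 1 / ω) fun i => ?_
    obtain ⟨R, hN⟩ := (h i).1
    have h1 := hN.residual.trans (he i)
    rw [div_mul_eq_mul_div, le_div_iff₀ hω, one_mul, mul_comm]
    exact h1
  have hdiag : blockDiag c S = S := by
    rw [blockDiag_eq_self_iff]
    intro i j hij
    refine tendsto_nhds_unique (tendsto_pi_nhds.1 (tendsto_pi_nhds.1 hS i) j) ?_
    refine tendsto_const_nhds.congr fun k => ?_
    obtain ⟨R, hN⟩ := (h k).1
    have h1 := blockDiag_eq_self_iff.1 hN.diag i j hij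
    rw [Matrix.sub_apply, blockDiag_eq_self_iff.1 blockDiag_rectDiagonal i j hij, sub_zero] at h1
    exact h1.symm
  refine ⟨U, hdefect hU hdU, V, hdefect hV hdV, S, ⟨S, hdiag⟩, ?_, sub_eq_zero.1 hres⟩
  obtain ⟨C, hC⟩ : ∃ C : ℝ, C = max 1 (max (((m : ℝ) + l) * (2 * (((m : ℝ) + l) * 2 * 30)))
    (max (((n : ℝ) + q) * (2 * (((n : ℝ) + q) * 2 * 30))) (((l : ℝ) + q) * (2 * (|s| / ω))))) :=
    ⟨_, rfl⟩
  refine ⟨C, by rw [hC]; exact lt_max_of_lt_left one_pos, fun i => ?_⟩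
  rw [← rate_eq_zpow]
  have hr := (rate_pos p i).le
  refine max_le ((hU' i).trans ?_) (max_le ((hV' i).trans ?_) ((hS' i).trans ?_)) <;>
    refine mul_le_mul_of_nonneg_right ?_ hr <;> rw [hC]
  · exact (le_max_left _ _).trans (le_max_right _ _)
  · exact ((le_max_left _ _).trans (le_max_right _ _)).trans (le_max_right _ _)
  · exact ((le_max_right _ _).trans (le_max_right _ _)).trans (le_max_right _ _)

/-- Existence, uniqueness and convergence of the iteration whose initial point satisfies the test
with the threshold `u`. -/
lemma iteration_converges (hp : 1 ≤ p) {a ω u lam R₀ G₀ G₁ s₀ s₁ : ℝ} (ha : 1 ≤ a) (hω : 0 < ω)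
    (hu : 0 ≤ u) (hu1 : u ≤ 1) (hlam : 0 ≤ lam) (hlam1 : lam ≤ 1) (hs₁ : 0 ≤ s₁) (hG₁ : 0 ≤ G₁)
    (h₀ : Contracts m n l p c σ a ω u 0 G₀ s₀)
    (h₁ : Contracts m n l p c σ a ω (lam * u * (1 / 2) ^ p) R₀ G₁ s₁)
    (hG₀u : (G₀ * u) ^ p ≤ lam * (1 / 2) ^ p) (hG₁u : G₁ * (lam * u) ≤ 1 / 2)
    (hR : s₀ * u + 2 * s₁ * (lam * u * (1 / 2) ^ p) ≤ R₀) {M : Matrix (Fin m) (Fin n) ℂ}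
    {U₀ : Matrix (Fin m) (Fin l) ℂ} {V₀ : Matrix (Fin n) (Fin q) ℂ}
    (hU₀ : a * mnorm (defect U₀) ≤ u) (hV₀ : a * mnorm (defect V₀) ≤ u)
    (hΔ : ω * mnorm (U₀ᴴ * M * V₀ - rectDiagonal l σ) ≤ u) :
    ∃ T : ℕ → Triplet m n l q, IsIteration p c M (U₀, V₀, rectDiagonal l σ) T ∧
      (∀ T', IsIteration p c M (U₀, V₀, rectDiagonal l σ) T' → T' = T) ∧
      ∃ Uinf ∈ Stiefel m l, ∃ Vinf ∈ Stiefel n q, ∃ Sinf ∈ BlockDiagonal c l,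
        ConvergesWithOrder (p + 1) T (Uinf, Vinf, Sinf) ∧ Uinfᴴ * M * Vinf = Sinf := by
  obtain ⟨T, h1, h2, h3⟩ := exists_unique_iteration hp (by linarith) hu hlam hs₁ hG₁ h₀ h₁ hG₀u
    hG₁u hR M (U₀, V₀, rectDiagonal l σ)
    ⟨hU₀, hV₀, hΔ, by rw [sub_self, blockDiag_zero], by rw [sub_self, mnorm_zero, mul_zero]⟩
  exact ⟨T, h1, h2, converges_of_bounds hp ha hω hu hu1 hlam1 h3⟩

end MainConvergence

end ClusterSVD

theorem mainTheorem7 {m n l q : ℕ} (hql : q ≤ l) (p : ℕ) (hp : 1 ≤ p)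
    (M : Matrix (Fin m) (Fin n) ℂ) (c : Composition q) (δ : ℝ) (hδ : 0 ≤ δ)
    (σ : Fin q → ℝ) (hσ : ClusterSVD.IsClustered c δ σ) (hnd : ClusterSVD.Nondegenerate δ σ)
    (U₀ : Matrix (Fin m) (Fin l) ℂ) (V₀ : Matrix (Fin n) (Fin q) ℂ)
    (htest : ClusterSVD.testEps p δ σ M U₀ V₀ ≤ ClusterSVD.thresholdU p) :
    ∃ T : ℕ → ClusterSVD.Triplet m n l q,
      ClusterSVD.IsIteration p c M (U₀, V₀, ClusterSVD.rectDiagonal l σ) T ∧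
      (∀ T', ClusterSVD.IsIteration p c M (U₀, V₀, ClusterSVD.rectDiagonal l σ) T' → T' = T) ∧
      ∃ Uinf ∈ ClusterSVD.Stiefel m l, ∃ Vinf ∈ ClusterSVD.Stiefel n q,
        ∃ Sinf ∈ ClusterSVD.BlockDiagonal c l,
          ClusterSVD.ConvergesWithOrder (p + 1) T (Uinf, Vinf, Sinf) ∧
          Uinfᴴ * M * Vinf = Sinf := by
  have hC := ClusterSVD.conditioned_of_isClustered hδ hσ hnd
  unfold ClusterSVD.testEps at htest
  set κ := ClusterSVD.kappa δ σ
  set K := ClusterSVD.bigK σ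
  have hκ0 : 0 < κ := by linarith [hC.one_le_kappa]
  have hK0 : 0 < K := by linarith [hC.one_le_K]
  have hκK0 : 0 < κ * K := mul_pos hκ0 hK0
  have hκK1 : 1 ≤ κ * K := one_le_mul_of_one_le_of_one_le hC.one_le_kappa hC.one_le_K
  obtain ⟨hU, hVΔ⟩ := max_le_iff.1 htest
  obtain ⟨hV, hΔ⟩ := max_le_iff.1 hVΔ
  rcases hp.eq_or_lt with rfl | hp2
  · simp only [ClusterSVD.expA, ClusterSVD.thresholdU, if_true] at hU hV hΔ
    have e1 : (κ * K) ^ (2 : ℝ) = (κ * K) ^ 2 := Real.rpow_two _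
    have e2 : κ ^ (2 : ℝ) * K ^ ((2 : ℝ) - 1) = κ * (κ * K) := by
      rw [Real.rpow_two, show (2 : ℝ) - 1 = 1 by norm_num, Real.rpow_one]; ring
    rw [e1] at hU hV
    rw [e2] at hΔ
    obtain ⟨s₀, s₁, hs₁, h₀, h₁, hR⟩ := hC.contracts_one (m := m) (n := n) hql rfl
    exact ClusterSVD.iteration_converges (lam := 0.8) le_rfl (one_le_pow₀ hκK1)
      (mul_pos hκ0 hκK0) (by norm_num) (by norm_num) (by norm_num) (by norm_num) hs₁ (by norm_num)
      h₀ (h₁.mono (by norm_num)) (by norm_num) (by norm_num)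
      (by rw [pow_one]; linarith) hU hV hΔ
  · have hp1 : p ≠ 1 := by omega
    simp only [ClusterSVD.expA, ClusterSVD.thresholdU, if_neg hp1] at hU hV hΔ
    have hth : (if p = 2 then 0.046 else 0.0297 : ℝ) ≤ 0.046 := by split_ifs <;> norm_num
    set h := (κ * K) ^ (1 / 3 : ℝ) with hh
    have hh1 : 1 ≤ h := Real.one_le_rpow hκK1 (by norm_num)
    have hh3 : h ^ 3 = κ * K := by
      rw [hh, ← Real.rpow_natCast, ← Real.rpow_mul hκK0.le]
      norm_num
    have e1 : (κ * K) ^ (4 / 3 : ℝ) = h ^ 4 := by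
      rw [hh, ← Real.rpow_natCast, ← Real.rpow_mul hκK0.le]
      norm_num
    have e2 : κ ^ (4 / 3 : ℝ) * K ^ ((4 / 3 : ℝ) - 1) = κ * h := by
      rw [hh, Real.mul_rpow hκ0.le hK0.le, ← mul_assoc,
        show (4 / 3 : ℝ) = 1 + 1 / 3 by norm_num, Real.rpow_add hκ0, Real.rpow_one]
      norm_num
    rw [e1] at hU hV
    rw [e2] at hΔ
    obtain ⟨s₀, s₁, hs₁, h₀, h₁, hR⟩ := hC.contracts_of_two_le (m := m) (n := n) (p := p) hp2 hql
      hh1 hh3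
    have hpow : ((1 : ℝ) / 2) ^ p ≤ 1 / 4 :=
      (pow_le_pow_of_le_one (by norm_num) (by norm_num) hp2).trans (by norm_num)
    have hε : 0.83 * 0.046 * ((1 : ℝ) / 2) ^ p ≤ 0.83 * 0.046 / 4 := by linarith
    refine ClusterSVD.iteration_converges (lam := 0.83) hp (one_le_pow₀ hh1)
      (mul_pos hκ0 (by linarith)) (by norm_num) (by norm_num) (by norm_num) (by norm_num) hs₁
      (by norm_num) h₀ (h₁.mono hε) ?_ (by norm_num) ?_ (hU.trans hth) (hV.trans hth)
      (hΔ.trans hth)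
    -- `2 * 9.9 * 0.046 < 1`, so the condition on the first step is sharpest for `p = 2`
    · have h2 : ((9.9 * 0.046 * 2 : ℝ)) ^ p ≤ (9.9 * 0.046 * 2) ^ 2 :=
        pow_le_pow_of_le_one (by norm_num) (by norm_num) hp2
      calc (9.9 * 0.046 : ℝ) ^ p = (9.9 * 0.046 * 2) ^ p * (1 / 2) ^ p := by
            rw [← mul_pow]; norm_num
        _ ≤ 0.83 * (1 / 2) ^ p :=
            mul_le_mul_of_nonneg_right (h2.trans (by norm_num)) (by positivity)
    · have := mul_le_mul_of_nonneg_left hε hs₁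
      linarith
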